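/- Let $N\ge 1$ and $k$ be integers, $\Gamma=\Gamma_0(N)$, $\mathbb H=\{\tau=u+iv: v>0\}$, and $(h|_m\gamma)(\tau)=(c\tau+d)^{-m}h(\gamma\tau)$ for $\gamma=\begin{pmatrix}a&b\\c&d\end{pmatrix}\in SL_2(\mathbb Z)$. Put $\Theta=\frac1{2\pi i}\frac{d}{d\tau}$ and $$\mathcal D_kf=\frac{\Theta f}{f}-\frac{k}{4\pi v},\qquad \xi_m h=2i\,v^m\,\overline{\frac{\partial h}{\partial\overline\tau}},\qquad \Delta_m=-\xi_{2-m}\circ\xi_m .$$ Let $\mathcal C_N=\Gamma\backslash(\mathbb Q\cup\{i\infty\})$. For each $\rho\in\mathcal C_N$ let $\sigma_\rho\in SL_2(\mathbb Z)$ be such that $\sigma_\rho i\infty$ represents $\rho$, and let the width $\ell_\rho$ be the least integer $\ell\ge1$ with $\sigma_\rho\begin{pmatrix}1&\ell\\0&1\end{pmatrix}\sigma_\rho^{-1}\in\Gamma$. Let $\mathcal F\subset\mathbb H$ be (the part in $\mathbb H$ of) a closed fundamental domain for $\Gamma$: $\mathcal F$ is closed in $\mathbb H$ with boundary of measure zero,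 its $\Gamma$-translates cover $\mathbb H$, the interiors of $\mathcal F$ and $\gamma\mathcal F$ are disjoint for $\gamma\in\Gamma$, $\gamma\neq\pm I$, and $\mathcal F$ together with its cusps is compact in the following sense. For $c=\sigma i\infty\in\mathbb Q\cup\{i\infty\}$ with $\sigma\in SL_2(\mathbb Z)$ put $H_{c,y}=\{\sigma\tau:\operatorname{Im}\tau>y\}$; the set $S$ of cusps of $\mathcal F$, i.e. of those $c$ with $\mathcal F\cap H_{c,y}\ne\emptyset$ for all $y>0$, is finite, and $\mathcal F\setminus\bigcup_{c\in S}H_{c,y}$ is compact for all $y>0$. For $\Gamma$-invariant functions $\varphi,\psi$ on $\mathbb H$ that are smooth except at singularities, of which only finitely many points $z_1,\dots,z_n$ lie in $\mathcal F$, the regularized Petersson inner product is $$\langle\varphi,\psi\rangle^{\mathrm{reg}}=\lim_{\varepsilon\to0^+}\ \lim_{y\to\infty}\int_{\mathcal F^{\varepsilon,y}}\varphi\,\overline{\psi}\,\frac{du\,dv}{v^2},\qquad \mathcal F^{\varepsilon,y}=\mathcal F\setminus\Big(\bigcup_j\{|\tau-z_j|<\varepsilon\}\cup\bigcup_{c\in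 S}H_{c,y}\Big),$$ if the limit exists. **Theorem.** Let $f\not\equiv0$ be a meromorphic modular form of weight $k$ on $\Gamma$ (meromorphic on $\mathbb H$ and at all cusps), and let $g:\mathbb H\to\mathbb C$ be a $C^\infty$ function with $g|_2\gamma=g$ for all $\gamma\in\Gamma$. Suppose that for every $\rho\in\mathcal C_N$ the limits $$C_{1,\rho}=-2\pi\lim_{y\to\infty}\int_{iy}^{\ell_\rho+iy}(\mathcal D_kf)|_2\sigma_\rho(\tau)\cdot(\xi_2g)|_0\sigma_\rho(\tau)\,d\tau,$$ $$C_{2,\rho}=\lim_{y\to\infty}\int_{iy}^{\ell_\rho+iy}\Big(\log\big(v^{k/2}|(f|_k\sigma_\rho)(\tau)|\big)\cdot(\Delta_2g)|_2\sigma_\rho(\tau)+\frac k2\,(g|_2\sigma_\rho)(\tau)\Big)d\tau$$ exist. Then $\xi_2\Delta_2 g$ and $\log(v^{k/2}|f|)$ have only finitely many singularities in $\mathcal F$, their regularized inner product exists, and $$\big\langle \xi_2\Delta_2g,\ \log(v^{k/2}|f|)\big\rangle^{\mathrm{reg}}=-2\pi\sum_{z\in\Gamma\backslash\mathbb H}\frac{\operatorname{ord}_z(f)}{\omega_z}\,\xi_2g(z)+\sum_{\rho\in\mathcal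 C_N}\Big(C_{1,\rho}+\overline{C_{2,\rho}}\Big),$$ where $\omega_z$ is the order of the stabilizer of $z$ in $\Gamma/\{\pm I\}$. -/

import Mathlib

open UpperHalfPlane hiding I
open Complex Filter Topology MeasureTheory CongruenceSubgroup
open scoped MatrixGroups ModularForm ContDiff Real Pointwise ComplexConjugate

noncomputable section

namespace RohrlichDivisor

/-! ### Differential operators on functions `ℍ → ℂ` (points are written `τ = u + i v`) -/

/-- The Wirtinger derivative `∂φ/∂τ̄ = (1/2) (∂φ/∂u + i ∂φ/∂v)`. -/
def dbar (φ : ℍ → ℂ) (τ : ℍ) : ℂ :=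
  (1 / 2) * (fderiv ℝ (φ ∘ ofComplex) (τ : ℂ) 1 + I * fderiv ℝ (φ ∘ ofComplex) (τ : ℂ) I)

/-- `ξ_k φ = 2 i v^k conj (∂φ/∂τ̄)`. -/
def xiOp (k : ℤ) (φ : ℍ → ℂ) (τ : ℍ) : ℂ :=
  2 * I * (τ.im : ℂ) ^ k * conj (dbar φ τ)

/-- `Δ_k = - ξ_{2-k} ∘ ξ_k`. -/
def lapOp (k : ℤ) (φ : ℍ → ℂ) (τ : ℍ) : ℂ :=
  - xiOp (2 - k) (xiOp k φ) τ

/-- `𝒟_k f = Θf / f - k / (4 π v)` with `Θ = (2 π i)⁻¹ d/dτ`. -/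
def logDerivOp (k : ℤ) (f : ℍ → ℂ) (τ : ℍ) : ℂ :=
  Derivative.normalizedDerivOfComplex f τ / f τ - (k : ℂ) / (4 * π * τ.im)

/-- The real number `log (v^{k/2} |f(τ)|)`, as a complex number. -/
def logNorm (k : ℤ) (f : ℍ → ℂ) (τ : ℍ) : ℂ :=
  (Real.log (τ.im ^ ((k : ℝ) / 2) * ‖f τ‖) : ℂ)

/-! ### Cusps -/

/-- The set `Γ₀(N) \ (ℚ ∪ {i∞})` of cusps of `Γ₀(N)`. -/
abbrev CuspClass (N : ℕ) : Type :=
  MulAction.orbitRel.Quotient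
    ((Gamma0 N).map (Matrix.SpecialLinearGroup.mapGL ℚ)) (OnePoint ℚ)

/-- The point `σ i∞` of `ℚ ∪ {i∞}`. -/
def cuspOf (σ : SL(2, ℤ)) : OnePoint ℚ :=
  Matrix.SpecialLinearGroup.mapGL ℚ σ • (OnePoint.infty : OnePoint ℚ)

/-- The class of `σ i∞` in `Γ₀(N) \ (ℚ ∪ {i∞})`. -/
def cuspClassOf (N : ℕ) (σ : SL(2, ℤ)) : CuspClass N :=
  Quotient.mk _ (cuspOf σ)

/-- The width of the cusp `σ i∞`: the least `n ≥ 1` with `σ (1 n; 0 1) σ⁻¹ ∈ Γ₀(N)`.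
(As `-I ∈ Γ₀(N)`, a sign in front of the translation would change nothing.) -/
def cuspWidth (N : ℕ) (σ : SL(2, ℤ)) : ℕ :=
  sInf {n : ℕ | 0 < n ∧ σ * ModularGroup.T ^ n * σ⁻¹ ∈ Gamma0 N}

/-! ### Modular forms -/

/-- Meromorphic modular forms of weight `k` on `Γ₀(N)`: meromorphic on `ℍ` and at all cusps. A
meromorphic function is represented by the function which is analytic off its poles
and takes the value `0` at its poles. -/
structure IsMeromorphicModularForm (N : ℕ) (k : ℤ) (f : ℍ → ℂ) : Prop where
  meromorphic : MeromorphicNFOn (f ∘ ofComplex) upperHalfPlaneSet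
  slash_eq : ∀ γ ∈ Gamma0 N, f ∣[k] γ = f
  /-- at the cusp `σ i∞` of width `ℓ`, `f ∣[k] σ` is meromorphic in `exp (2 π i τ / ℓ)` at `0` -/
  meromorphic_at_cusps : ∀ σ : SL(2, ℤ), MeromorphicAt
    (Function.Periodic.cuspFunction (cuspWidth N σ) ((f ∣[k] σ) ∘ ofComplex)) 0

/-- Smooth modular forms of weight `k` on `Γ₀(N)`, without singularities on `ℍ`; nothing is
required at the cusps. -/
structure IsSmoothModularForm (N : ℕ) (k : ℤ) (g : ℍ → ℂ) : Prop where
  smooth : ContDiffOn ℝ ∞ (g ∘ ofComplex) upperHalfPlaneSet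
  slash_eq : ∀ γ ∈ Gamma0 N, g ∣[k] γ = g

/-- The order of `f` at `z ∈ ℍ`. -/
def ordAt (f : ℍ → ℂ) (z : ℍ) : ℤ :=
  (meromorphicOrderAt (f ∘ ofComplex) (z : ℂ)).untop₀

/-- `ω_z`: the order of the stabilizer of `z` in `Γ₀(N) / {± I}`, taken inside
`SL(2, ℤ) / {± I}`. -/
def stabOrder (N : ℕ) (z : ℍ) : ℕ :=
  Nat.card ((MulAction.stabilizer SL(2, ℤ) z ⊓ Gamma0 N).map
    (QuotientGroup.mk' (Subgroup.center SL(2, ℤ))))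

/-! ### Fundamental domains and the regularized inner product -/

/-- The horoball `{σ τ : Im τ > y}` at `ρ = σ i∞`, where `σ ∈ SL(2, ℤ)`; it does not depend on
the choice of `σ`. -/
def horoball (ρ : OnePoint ℚ) (y : ℝ) : Set ℍ :=
  {τ | ∃ σ : SL(2, ℤ), cuspOf σ = ρ ∧ ∃ τ' : ℍ, y < τ'.im ∧ σ • τ' = τ}

/-- The cusps of `F`: the points of `ℚ ∪ {i∞}` in the closure of `F` in `ℍ ∪ ℚ ∪ {i∞}`, where the
neighbourhoods of `ρ ∈ ℚ ∪ {i∞}` are generated by the horoballs at `ρ` together with `ρ`. -/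
def cuspsOf (F : Set ℍ) : Set (OnePoint ℚ) :=
  {ρ | ∀ y : ℝ, 0 < y → (F ∩ horoball ρ y).Nonempty}

/-- `F` is the part in `ℍ` of a closed fundamental domain for the action of `Γ₀(N)` on
`ℍ ∪ ℚ ∪ {i∞}`: it has finitely many cusps and, once these are added, it is compact. -/
structure IsClosedFundamentalDomain (N : ℕ) (F : Set ℍ) : Prop where
  isClosed : IsClosed F
  covers : ∀ τ : ℍ, ∃ γ ∈ Gamma0 N, γ • τ ∈ F
  disjoint_interior : ∀ γ ∈ Gamma0 N, γ ≠ 1 → γ ≠ -1 →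
    Disjoint (interior F) (γ • interior F)
  volume_frontier : volume (frontier F) = 0
  finite_cusps : (cuspsOf F).Finite
  isCompact_truncation : ∀ y : ℝ, 0 < y → IsCompact (F \ ⋃ ρ ∈ cuspsOf F, horoball ρ y)

/-- The singularities of a function on `ℍ`: the points at which it is not smooth. -/
def singularSet (φ : ℍ → ℂ) : Set ℍ :=
  {z | ¬ ContDiffAt ℝ ∞ (φ ∘ ofComplex) (z : ℂ)}

/-- The punctured fundamental domain: Euclidean `ε`-discs around the points of `Z` and horoballs of
height `y` at the cusps of `F` are removed from `F`. -/
def puncturedDomain (F Z : Set ℍ) (ε y : ℝ) : Set ℍ :=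
  F \ ((⋃ z ∈ Z, {τ : ℍ | ‖(τ : ℂ) - (z : ℂ)‖ < ε}) ∪ ⋃ ρ ∈ cuspsOf F, horoball ρ y)

/-- The regularized Petersson inner product
`⟨φ, ψ⟩^reg = lim_{ε → 0} lim_{y → ∞} ∫ φ conj(ψ) du dv / v²` over the punctured fundamental domain,
where the discs are centred at the singularities of `φ` and `ψ` in `F`, is defined and equal
to `c`. The measure `volume` on `ℍ` is `du dv / v²`. -/
structure HasRegInner (F : Set ℍ) (φ ψ : ℍ → ℂ) (c : ℂ) : Prop where
  finite_singularities : ((singularSet φ ∪ singularSet ψ) ∩ F).Finite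
  integrable : ∀ᶠ ε in 𝓝[>] (0 : ℝ), ∀ᶠ y in (atTop : Filter ℝ),
    IntegrableOn (fun τ : ℍ ↦ φ τ * conj (ψ τ))
      (puncturedDomain F ((singularSet φ ∪ singularSet ψ) ∩ F) ε y) volume
  hasLimit : ∃ J : ℝ → ℂ,
    (∀ᶠ ε in 𝓝[>] (0 : ℝ), Tendsto (fun y : ℝ ↦
      ∫ τ in puncturedDomain F ((singularSet φ ∪ singularSet ψ) ∩ F) ε y,
        φ τ * conj (ψ τ)) atTop (𝓝 (J ε))) ∧
    Tendsto J (𝓝[>] (0 : ℝ)) (𝓝 c)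

/-! ### The two sides of the formula -/

/-- The integral `∫_{iy}^{ℓ + iy} h(τ) dτ` along a horizontal segment. -/
def horizontalIntegral (ℓ : ℕ) (h : ℍ → ℂ) (y : ℝ) : ℂ :=
  ∫ t in (0 : ℝ)..ℓ, h (ofComplex ((t : ℂ) + (y : ℂ) * I))

/-- The function of `y` whose limit is `C_{1,ρ}(f, g)`, for `ρ = σ i∞`. -/
def cuspTerm₁ (N : ℕ) (k : ℤ) (f g : ℍ → ℂ) (σ : SL(2, ℤ)) (y : ℝ) : ℂ :=
  -2 * π * horizontalIntegral (cuspWidth N σ)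
    (fun τ ↦ (logDerivOp k f ∣[(2 : ℤ)] σ) τ * (xiOp 2 g ∣[(0 : ℤ)] σ) τ) y

/-- The function of `y` whose limit is `C_{2,ρ}(f, g)`, for `ρ = σ i∞`. -/
def cuspTerm₂ (N : ℕ) (k : ℤ) (f g : ℍ → ℂ) (σ : SL(2, ℤ)) (y : ℝ) : ℂ :=
  horizontalIntegral (cuspWidth N σ)
    (fun τ ↦ logNorm k (f ∣[k] σ) τ * (lapOp 2 g ∣[(2 : ℤ)] σ) τ
      + (k : ℂ) / 2 * (g ∣[(2 : ℤ)] σ) τ) y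

/-- `∑_{z ∈ Γ₀(N) \ ℍ} (ord_z f / ω_z) h(z)`, for `f` of some weight and `h` invariant under
`Γ₀(N)`; the summand then depends only on the orbit of `z`. -/
def divisorSum (N : ℕ) (f h : ℍ → ℂ) : ℂ :=
  ∑ᶠ x : MulAction.orbitRel.Quotient (Gamma0 N) ℍ,
    (ordAt f x.out : ℂ) / (stabOrder N x.out : ℂ) * h x.out

end RohrlichDivisor

end

open RohrlichDivisor

/-! The formula is Stokes' theorem. Write `L = log (v^{k/2} |f|)`, `D = 𝒟_k f`, `G = ξ_2 g`, `h =
Δ_2 g`. Then `∂L/∂τ̄ = -π i conj D`, while `∂G/∂τ̄` and `∂h/∂τ̄` are the conjugates of `h` and `ξ_2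
h` up to elementary factors. Hence `ξ_2 h · L / v²` is a combination of the `τ̄`-derivative of `D G`
and the conjugate of the `τ̄`-derivative of `L h + (k/2) g`: the mixed terms `D conj h` cancel, and
the term `(k/2) g` cancels what `-k/(4πv)` contributes to `∂D/∂τ̄`. The singularities of `L` are too
weak to contribute; the poles of `f'/f` contribute `ord_z(f) ξ_2 g(z)`, and the horocycles at the
cusps contribute the cusp terms.

Consequently the formula is exact at every large finite height `y`, with `cuspTerm₁` and `cuspTerm₂`
at height `y` in place of their limits: this is `IsClosedFundamentalDomain.setIntegral_eq`. The
theorem is the limit `y → ∞`. The integrand is locally integrable across the zeros and poles of `f`,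
so the `ε`-discs disappear in the limit (`hasRegInner_of_tendsto`).

The frontier of `F` is only assumed to be null, so Stokes is not applied to `F` itself. Instead
`exists_partition` provides a compactly supported smooth `X` whose translates under `SL(2, ℤ)` sum
to `1` on the truncated plane. Unfolding (`setIntegral_unfold`,
`IsClosedFundamentalDomain.setIntegral_inter`) turns the integral over `F` into a sum over the
cosets of `Γ₀(N)` of integrals weighted by `X` over `Im τ ≤ y`, where the boundary is a straight
line and `IsNonzeroMeromorphic.green` applies to `f ∣ γ`, `g ∣ γ`. Four kinds of terms come out.
Those containing `∂X/∂τ̄` sum to zero, since unfolding them once more produces the derivative of the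
constant `1` (`setIntegral_dbar_eq_zero`, `sum_setIntegral_dbar_eq_zero`). The two line integrals
reassemble into closed horocycles, because the cosets are indexed by a cusp and a residue modulo its
width (`bijective_cusps`, `sum_integral_horizontal`). The point terms become the sum over orbits
with weights `1/ω_z` (`divisorSum_unfold`). The factors `2` and `1/2` throughout come from `-I`,
which acts trivially but is counted in sums over `SL(2, ℤ)`. -/

noncomputable section

namespace RohrlichDivisor

/-! ### The Wirtinger derivative on `ℂ` -/

/-- The Wirtinger derivative `∂ψ/∂w̄` of a function on `ℂ`. -/
def dbarC (ψ : ℂ → ℂ) (w : ℂ) : ℂ :=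
  (1 / 2) * (fderiv ℝ ψ w 1 + I * fderiv ℝ ψ w I)

lemma dbar_eq_dbarC (φ : ℍ → ℂ) (τ : ℍ) : dbar φ τ = dbarC (φ ∘ ofComplex) τ := rfl

lemma dbarC_congr {φ ψ : ℂ → ℂ} {w : ℂ} (h : φ =ᶠ[𝓝 w] ψ) : dbarC φ w = dbarC ψ w := by
  rw [dbarC, dbarC, h.fderiv_eq]

lemma dbarC_add {φ ψ : ℂ → ℂ} {w : ℂ} (hφ : DifferentiableAt ℝ φ w)
    (hψ : DifferentiableAt ℝ ψ w) :
    dbarC (fun z ↦ φ z + ψ z) w = dbarC φ w + dbarC ψ w := by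
  simp only [dbarC, fderiv_fun_add hφ hψ, add_apply]
  ring

lemma dbarC_mul {φ ψ : ℂ → ℂ} {w : ℂ} (hφ : DifferentiableAt ℝ φ w)
    (hψ : DifferentiableAt ℝ ψ w) :
    dbarC (fun z ↦ φ z * ψ z) w = dbarC φ w * ψ w + φ w * dbarC ψ w := by
  simp only [dbarC, fderiv_fun_mul hφ hψ, add_apply, smul_apply,
    smul_eq_mul]
  ring

lemma dbarC_const_mul {φ : ℂ → ℂ} {w : ℂ} (c : ℂ) (hφ : DifferentiableAt ℝ φ w) :
    dbarC (fun z ↦ c * φ z) w = c * dbarC φ w := by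
  simp only [dbarC, fderiv_const_mul hφ, smul_apply, smul_eq_mul]
  ring

lemma dbarC_sum {ι : Type*} (s : Finset ι) {φ : ι → ℂ → ℂ} {w : ℂ}
    (hφ : ∀ i ∈ s, DifferentiableAt ℝ (φ i) w) :
    dbarC (fun z ↦ ∑ i ∈ s, φ i z) w = ∑ i ∈ s, dbarC (φ i) w := by
  simp only [dbarC, fderiv_fun_sum hφ, sum_apply, Finset.mul_sum,
    ← Finset.sum_add_distrib]

lemma dbarC_const (c w : ℂ) : dbarC (fun _ ↦ c) w = 0 := by
  simp [dbarC]

lemma dbarC_eq_of_hasFDerivAt {ψ : ℂ → ℂ} {w : ℂ} {L : ℂ →L[ℝ] ℂ} (h : HasFDerivAt ψ L w) :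
    dbarC ψ w = (1 / 2) * (L 1 + I * L I) := by
  rw [dbarC, h.fderiv]

lemma dbarC_of_differentiableAt {f : ℂ → ℂ} {w : ℂ} (h : DifferentiableAt ℂ f w) :
    dbarC f w = 0 := by
  rw [dbarC_eq_of_hasFDerivAt h.hasDerivAt.complexToReal_fderiv]
  simp only [smul_apply, one_apply_eq_self, smul_eq_mul]
  linear_combination (1 / 2) * deriv f w * I_mul_I

lemma hasFDerivAt_conj_comp {f : ℂ → ℂ} {f' w : ℂ} (h : HasDerivAt f f' w) :
    HasFDerivAt (fun z ↦ conj (f z)) ((conjCLE : ℂ →L[ℝ] ℂ) ∘L (f' • (1 : ℂ →L[ℝ] ℂ))) w :=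
  (conjCLE : ℂ ≃L[ℝ] ℂ).hasFDerivAt.comp w h.complexToReal_fderiv

lemma dbarC_conj {f : ℂ → ℂ} {f' w : ℂ} (h : HasDerivAt f f' w) :
    dbarC (fun z ↦ conj (f z)) w = conj f' := by
  rw [dbarC_eq_of_hasFDerivAt (hasFDerivAt_conj_comp h)]
  simp
  linear_combination (-1 / 2) * conj f' * I_mul_I

/-- As `g` is holomorphic, the term of the chain rule with `∂f/∂w` carries the factor `∂g/∂w̄ = 0`,
and only `∂f/∂w̄` times the conjugate of `g'` survives. -/
lemma dbarC_comp {f g : ℂ → ℂ} {g' w : ℂ} (hf : DifferentiableAt ℝ f (g w))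
    (hg : HasDerivAt g g' w) :
    dbarC (fun z ↦ f (g z)) w = dbarC f (g w) * conj g' := by
  have h : HasFDerivAt (fun z ↦ f (g z)) _ w := hf.hasFDerivAt.comp w hg.complexToReal_fderiv
  rw [dbarC_eq_of_hasFDerivAt h, dbarC]
  have key (z : ℂ) : fderiv ℝ f (g w) z =
      z.re * fderiv ℝ f (g w) 1 + z.im * fderiv ℝ f (g w) I := by
    conv_lhs => rw [← re_add_im z, show (z.re : ℂ) + z.im * I = z.re • (1 : ℂ) + z.im • I by simp]
    rw [map_add, map_smul, map_smul]
    simp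
  simp only [ContinuousLinearMap.comp_apply, smul_apply,
    one_apply_eq_self, smul_eq_mul]
  rw [key (g' * 1), key (g' * I)]
  have hc : conj g' = g'.re - g'.im * I := by
    apply Complex.ext <;> simp
  rw [hc]
  simp only [mul_one, mul_re, mul_im, Complex.I_re, Complex.I_im, mul_zero, zero_sub, ofReal_neg,
    add_zero, mul_one]
  linear_combination (g'.im : ℂ) * (1 / 2) * fderiv ℝ f (g w) I * I_mul_I

lemma dbarC_ofReal_comp {f : ℝ → ℝ} {f' : ℝ} {φ : ℂ → ℝ} {w : ℂ} (hf : HasDerivAt f f' (φ w))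
    (hφ : DifferentiableAt ℝ φ w) :
    dbarC (fun z ↦ (f (φ z) : ℂ)) w = f' * dbarC (fun z ↦ (φ z : ℂ)) w := by
  have h1 : HasFDerivAt (fun z ↦ (φ z : ℂ)) (ofRealCLM ∘L fderiv ℝ φ w) w :=
    ofRealCLM.hasFDerivAt.comp w hφ.hasFDerivAt
  have h2 : HasFDerivAt (fun z ↦ (f (φ z) : ℂ)) (ofRealCLM ∘L (f' • fderiv ℝ φ w)) w :=
    ofRealCLM.hasFDerivAt.comp w (hf.comp_hasFDerivAt w hφ.hasFDerivAt)
  rw [dbarC_eq_of_hasFDerivAt h1, dbarC_eq_of_hasFDerivAt h2]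
  simp
  ring

lemma dbarC_im (w : ℂ) : dbarC (fun z ↦ (z.im : ℂ)) w = I / 2 := by
  have h : HasFDerivAt (fun z : ℂ ↦ (z.im : ℂ)) (ofRealCLM ∘L imCLM) w :=
    (ofRealCLM ∘L imCLM).hasFDerivAt
  rw [dbarC_eq_of_hasFDerivAt h]
  simp
  ring

lemma continuous_dbarC {ψ : ℂ → ℂ} (hψ : ContDiff ℝ 1 ψ) : Continuous (dbarC ψ) := by
  have h := hψ.continuous_fderiv one_ne_zero
  unfold dbarC
  fun_prop

lemma hasCompactSupport_dbarC {ψ : ℂ → ℂ} (hψ : HasCompactSupport ψ) :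
    HasCompactSupport (dbarC ψ) := by
  refine (hψ.fderiv ℝ).mono fun w hw ↦ ?_
  contrapose! hw
  simp only [Function.mem_support, not_not] at hw
  simp [dbarC, hw]

/-! ### The Cauchy–Green formula on a half plane -/

lemma isClosedEmbedding_verticalLine (u : ℝ) :
    IsClosedEmbedding (fun v : ℝ ↦ (u : ℂ) + v * I) := by
  refine (Isometry.of_dist_eq fun a b ↦ ?_).isClosedEmbedding
  rw [dist_add_left, dist_eq_norm, ← sub_mul, norm_mul, norm_I, mul_one, ← ofReal_sub, norm_real,
    dist_eq_norm]

lemma isClosedEmbedding_horizontalLine (v : ℝ) :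
    IsClosedEmbedding (fun u : ℝ ↦ (u : ℂ) + v * I) := by
  refine (Isometry.of_dist_eq fun a b ↦ ?_).isClosedEmbedding
  rw [dist_add_right, dist_eq_norm, ← ofReal_sub, norm_real, dist_eq_norm]

/-- Green's formula on the half plane `Im w ≤ y`. -/
lemma integral_dbarC_halfPlane {ψ : ℂ → ℂ} (hψ : ContDiff ℝ 1 ψ) (hc : HasCompactSupport ψ)
    (y : ℝ) :
    ∫ w in {w : ℂ | w.im ≤ y}, 2 * I * dbarC ψ w = - ∫ u : ℝ, ψ (u + y * I) := by
  have hd := hψ.differentiable one_ne_zero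
  have hemb (u : ℝ) : IsClosedEmbedding (fun v : ℝ ↦ (u : ℂ) + v * I) :=
    isClosedEmbedding_verticalLine u
  have hemb' (v : ℝ) : IsClosedEmbedding (fun u : ℝ ↦ (u : ℂ) + v * I) :=
    isClosedEmbedding_horizontalLine v
  have hmeas : MeasurableSet {w : ℂ | w.im ≤ y} := measurableSet_le measurable_im measurable_const
  have hcont1 : Continuous (fun w ↦ fderiv ℝ ψ w 1) :=
    (hψ.continuous_fderiv one_ne_zero).clm_apply continuous_const
  have hcontI : Continuous (fun w ↦ fderiv ℝ ψ w I) :=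
    (hψ.continuous_fderiv one_ne_zero).clm_apply continuous_const
  have hsupp1 : HasCompactSupport (fun w ↦ fderiv ℝ ψ w 1) := hc.fderiv_apply ℝ 1
  have hsuppI : HasCompactSupport (fun w ↦ fderiv ℝ ψ w I) := hc.fderiv_apply ℝ I
  have hint1 := hcont1.integrable_of_hasCompactSupport (μ := volume) hsupp1
  have hintI := hcontI.integrable_of_hasCompactSupport (μ := volume) hsuppI
  have hderu (u v : ℝ) : HasDerivAt (fun t : ℝ ↦ ψ (t + v * I)) (fderiv ℝ ψ (u + v * I) 1) u := by
    have h := (hd ((u : ℂ) + v * I)).hasFDerivAt.comp_hasDerivAt u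
      (((hasDerivAt_id u).ofReal_comp).add_const ((v : ℂ) * I))
    simpa [Function.comp_def] using h
  have hderv (u v : ℝ) : HasDerivAt (fun t : ℝ ↦ ψ (u + t * I)) (fderiv ℝ ψ (u + v * I) I) v := by
    have h := (hd ((u : ℂ) + v * I)).hasFDerivAt.comp_hasDerivAt v
      ((((hasDerivAt_id v).ofReal_comp).mul_const I).const_add (u : ℂ))
    simpa [Function.comp_def] using h
  have hpre : MeasurePreserving (measurableEquivRealProd.symm) (volume : Measure (ℝ × ℝ)) volume :=
    volume_preserving_equiv_real_prod.symm
  have hset : measurableEquivRealProd.symm ⁻¹' {w : ℂ | w.im ≤ y} = Set.univ ×ˢ Set.Iic y := by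
    ext p; simp [measurableEquivRealProd_symm_apply]
  have htr (φ : ℂ → ℂ) : ∫ w in {w : ℂ | w.im ≤ y}, φ w =
      ∫ p : ℝ × ℝ in Set.univ ×ˢ Set.Iic y, φ (p.1 + p.2 * I) := by
    rw [← hpre.setIntegral_preimage_emb measurableEquivRealProd.symm.measurableEmbedding, hset]
    simp [measurableEquivRealProd_symm_apply, mk_eq_add_mul_I]
  have htri (φ : ℂ → ℂ) (hφ : Integrable φ) : IntegrableOn
      (fun p : ℝ × ℝ ↦ φ (p.1 + p.2 * I)) (Set.univ ×ˢ Set.Iic y) (volume.prod volume) := by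
    have := (hpre.integrable_comp_emb measurableEquivRealProd.symm.measurableEmbedding
      (g := φ)).mpr hφ
    refine (this.congr (Eventually.of_forall fun p ↦ ?_)).integrableOn
    simp [measurableEquivRealProd_symm_apply, mk_eq_add_mul_I]
  -- The horizontal derivative integrates to zero along each full horizontal line.
  have hA : ∫ w in {w : ℂ | w.im ≤ y}, fderiv ℝ ψ w 1 = 0 := by
    rw [htr, Measure.volume_eq_prod, setIntegral_prod _ (htri _ hint1)]
    rw [← Measure.restrict_univ (μ := (volume : Measure ℝ)), integral_integral_swap]
    · refine integral_eq_zero_of_ae (Eventually.of_forall fun v ↦ ?_)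
      simp only [Measure.restrict_univ, Pi.zero_apply]
      rw [integral_eq_zero_of_hasDerivAt_of_integrable (fun u ↦ hderu u v)]
      · exact (hcont1.comp (hemb' v).continuous).integrable_of_hasCompactSupport
          (hsupp1.comp_isClosedEmbedding (hemb' v))
      · exact (hψ.continuous.comp (hemb' v).continuous).integrable_of_hasCompactSupport
          (hc.comp_isClosedEmbedding (hemb' v))
    · have := htri _ hint1
      rw [IntegrableOn, ← Measure.prod_restrict] at this
      simpa [Function.uncurry_def] using this
  -- The vertical derivative, integrated over `(-∞, y]`, leaves the value at height `y`.
  have hB : ∫ w in {w : ℂ | w.im ≤ y}, fderiv ℝ ψ w I = ∫ u : ℝ, ψ (u + y * I) := by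
    rw [htr, Measure.volume_eq_prod, setIntegral_prod _ (htri _ hintI), Measure.restrict_univ]
    refine integral_congr_ae (Eventually.of_forall fun u ↦ ?_)
    simp only
    have h2 : HasCompactSupport (fun v : ℝ ↦ ψ (u + v * I)) := hc.comp_isClosedEmbedding (hemb u)
    rw [integral_Iic_of_hasDerivAt_of_tendsto' (fun v _ ↦ hderv u v) (m := 0), sub_zero]
    · exact ((hcontI.comp (hemb u).continuous).integrable_of_hasCompactSupport
          (hsuppI.comp_isClosedEmbedding (hemb u))).integrableOn
    · rw [hasCompactSupport_iff_eventuallyEq, Filter.coclosedCompact_eq_cocompact] at h2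
      exact h2.filter_mono _root_.atBot_le_cocompact |>.tendsto
  have : ∀ w, 2 * I * dbarC ψ w = I * fderiv ℝ ψ w 1 - fderiv ℝ ψ w I := fun w ↦ by
    rw [dbarC]
    linear_combination fderiv ℝ ψ w I * I_mul_I
  simp_rw [this]
  rw [integral_sub (hint1.const_mul I).integrableOn hintI.integrableOn, integral_const_mul, hA, hB]
  simp

end RohrlichDivisor

end

noncomputable section

namespace RohrlichDivisor

/-! ### Green's formula with the kernels `1 / (w - z)` and `log |w - z|` -/

/-- Crude on purpose: it bounds the logarithmic singularity by the one of `1 / |w|`, so that one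
integrability lemma covers both kernels. -/
lemma abs_log_le_inv_add {r : ℝ} (hr : 0 ≤ r) : |Real.log r| ≤ r⁻¹ + r := by
  rcases hr.eq_or_lt with rfl | hr
  · simp
  have h1 := Real.log_le_sub_one_of_pos hr
  have h2 := Real.log_le_sub_one_of_pos (inv_pos.mpr hr)
  rw [Real.log_inv] at h2
  have := inv_pos.mpr hr
  rw [abs_le]
  constructor <;> linarith

/-- The exponent `1` is below the real dimension `2`. -/
lemma locallyIntegrable_inv_norm : LocallyIntegrable (fun w : ℂ ↦ ‖w‖⁻¹) volume := by
  refine locallyIntegrable_of_norm_le_rpow (C := 1) (α := 1) (by simp) (by simp) ?_ ?_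
  · refine Eventually.of_forall fun w ↦ ?_
    simp [Real.rpow_neg_one]
  · exact (measurable_norm.inv).aestronglyMeasurable

lemma integrable_mul_of_norm_le_inv {φ : ℂ → ℂ} (hφ : Continuous φ) (hc : HasCompactSupport φ)
    {h : ℂ → ℂ} (hm : AEStronglyMeasurable h volume) (z : ℂ) {C : ℝ}
    (hh : ∀ w, ‖h w‖ ≤ ‖w - z‖⁻¹ + C * (1 + ‖w - z‖) ^ 2) :
    Integrable (fun w ↦ φ w * h w) volume := by
  have hi : Integrable (fun w : ℂ ↦ ‖φ w‖ * (‖w - z‖⁻¹ + C * (1 + ‖w - z‖) ^ 2)) volume := by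
    have h0 : LocallyIntegrable (fun w : ℂ ↦ ‖w‖⁻¹ + C * (1 + ‖w‖) ^ 2) volume :=
      locallyIntegrable_inv_norm.add (Continuous.locallyIntegrable (by fun_prop))
    have h1 := h0.integrable_smul_left_of_hasCompactSupport (g := fun w ↦ ‖φ (w + z)‖)
      (by fun_prop) ((hc.comp_homeomorph (Homeomorph.addRight z)).norm)
    simpa using h1.comp_sub_right z
  refine hi.mono' (hφ.aestronglyMeasurable.mul hm) (Eventually.of_forall fun w ↦ ?_)
  rw [norm_mul]
  gcongr
  exact hh w

lemma integrable_mul_inv_sub {φ : ℂ → ℂ} (hφ : Continuous φ) (hc : HasCompactSupport φ) (z : ℂ) :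
    Integrable (fun w ↦ φ w * (w - z)⁻¹) volume :=
  integrable_mul_of_norm_le_inv hφ hc (by fun_prop) z (C := 0) fun w ↦ by simp

lemma integrable_mul_log_sub {φ : ℂ → ℂ} (hφ : Continuous φ) (hc : HasCompactSupport φ) (z : ℂ) :
    Integrable (fun w ↦ φ w * (Real.log ‖w - z‖ : ℂ)) volume := by
  have hm : Measurable (fun w : ℂ ↦ (Real.log ‖w - z‖ : ℂ)) :=
    measurable_ofReal.comp (Real.measurable_log.comp (by fun_prop))
  refine integrable_mul_of_norm_le_inv hφ hc hm.aestronglyMeasurable z (C := 1) fun w ↦ ?_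
  rw [norm_real, Real.norm_eq_abs]
  refine (abs_log_le_inv_add (norm_nonneg _)).trans ?_
  nlinarith [norm_nonneg (w - z)]

lemma contDiff_normSq_sub (z : ℂ) (e : ℝ) :
    ContDiff ℝ ∞ (fun w : ℂ ↦ normSq (w - z) + e) := by
  simp only [normSq_apply, sub_re, sub_im]
  have h1 : ContDiff ℝ ∞ (fun w : ℂ ↦ w.re) := reCLM.contDiff
  have h2 : ContDiff ℝ ∞ (fun w : ℂ ↦ w.im) := imCLM.contDiff
  fun_prop

lemma contDiff_conj_sub (z : ℂ) : ContDiff ℝ ∞ (fun w : ℂ ↦ conj (w - z)) :=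
  (conjCLE : ℂ ≃L[ℝ] ℂ).contDiff.comp (contDiff_id.sub contDiff_const)

lemma dbarC_conj_sub (z w : ℂ) : dbarC (fun w ↦ conj (w - z)) w = 1 := by
  rw [dbarC_conj ((hasDerivAt_id' w).sub_const z)]
  simp

lemma dbarC_normSq_sub (z w : ℂ) (e : ℝ) :
    dbarC (fun w ↦ ((normSq (w - z) + e : ℝ) : ℂ)) w = w - z := by
  have h : (fun w ↦ ((normSq (w - z) + e : ℝ) : ℂ)) = fun w ↦ (w - z) * conj (w - z) + (e : ℂ) := by
    ext w
    rw [mul_conj]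
    push_cast
    ring
  have hd : DifferentiableAt ℂ (fun w ↦ w - z) w := by fun_prop
  have hd1 : DifferentiableAt ℝ (fun w ↦ w - z) w := by fun_prop
  have hd2 : DifferentiableAt ℝ (fun w ↦ conj (w - z)) w :=
    (contDiff_conj_sub z).differentiable (by simp) w
  rw [h, dbarC_add (hd1.fun_mul hd2) (by fun_prop), dbarC_mul hd1 hd2, dbarC_of_differentiableAt hd,
    dbarC_const, dbarC_conj_sub]
  ring

/-- The kernel `conj (w - z) / (|w - z|² + e)` is a smooth substitute for `1 / (w - z)`, recovered
as `e → 0`. -/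
lemma contDiff_regularizedInv (z : ℂ) {e : ℝ} (he : 0 < e) :
    ContDiff ℝ ∞ (fun w ↦ conj (w - z) * (((normSq (w - z) + e)⁻¹ : ℝ) : ℂ)) := by
  refine (contDiff_conj_sub z).mul (ofRealCLM.contDiff.comp ?_)
  exact (contDiff_normSq_sub z e).inv fun w ↦ (by positivity [normSq_nonneg (w - z)])

/-- The result is a bump of total mass `π` that concentrates at `z` as `e → 0`; it produces the
point value in the Cauchy–Pompeiu formula. -/
lemma dbarC_regularizedInv (z w : ℂ) {e : ℝ} (he : 0 < e) :
    dbarC (fun w ↦ conj (w - z) * (((normSq (w - z) + e)⁻¹ : ℝ) : ℂ)) w =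
      ((e / (normSq (w - z) + e) ^ 2 : ℝ) : ℂ) := by
  have hq : 0 < normSq (w - z) + e := by positivity [normSq_nonneg (w - z)]
  have hd2 : DifferentiableAt ℝ (fun w ↦ conj (w - z)) w :=
    (contDiff_conj_sub z).differentiable (by simp) w
  have hd3 := (contDiff_normSq_sub z e).differentiable (by simp) w
  have hd4 : DifferentiableAt ℝ (fun w ↦ (((normSq (w - z) + e)⁻¹ : ℝ) : ℂ)) w :=
    ofRealCLM.differentiableAt.comp w (hd3.inv hq.ne')
  rw [dbarC_mul hd2 hd4, dbarC_ofReal_comp (hasDerivAt_inv hq.ne') hd3, dbarC_conj_sub,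
    dbarC_normSq_sub]
  have hq' : ((normSq (w - z) + e : ℝ) : ℂ) ≠ 0 := by exact_mod_cast hq.ne'
  have hn : ((normSq (w - z) : ℝ) : ℂ) = (w - z) * conj (w - z) := (mul_conj _).symm
  push_cast at hq' ⊢
  field_simp
  rw [hn]
  ring

lemma contDiff_regularizedLog (z : ℂ) {e : ℝ} (he : 0 < e) :
    ContDiff ℝ ∞ (fun w ↦ ((1 / 2 * Real.log (normSq (w - z) + e) : ℝ) : ℂ)) := by
  refine ofRealCLM.contDiff.comp (contDiff_const.mul ?_)
  exact (contDiff_normSq_sub z e).log fun w ↦ (by positivity [normSq_nonneg (w - z)])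

lemma dbarC_regularizedLog (z w : ℂ) {e : ℝ} (he : 0 < e) :
    dbarC (fun w ↦ ((1 / 2 * Real.log (normSq (w - z) + e) : ℝ) : ℂ)) w =
      1 / 2 * ((w - z) * (((normSq (w - z) + e)⁻¹ : ℝ) : ℂ)) := by
  have hq : 0 < normSq (w - z) + e := by positivity [normSq_nonneg (w - z)]
  have hd3 := (contDiff_normSq_sub z e).differentiable (by simp) w
  rw [dbarC_ofReal_comp ((Real.hasDerivAt_log hq.ne').const_mul (1 / 2)) hd3, dbarC_normSq_sub]
  push_cast
  ring

/-- In polar coordinates the radial integral has the antiderivative `-(2π)⁻¹ (1 + r²)⁻¹`. -/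
lemma integral_poissonKernel : ∫ s : ℂ, π⁻¹ * ((1 + ‖s‖ ^ 2) ^ 2)⁻¹ = 1 := by
  have h := integral_fun_norm_addHaar (volume : Measure ℂ) (fun r : ℝ ↦ π⁻¹ * ((1 + r ^ 2) ^ 2)⁻¹)
  rw [h]
  have h2 : ∫ r in Set.Ioi (0 : ℝ), r ^ (Module.finrank ℝ ℂ - 1) • (π⁻¹ * ((1 + r ^ 2) ^ 2)⁻¹)
      = (2 * π)⁻¹ := by
    have hd (r : ℝ) : HasDerivAt (fun r : ℝ ↦ -(2 * π)⁻¹ * (1 + r ^ 2)⁻¹)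
        (r ^ (Module.finrank ℝ ℂ - 1) • (π⁻¹ * ((1 + r ^ 2) ^ 2)⁻¹)) r := by
      have h3 : (1 + r ^ 2 : ℝ) ≠ 0 := by positivity
      have := (((hasDerivAt_pow 2 r).const_add 1).inv h3).const_mul (-(2 * π)⁻¹)
      refine this.congr_deriv ?_
      simp only [finrank_real_complex, smul_eq_mul]
      field_simp
      norm_num
    rw [integral_Ioi_of_hasDerivAt_of_nonneg' (fun x _ ↦ hd x) (l := 0)]
    · simp
    · intro r hr
      have : (0 : ℝ) < r := hr
      simp only [smul_eq_mul]
      positivity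
    · have : Tendsto (fun r : ℝ ↦ (1 + r ^ 2)) atTop atTop :=
        tendsto_atTop_add_const_left _ _ (tendsto_pow_atTop two_ne_zero)
      simpa using (tendsto_inv_atTop_zero.comp this).const_mul (-(2 * π)⁻¹)
  rw [h2, finrank_real_complex, measureReal_def, Complex.volume_ball]
  simp

/-- With `e = c⁻²` the bump is `π` times the rescaling `c² φ(c (w - z))` of a density `φ` of mass
one, hence an approximate identity. -/
lemma tendsto_integral_poissonKernel {ψ : ℂ → ℂ} (hψ : Integrable ψ) {z : ℂ}
    (hz : ContinuousAt ψ z) :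
    Tendsto (fun c : ℝ ↦ ∫ w, (((c ^ 2)⁻¹ / (normSq (w - z) + (c ^ 2)⁻¹) ^ 2 : ℝ) : ℂ) * ψ w)
      atTop (𝓝 (π * ψ z)) := by
  have h := tendsto_integral_comp_smul_smul_of_integrable' (μ := (volume : Measure ℂ))
    (φ := fun s : ℂ ↦ π⁻¹ * ((1 + ‖s‖ ^ 2) ^ 2)⁻¹) (fun s ↦ by positivity)
    integral_poissonKernel ?_ hψ hz
  · refine (h.const_mul (π : ℂ)).congr' ?_
    filter_upwards [eventually_gt_atTop 0] with c hc
    rw [← integral_const_mul]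
    refine integral_congr_ae (Eventually.of_forall fun w ↦ ?_)
    simp only [finrank_real_complex, real_smul]
    rw [norm_mul, norm_real, Real.norm_eq_abs, abs_of_pos hc, norm_sub_rev, normSq_eq_norm_sq,
      ← mul_assoc]
    congr 1
    norm_cast
    field_simp
    ring
  -- The remaining condition on the density `φ` is `|s|² φ(s) → 0` at infinity.
  · rw [finrank_real_complex]
    have h1 : Tendsto (fun r : ℝ ↦ π⁻¹ * (1 + r ^ 2)⁻¹) atTop (𝓝 0) := by
      have : Tendsto (fun r : ℝ ↦ (1 + r ^ 2)) atTop atTop :=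
        tendsto_atTop_add_const_left _ _ (tendsto_pow_atTop two_ne_zero)
      simpa using (tendsto_inv_atTop_zero.comp this).const_mul π⁻¹
    refine squeeze_zero (fun s ↦ by positivity) (fun s ↦ ?_)
      (h1.comp (tendsto_norm_cobounded_atTop (E := ℂ)))
    simp only [Function.comp]
    have : 0 < 1 + ‖s‖ ^ 2 := by positivity
    rw [mul_left_comm]
    gcongr
    field_simp
    nlinarith

/-- The bound does not depend on `e`; it is the majorant for dominated convergence as the
regularization is removed. -/
lemma norm_regularizedInv_le (w : ℂ) {e : ℝ} (he : 0 < e) :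
    ‖w * (((normSq w + e)⁻¹ : ℝ) : ℂ)‖ ≤ ‖w‖⁻¹ := by
  rcases eq_or_ne w 0 with rfl | hw
  · simp
  have hw' := norm_pos_iff.mpr hw
  rw [norm_mul, norm_real, Real.norm_eq_abs, normSq_eq_norm_sq, abs_of_pos (by positivity)]
  rw [← div_eq_mul_inv, div_le_iff₀ (by positivity), inv_mul_eq_div, le_div_iff₀ hw']
  nlinarith

lemma tendsto_inv_sq_atTop : Tendsto (fun c : ℝ ↦ (c ^ 2)⁻¹) atTop (𝓝 0) :=
  tendsto_inv_atTop_zero.comp (tendsto_pow_atTop two_ne_zero)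

lemma tendsto_regularizedInv {w : ℂ} (hw : w ≠ 0) :
    Tendsto (fun c : ℝ ↦ (((normSq w + (c ^ 2)⁻¹)⁻¹ : ℝ) : ℂ)) atTop
      (𝓝 (((normSq w)⁻¹ : ℝ) : ℂ)) := by
  have h1 : Tendsto (fun c : ℝ ↦ normSq w + (c ^ 2)⁻¹) atTop (𝓝 (normSq w)) := by
    simpa using tendsto_inv_sq_atTop.const_add (normSq w)
  exact (continuous_ofReal.tendsto _).comp (h1.inv₀ (normSq_pos.mpr hw).ne')

lemma integrable_horizontal {ψ : ℂ → ℂ} (hψ : Continuous ψ) (hc : HasCompactSupport ψ) (y : ℝ) :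
    Integrable (fun u : ℝ ↦ ψ (u + y * I)) :=
  (hψ.comp (isClosedEmbedding_horizontalLine y).continuous).integrable_of_hasCompactSupport
    (hc.comp_isClosedEmbedding (isClosedEmbedding_horizontalLine y))

lemma horizontal_sub_ne_zero {y : ℝ} {z : ℂ} (hz : z.im ≠ y) (u : ℝ) :
    (u : ℂ) + y * I - z ≠ 0 := fun h ↦ by
  have := congrArg Complex.im h
  simp at this
  exact hz (by linarith)

lemma abs_sub_im_le_norm {y : ℝ} {z : ℂ} (u : ℝ) :
    |y - z.im| ≤ ‖(u : ℂ) + y * I - z‖ := by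
  have := abs_im_le_norm ((u : ℂ) + y * I - z)
  simpa using this

/-- The Cauchy–Pompeiu formula on the half plane `Im w ≤ y`. -/
lemma integral_dbarC_mul_inv_halfPlane {ψ : ℂ → ℂ} (hψ : ContDiff ℝ 1 ψ)
    (hc : HasCompactSupport ψ) {y : ℝ} {z : ℂ} (hz : z.im ≠ y) :
    ∫ w in {w : ℂ | w.im ≤ y}, 2 * I * (dbarC ψ w * (w - z)⁻¹) =
      - (∫ u : ℝ, ψ (u + y * I) * (u + y * I - z)⁻¹) -
        2 * π * I * (if z.im < y then ψ z else 0) := by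
  have hd := hψ.differentiable one_ne_zero
  have hmeas : MeasurableSet {w : ℂ | w.im ≤ y} := measurableSet_le measurable_im measurable_const
  have hcd := continuous_dbarC hψ
  have hsd := hasCompactSupport_dbarC hc
  set k : ℝ → ℂ → ℂ := fun c w ↦ conj (w - z) * (((normSq (w - z) + (c ^ 2)⁻¹)⁻¹ : ℝ) : ℂ) with hk
  have hkle {c : ℝ} (hc : 0 < c) (w : ℂ) : ‖k c w‖ ≤ ‖w - z‖⁻¹ := by
    have := norm_regularizedInv_le (w - z) (e := (c ^ 2)⁻¹) (by positivity)
    simpa only [hk, norm_mul, RCLike.norm_conj] using this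
  have hkt {w : ℂ} (hw : w ≠ z) : Tendsto (fun c ↦ k c w) atTop (𝓝 (w - z)⁻¹) := by
    have := (tendsto_regularizedInv (sub_ne_zero.mpr hw)).const_mul (conj (w - z))
    rwa [← Complex.inv_def] at this
  have hkc {c : ℝ} (hc : 0 < c) : ContDiff ℝ 1 (k c) :=
    (contDiff_regularizedInv z (e := (c ^ 2)⁻¹) (by positivity)).of_le (by simp)
  -- the formula for the regularized kernel
  have hreg : ∀ᶠ c : ℝ in atTop, (∫ w in {w : ℂ | w.im ≤ y}, 2 * I * (dbarC ψ w * k c w)) =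
      - (∫ u : ℝ, ψ (u + y * I) * k c (u + y * I)) - 2 * I * ∫ w,
        (((c ^ 2)⁻¹ / (normSq (w - z) + (c ^ 2)⁻¹) ^ 2 : ℝ) : ℂ) *
          ({w : ℂ | w.im ≤ y}.indicator ψ) w := by
    filter_upwards [eventually_gt_atTop 0] with c hc0
    have h := integral_dbarC_halfPlane (hψ.mul (hkc hc0)) (hc.mul_right (f' := k c)) y
    have h1 : ∀ w, 2 * I * dbarC (fun w ↦ ψ w * k c w) w = 2 * I * (dbarC ψ w * k c w) +
        2 * I * ((((c ^ 2)⁻¹ / (normSq (w - z) + (c ^ 2)⁻¹) ^ 2 : ℝ) : ℂ) * ψ w) := fun w ↦ by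
      rw [dbarC_mul (hd w) ((hkc hc0).differentiable one_ne_zero w),
        dbarC_regularizedInv z w (by positivity)]
      ring
    simp_rw [h1] at h
    rw [integral_add] at h
    · rw [← h, ← integral_const_mul]
      have : ∀ w, 2 * I * ((((c ^ 2)⁻¹ / (normSq (w - z) + (c ^ 2)⁻¹) ^ 2 : ℝ) : ℂ) *
          ({w : ℂ | w.im ≤ y}.indicator ψ) w) = {w : ℂ | w.im ≤ y}.indicator (fun w ↦ 2 * I *
          ((((c ^ 2)⁻¹ / (normSq (w - z) + (c ^ 2)⁻¹) ^ 2 : ℝ) : ℂ) * ψ w)) w := fun w ↦ by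
        by_cases hw : w ∈ {w : ℂ | w.im ≤ y}
        · simp [Set.indicator_of_mem hw]
        · simp [Set.indicator_of_notMem hw]
      simp_rw [this]
      rw [integral_indicator hmeas]
      ring
    · refine Integrable.integrableOn (Integrable.const_mul ?_ _)
      exact (hcd.mul (hkc hc0).continuous).integrable_of_hasCompactSupport hsd.mul_right
    · refine Integrable.integrableOn (Integrable.const_mul ?_ _)
      refine Continuous.integrable_of_hasCompactSupport (Continuous.mul ?_ hψ.continuous) hc.mul_left
      have h5 := continuous_normSq.comp (continuous_id.sub (continuous_const (y := z)))
      refine continuous_ofReal.comp (Continuous.div continuous_const (by fun_prop) fun w ↦ ?_)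
      positivity [normSq_nonneg (w - z)]
  have t1 : Tendsto (fun c ↦ ∫ w in {w : ℂ | w.im ≤ y}, 2 * I * (dbarC ψ w * k c w)) atTop
      (𝓝 (∫ w in {w : ℂ | w.im ≤ y}, 2 * I * (dbarC ψ w * (w - z)⁻¹))) := by
    refine tendsto_integral_filter_of_dominated_convergence
      (fun w ↦ ‖2 * I * (dbarC ψ w * (w - z)⁻¹)‖) ?_ ?_ ?_ ?_
    · filter_upwards [eventually_gt_atTop 0] with c hc0
      exact (continuous_const.mul (hcd.mul (hkc hc0).continuous)).aestronglyMeasurable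
    · filter_upwards [eventually_gt_atTop 0] with c hc0
      refine Eventually.of_forall fun w ↦ ?_
      simp only [norm_mul, norm_inv]
      gcongr
      exact hkle hc0 w
    · exact ((integrable_mul_inv_sub hcd hsd z).const_mul _).norm.integrableOn
    · have : ∀ᵐ w : ℂ, w ≠ z := by simp [ae_iff]
      filter_upwards [ae_restrict_of_ae this] with w hw
      exact ((hkt hw).const_mul _).const_mul _
  have t2 : Tendsto (fun c ↦ ∫ u : ℝ, ψ (u + y * I) * k c (u + y * I)) atTop
      (𝓝 (∫ u : ℝ, ψ (u + y * I) * (u + y * I - z)⁻¹)) := by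
    refine tendsto_integral_filter_of_dominated_convergence
      (fun u : ℝ ↦ ‖ψ (u + y * I)‖ * |y - z.im|⁻¹) ?_ ?_ ?_ ?_
    · filter_upwards [eventually_gt_atTop 0] with c hc0
      exact ((hψ.continuous.mul (hkc hc0).continuous).comp
        (isClosedEmbedding_horizontalLine y).continuous).aestronglyMeasurable
    · filter_upwards [eventually_gt_atTop 0] with c hc0
      refine Eventually.of_forall fun u ↦ ?_
      rw [norm_mul]
      gcongr
      refine (hkle hc0 _).trans ?_
      have : 0 < |y - z.im| := abs_pos.mpr (sub_ne_zero.mpr hz.symm)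
      gcongr
      exact abs_sub_im_le_norm u
    · exact (integrable_horizontal hψ.continuous hc y).norm.mul_const _
    · exact Eventually.of_forall fun u ↦
        (hkt (sub_ne_zero.mp (horizontal_sub_ne_zero hz u))).const_mul _
  -- The half plane is built into the test function by an indicator. It stays continuous at `z`
  -- because `z` is not on the line `Im w = y`, and its value at `z` decides whether the point term
  -- occurs.
  have t3 := tendsto_integral_poissonKernel (z := z)
    (((hψ.continuous.integrable_of_hasCompactSupport hc).indicator hmeas)) (by
      refine ContinuousAt.congr (f := if z.im < y then ψ else 0) ?_ ?_
      · split_ifs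
        · exact hψ.continuous.continuousAt
        · exact continuousAt_const
      · rcases lt_or_gt_of_ne hz with h | h
        · filter_upwards [(isOpen_lt Complex.continuous_im continuous_const).mem_nhds h] with w hw
          rw [if_pos h, Set.indicator_of_mem (show w ∈ {w : ℂ | w.im ≤ y} from le_of_lt hw)]
        · filter_upwards [(isOpen_lt continuous_const Complex.continuous_im).mem_nhds h] with w hw
          have hw : y < w.im := hw
          rw [if_neg h.not_gt, Set.indicator_of_notMem (by simpa using hw)]
          rfl)
  have hlim := (t2.neg.sub (t3.const_mul (2 * I)))
  have := tendsto_nhds_unique (t1.congr' hreg) hlim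
  rw [this]
  rcases lt_or_gt_of_ne hz with h | h
  · rw [if_pos h, Set.indicator_of_mem (show z ∈ {w : ℂ | w.im ≤ y} from h.le)]
    ring
  · rw [if_neg h.not_gt, Set.indicator_of_notMem (by simpa using h)]
    ring

/-- Green's formula on the half plane `Im w ≤ y` for a test function times `log |w - z|`. -/
lemma integral_dbarC_mul_log_halfPlane {ψ : ℂ → ℂ} (hψ : ContDiff ℝ 1 ψ)
    (hc : HasCompactSupport ψ) {y : ℝ} {z : ℂ} (hz : z.im ≠ y) :
    ∫ w in {w : ℂ | w.im ≤ y}, 2 * I * (dbarC ψ w * (Real.log ‖w - z‖ : ℂ) +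
        ψ w * (1 / 2 * conj (w - z)⁻¹)) =
      - ∫ u : ℝ, ψ (u + y * I) * (Real.log ‖u + y * I - z‖ : ℂ) := by
  have hd := hψ.differentiable one_ne_zero
  have hcd := continuous_dbarC hψ
  have hsd := hasCompactSupport_dbarC hc
  set ℓ : ℝ → ℂ → ℂ :=
    fun c w ↦ ((1 / 2 * Real.log (normSq (w - z) + (c ^ 2)⁻¹) : ℝ) : ℂ) with hl
  set k : ℝ → ℂ → ℂ := fun c w ↦ 1 / 2 * ((w - z) * (((normSq (w - z) + (c ^ 2)⁻¹)⁻¹ : ℝ) : ℂ))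
    with hk
  have hkle {c : ℝ} (hc : 0 < c) (w : ℂ) : ‖k c w‖ ≤ ‖w - z‖⁻¹ := by
    have := norm_regularizedInv_le (w - z) (e := (c ^ 2)⁻¹) (by positivity)
    rw [hk, norm_mul]
    refine le_trans ?_ this
    refine mul_le_of_le_one_left (norm_nonneg _) ?_
    norm_num
  have hkt {w : ℂ} (hw : w ≠ z) :
      Tendsto (fun c ↦ k c w) atTop (𝓝 (1 / 2 * conj (w - z)⁻¹)) := by
    have := ((tendsto_regularizedInv (sub_ne_zero.mpr hw)).const_mul (w - z)).const_mul (1 / 2 : ℂ)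
    convert this using 2
    rw [Complex.inv_def]
    simp
  -- For `c ≥ 1` the parameter `c⁻²` is at most `1`, so `log (r² + c⁻²)` lies between `2 log r` and
  -- `r²`; this gives a majorant independent of `c`.
  have hlle {c : ℝ} (hc : 1 ≤ c) {w : ℂ} (hw : w ≠ z) :
      ‖ℓ c w‖ ≤ ‖w - z‖⁻¹ + 1 * (1 + ‖w - z‖) ^ 2 := by
    have hr : 0 < ‖w - z‖ := norm_pos_iff.mpr (sub_ne_zero.mpr hw)
    set r := ‖w - z‖
    have he : 0 < (c ^ 2)⁻¹ := by positivity
    have he1 : (c ^ 2)⁻¹ ≤ 1 := inv_le_one_of_one_le₀ (one_le_pow₀ hc)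
    rw [hl]
    simp only
    rw [norm_real, Real.norm_eq_abs, normSq_eq_norm_sq]
    have h1 : Real.log (r ^ 2 + (c ^ 2)⁻¹) ≤ r ^ 2 := by
      have := Real.log_le_sub_one_of_pos (x := r ^ 2 + (c ^ 2)⁻¹) (by positivity)
      linarith
    have h2 : Real.log (r ^ 2) ≤ Real.log (r ^ 2 + (c ^ 2)⁻¹) := by
      gcongr
      linarith
    have h3 := Real.log_le_sub_one_of_pos (inv_pos.mpr hr)
    rw [Real.log_inv] at h3
    rw [Real.log_pow] at h2
    push_cast at h2
    have h4 := inv_pos.mpr hr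
    rw [abs_le]
    constructor <;> nlinarith
  have hlt {w : ℂ} (hw : w ≠ z) :
      Tendsto (fun c ↦ ℓ c w) atTop (𝓝 (Real.log ‖w - z‖ : ℂ)) := by
    have h1 : Tendsto (fun c : ℝ ↦ normSq (w - z) + (c ^ 2)⁻¹) atTop (𝓝 (normSq (w - z))) := by
      simpa using tendsto_inv_sq_atTop.const_add (normSq (w - z))
    have h2 := (h1.log (normSq_pos.mpr (sub_ne_zero.mpr hw)).ne').const_mul (1 / 2)
    have h3 : Real.log ‖w - z‖ = 1 / 2 * Real.log (normSq (w - z)) := by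
      rw [normSq_eq_norm_sq, Real.log_pow]
      push_cast
      ring
    rw [h3]
    exact (continuous_ofReal.tendsto _).comp h2
  have hlc {c : ℝ} (hc : 0 < c) : ContDiff ℝ 1 (ℓ c) :=
    (contDiff_regularizedLog z (e := (c ^ 2)⁻¹) (by positivity)).of_le (by simp)
  have hae : ∀ᵐ w : ℂ, w ≠ z := by simp [ae_iff]
  have hreg : ∀ᶠ c : ℝ in atTop, (∫ w in {w : ℂ | w.im ≤ y},
      2 * I * (dbarC ψ w * ℓ c w + ψ w * k c w)) =
      - (∫ u : ℝ, ψ (u + y * I) * ℓ c (u + y * I)) := by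
    filter_upwards [eventually_gt_atTop 0] with c hc0
    rw [← integral_dbarC_halfPlane (hψ.mul (hlc hc0)) (hc.mul_right (f' := ℓ c)) y]
    refine integral_congr_ae (Eventually.of_forall fun w ↦ ?_)
    beta_reduce
    rw [dbarC_mul (hd w) ((hlc hc0).differentiable one_ne_zero w),
      dbarC_regularizedLog z w (by positivity)]
  have hbound : Integrable (fun w ↦ ‖2 * I‖ * (‖dbarC ψ w‖ * (‖w - z‖⁻¹ + 1 * (1 + ‖w - z‖) ^ 2) +
      ‖ψ w‖ * ‖w - z‖⁻¹)) := by
    refine Integrable.const_mul (Integrable.add ?_ ?_) _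
    · have h6 := (integrable_mul_of_norm_le_inv hcd hsd
        (h := fun w ↦ ((‖w - z‖⁻¹ + 1 * (1 + ‖w - z‖) ^ 2 : ℝ) : ℂ)) (by fun_prop) z (C := 1)
        fun w ↦ (by rw [norm_real, Real.norm_eq_abs, abs_of_nonneg (by positivity)])).norm
      refine h6.congr (Eventually.of_forall fun w ↦ ?_)
      simp only [norm_mul, norm_real, Real.norm_eq_abs]
      rw [abs_of_nonneg (by positivity)]
    · simpa using (integrable_mul_inv_sub hψ.continuous hc z).norm
  have t1 : Tendsto (fun c ↦ ∫ w in {w : ℂ | w.im ≤ y}, 2 * I * (dbarC ψ w * ℓ c w + ψ w * k c w))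
      atTop (𝓝 (∫ w in {w : ℂ | w.im ≤ y}, 2 * I * (dbarC ψ w * (Real.log ‖w - z‖ : ℂ) +
        ψ w * (1 / 2 * conj (w - z)⁻¹)))) := by
    refine tendsto_integral_filter_of_dominated_convergence _ ?_ ?_ hbound.integrableOn ?_
    · filter_upwards [eventually_gt_atTop 0] with c hc0
      have h7 : Measurable (k c) := by
        have h8 : Measurable fun w : ℂ ↦ normSq (w - z) + (c ^ 2)⁻¹ :=
          (contDiff_normSq_sub z _).continuous.measurable
        exact ((measurable_id.sub_const z).mul (measurable_ofReal.comp h8.inv)).const_mul _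
      exact ((measurable_const.mul ((hcd.mul (hlc hc0).continuous).measurable.add
        (hψ.continuous.measurable.mul h7)))).aestronglyMeasurable
    · filter_upwards [eventually_ge_atTop 1] with c hc0
      filter_upwards [ae_restrict_of_ae hae] with w hw
      rw [norm_mul]
      gcongr
      refine (norm_add_le _ _).trans ?_
      rw [norm_mul, norm_mul]
      gcongr
      · exact hlle hc0 hw
      · exact hkle (by linarith) w
    · filter_upwards [ae_restrict_of_ae hae] with w hw
      exact (((hlt hw).const_mul _).add ((hkt hw).const_mul _)).const_mul _
  have t2 : Tendsto (fun c ↦ ∫ u : ℝ, ψ (u + y * I) * ℓ c (u + y * I)) atTop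
      (𝓝 (∫ u : ℝ, ψ (u + y * I) * (Real.log ‖u + y * I - z‖ : ℂ))) := by
    refine tendsto_integral_filter_of_dominated_convergence
      (fun u : ℝ ↦ ‖ψ (u + y * I)‖ * (|y - z.im|⁻¹ + (1 + ‖u + y * I - z‖) ^ 2)) ?_ ?_ ?_ ?_
    · filter_upwards [eventually_gt_atTop 0] with c hc0
      exact ((hψ.continuous.mul (hlc hc0).continuous).comp
        (isClosedEmbedding_horizontalLine y).continuous).aestronglyMeasurable
    · filter_upwards [eventually_ge_atTop 1] with c hc0
      refine Eventually.of_forall fun u ↦ ?_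
      rw [norm_mul]
      gcongr
      refine (hlle hc0 (sub_ne_zero.mp (horizontal_sub_ne_zero hz u))).trans ?_
      have : 0 < |y - z.im| := abs_pos.mpr (sub_ne_zero.mpr hz.symm)
      rw [one_mul]
      gcongr
      exact abs_sub_im_le_norm u
    · refine Continuous.integrable_of_hasCompactSupport ?_ ?_
      · have := hψ.continuous
        fun_prop
      · exact (hc.comp_isClosedEmbedding (isClosedEmbedding_horizontalLine y)).norm.mul_right
    · exact Eventually.of_forall fun u ↦
        (hlt (sub_ne_zero.mp (horizontal_sub_ne_zero hz u))).const_mul _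
  exact tendsto_nhds_unique (t1.congr' hreg) t2.neg

end RohrlichDivisor

end

noncomputable section

namespace RohrlichDivisor

/-! ### Green's formula with `f' / f` and `log |f|` for a meromorphic function `f` -/

/-- Off the support of `ψ` the product is locally zero, so nothing is needed of `h` outside `W`. -/
lemma contDiff_mul_of_tsupport_subset {n : WithTop ℕ∞} {ψ h : ℂ → ℂ} {W : Set ℂ} (hW : IsOpen W)
    (hψ : ContDiff ℝ n ψ) (hψW : tsupport ψ ⊆ W) (hh : ContDiffOn ℝ n h W) :
    ContDiff ℝ n (fun w ↦ ψ w * h w) := by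
  rw [contDiff_iff_contDiffAt]
  intro w
  by_cases hw : w ∈ tsupport ψ
  · exact hψ.contDiffAt.mul (hh.contDiffAt (hW.mem_nhds (hψW hw)))
  · have : (fun w ↦ ψ w * h w) =ᶠ[𝓝 w] fun _ ↦ 0 := by
      filter_upwards [notMem_tsupport_iff_eventuallyEq.mp hw] with z hz
      simp [hz]
    exact contDiffAt_const.congr_of_eventuallyEq this

lemma continuous_mul_of_tsupport_subset {ψ h : ℂ → ℂ} {W : Set ℂ} (hW : IsOpen W)
    (hψ : Continuous ψ) (hψW : tsupport ψ ⊆ W) (hh : ContinuousOn h W) :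
    Continuous (fun w ↦ ψ w * h w) := by
  rw [← contDiff_zero (𝕜 := ℝ)]
  exact contDiff_mul_of_tsupport_subset hW (contDiff_zero.mpr hψ) hψW (contDiffOn_zero.mpr hh)

lemma integral_dbarC_mul_halfPlane {ψ h : ℂ → ℂ} {W : Set ℂ} (hW : IsOpen W)
    (hψ : ContDiff ℝ 1 ψ) (hc : HasCompactSupport ψ) (hψW : tsupport ψ ⊆ W)
    (hh : ContDiffOn ℝ 1 h W) (y : ℝ) :
    ∫ w in {w : ℂ | w.im ≤ y}, 2 * I * (dbarC ψ w * h w + ψ w * dbarC h w) =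
      - ∫ u : ℝ, ψ (u + y * I) * h (u + y * I) := by
  rw [← integral_dbarC_halfPlane (contDiff_mul_of_tsupport_subset hW hψ hψW hh)
    (hc.mul_right (f' := h)) y]
  refine integral_congr_ae (Eventually.of_forall fun w ↦ ?_)
  simp only
  by_cases hw : w ∈ tsupport ψ
  · rw [dbarC_mul (hψ.differentiable one_ne_zero w)
      ((hh.contDiffAt (hW.mem_nhds (hψW hw))).differentiableAt one_ne_zero)]
  · have h0 := notMem_tsupport_iff_eventuallyEq.mp hw
    have : (fun w ↦ ψ w * h w) =ᶠ[𝓝 w] fun _ ↦ 0 := by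
      filter_upwards [h0] with z hz
      simp [hz]
    rw [dbarC_congr this, dbarC_congr (ψ := fun _ ↦ 0) h0, dbarC_const,
      image_eq_zero_of_notMem_tsupport hw]
    ring

lemma tsupport_dbarC_subset (ψ : ℂ → ℂ) : tsupport (dbarC ψ) ⊆ tsupport ψ := by
  refine closure_minimal (fun w hw ↦ ?_) (isClosed_tsupport ψ)
  by_contra h
  apply hw
  rw [dbarC_congr (ψ := fun _ ↦ 0) (notMem_tsupport_iff_eventuallyEq.mp h), dbarC_const]

/-- The divisor of `f` is finite on a compact neighbourhood of `K`, so all zeros and poles there can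
be split off as linear factors. This reduces Green's formula for `f'/f` and `log |f|` to the kernels
`1 / (w - u)` and `log |w - u|` plus a smooth remainder. -/
lemma exists_factorization {f : ℂ → ℂ} {V : Set ℂ} (hV : IsOpen V) (hf : MeromorphicNFOn f V)
    (htop : ∀ z ∈ V, meromorphicOrderAt f z ≠ ⊤) {K : Set ℂ} (hK : IsCompact K) (hKV : K ⊆ V) :
    ∃ (W : Set ℂ) (s : Finset ℂ) (g : ℂ → ℂ), IsOpen W ∧ K ⊆ W ∧ W ⊆ V ∧ ↑s ⊆ V ∧
      (∀ z ∈ s, f z = 0) ∧ (∀ z ∈ W, z ∉ s → (meromorphicOrderAt f z).untop₀ = 0) ∧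
      (∀ w ∈ W, AnalyticAt ℂ g w ∧ g w ≠ 0) ∧
      ∀ w ∈ W, f w = (∏ u ∈ s, (w - u) ^ (meromorphicOrderAt f u).untop₀) * g w := by
  obtain ⟨U, hU, hKU, hUV⟩ := exists_compact_between hK hV hKV
  have hfU : MeromorphicOn f U := fun z hz ↦ (hf (hUV hz)).meromorphicAt
  have hfin : (MeromorphicOn.divisor f U).support.Finite :=
    (MeromorphicOn.divisor f U).finiteSupport hU
  obtain ⟨g, hg, hg0, hfg⟩ := hfU.extract_zeros_poles (fun u ↦ htop u (hUV u.2)) hfin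
  have hsub : ∀ u ∈ hfin.toFinset, u ∈ U ∧ (meromorphicOrderAt f u).untop₀ ≠ 0 := fun u hu ↦ by
    have hu' : MeromorphicOn.divisor f U u ≠ 0 := by simpa using hu
    have huU : u ∈ U := (MeromorphicOn.divisor f U).supportWithinDomain hu'
    rw [MeromorphicOn.divisor_apply hfU huU] at hu'
    exact ⟨huU, hu'⟩
  refine ⟨interior U, hfin.toFinset, g, isOpen_interior, hKU, interior_subset.trans hUV,
    fun u hu ↦ hUV (hsub u hu).1, fun u hu ↦ ?_, fun z hz hzs ↦ ?_,
    fun w hw ↦ ⟨hg w (interior_subset hw), hg0 ⟨w, interior_subset hw⟩⟩, fun w hw ↦ ?_⟩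
  -- A function in normal form has order zero wherever its value is nonzero; its poles also have the
  -- value `0`.
  · by_contra h0
    have := (hf (hUV (hsub u hu).1)).meromorphicOrderAt_eq_zero_iff.mpr h0
    exact (hsub u hu).2 (by simp [this])
  · rw [← MeromorphicOn.divisor_apply hfU (interior_subset hz)]
    simpa using hzs
  · have hwU := interior_subset hw
    set P : ℂ → ℂ := ∏ᶠ u, (· - u) ^ MeromorphicOn.divisor f U u with hP
    have hPNF : MeromorphicNFAt P w :=
      Function.FactorizedRational.meromorphicNFOn_univ (MeromorphicOn.divisor f U) trivial
    have hPg : MeromorphicNFAt (P • g) w := by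
      have := (meromorphicNFAt_mul_iff_left (f := P) (hg w hwU) (hg0 ⟨w, hwU⟩)).mpr hPNF
      simpa [smul_eq_mul] using this
    have hne : f =ᶠ[𝓝[≠] w] P • g := by
      have h1 := mem_codiscreteWithin_iff_forall_mem_nhdsNE.mp hfg w hwU
      have h2 : U ∈ 𝓝[≠] w := mem_nhdsWithin_of_mem_nhds (mem_interior_iff_mem_nhds.mp hw)
      filter_upwards [h1, h2] with z hz hzU
      rcases hz with hz | hz
      · exact hz
      · exact absurd hzU hz
    -- Both sides are in normal form, so agreement on a punctured neighbourhood extends to the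
    -- centre.
    have heq := ((hf (hUV hwU)).eventuallyEq_nhdsNE_iff_eventuallyEq_nhds hPg).mp hne
    rw [heq.eq_of_nhds]
    simp only [Pi.smul_apply', smul_eq_mul]
    congr 1
    rw [hP, Function.FactorizedRational.finprod_eq_fun hfin]
    simp only
    rw [finprod_eq_prod_of_mulSupport_subset (s := hfin.toFinset)]
    · refine Finset.prod_congr rfl fun u hu ↦ ?_
      rw [MeromorphicOn.divisor_apply hfU (hsub u hu).1]
    · intro u hu
      simp only [Set.Finite.coe_toFinset, Function.mem_support]
      intro h
      apply hu
      simp [h]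

/-- A meromorphic function as in `exists_factorization`, together with the set on which it is
factored. -/
structure IsFactoredOn (f : ℂ → ℂ) (W : Set ℂ) (s : Finset ℂ) (n : ℂ → ℤ) (g : ℂ → ℂ) : Prop where
  isOpen : IsOpen W
  analyticAt : ∀ w ∈ W, AnalyticAt ℂ g w
  ne_zero : ∀ w ∈ W, g w ≠ 0
  eq_prod : ∀ w ∈ W, f w = (∏ u ∈ s, (w - u) ^ n u) * g w

namespace IsFactoredOn

variable {f : ℂ → ℂ} {W : Set ℂ} {s : Finset ℂ} {n : ℂ → ℤ} {g : ℂ → ℂ}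

lemma logDeriv_eq (h : IsFactoredOn f W s n g) {w : ℂ} (hw : w ∈ W) (hs : w ∉ s) :
    logDeriv f w = (∑ u ∈ s, n u * (w - u)⁻¹) + logDeriv g w := by
  have h1 : f =ᶠ[𝓝 w] fun w ↦ (∏ u ∈ s, (w - u) ^ n u) * g w := by
    filter_upwards [h.isOpen.mem_nhds hw] with z hz using h.eq_prod z hz
  have hne : ∀ u ∈ s, w - u ≠ 0 := fun u hu h0 ↦ hs (by rwa [sub_eq_zero.mp h0])
  have hdiff : ∀ u ∈ s, DifferentiableAt ℂ (fun w ↦ (w - u) ^ n u) w := fun u hu ↦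
    (differentiableAt_id.sub_const u).zpow (Or.inl (hne u hu))
  rw [logDeriv_apply, h1.deriv_eq, h1.eq_of_nhds, ← logDeriv_apply,
    logDeriv_mul w (Finset.prod_ne_zero_iff.mpr fun u hu ↦ zpow_ne_zero _ (hne u hu))
      (h.ne_zero w hw) (DifferentiableAt.fun_finsetProd hdiff) (h.analyticAt w hw).differentiableAt,
    logDeriv_prod (f := fun u w ↦ (w - u) ^ n u) (fun u hu ↦ zpow_ne_zero _ (hne u hu)) hdiff]
  congr 1
  refine Finset.sum_congr rfl fun u hu ↦ ?_
  rw [logDeriv_fun_zpow (by fun_prop), logDeriv_apply]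
  simp

lemma log_norm_eq (h : IsFactoredOn f W s n g) {w : ℂ} (hw : w ∈ W) (hs : w ∉ s) :
    Real.log ‖f w‖ = (∑ u ∈ s, n u * Real.log ‖w - u‖) + Real.log ‖g w‖ := by
  have hne : ∀ u ∈ s, ‖(w - u) ^ n u‖ ≠ 0 := fun u hu ↦
    norm_ne_zero_iff.mpr (zpow_ne_zero _ fun h0 ↦ hs (by rwa [sub_eq_zero.mp h0]))
  rw [h.eq_prod w hw, norm_mul, norm_prod, Real.log_mul (Finset.prod_ne_zero_iff.mpr hne)
    (norm_ne_zero_iff.mpr (h.ne_zero w hw)), Real.log_prod hne]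
  simp [Real.log_zpow]

lemma ae_notMem (s : Finset ℂ) : ∀ᵐ w : ℂ, w ∉ s := by
  rw [ae_iff]
  simpa using s.finite_toSet.measure_zero volume

lemma mul_eq_zero_or {ψ : ℂ → ℂ} (hψW : tsupport ψ ⊆ W) (w : ℂ) : ψ w = 0 ∨ w ∈ W :=
  or_iff_not_imp_right.mpr fun hw ↦ image_eq_zero_of_notMem_tsupport fun h ↦ hw (hψW h)

lemma continuousOn_logDeriv (h : IsFactoredOn f W s n g) : ContinuousOn (logDeriv g) W :=
  fun w hw ↦ ((h.analyticAt w hw).deriv.continuousAt.div (h.analyticAt w hw).continuousAt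
    (h.ne_zero w hw)).continuousWithinAt

lemma contDiffOn_logDeriv (h : IsFactoredOn f W s n g) : ContDiffOn ℝ 1 (logDeriv g) W :=
  fun w hw ↦ (((h.analyticAt w hw).deriv.contDiffAt.div (h.analyticAt w hw).contDiffAt
    (h.ne_zero w hw)).restrict_scalars ℝ).contDiffWithinAt

lemma dbarC_logDeriv (h : IsFactoredOn f W s n g) {w : ℂ} (hw : w ∈ W) :
    dbarC (logDeriv g) w = 0 :=
  dbarC_of_differentiableAt ((h.analyticAt w hw).deriv.differentiableAt.div
    (h.analyticAt w hw).differentiableAt (h.ne_zero w hw))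

end IsFactoredOn

/-- Near a point where `g` is holomorphic and does not vanish, `log |g|` is up to a constant the
real part of a holomorphic function with derivative `g' / g`. -/
lemma exists_eventuallyEq_log_norm {g : ℂ → ℂ} {w : ℂ} (hg : AnalyticAt ℂ g w) (h0 : g w ≠ 0) :
    ∃ F : ℂ → ℂ, AnalyticAt ℂ F w ∧ HasDerivAt F (logDeriv g w) w ∧
      (fun z ↦ (Real.log ‖g z‖ : ℂ)) =ᶠ[𝓝 w] fun z ↦ 1 / 2 * (F z + conj (F z)) := by
  have hq : AnalyticAt ℂ (fun z ↦ g z / g w) w := hg.div analyticAt_const h0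
  have h1 : g w / g w ∈ slitPlane := by
    rw [div_self h0]
    exact one_mem_slitPlane
  refine ⟨fun z ↦ Complex.log (g z / g w) + Real.log ‖g w‖, (hq.clog h1).add analyticAt_const,
    ?_, ?_⟩
  · have := ((hg.differentiableAt.hasDerivAt.div_const (g w)).clog h1).add_const
      (Real.log ‖g w‖ : ℂ)
    refine this.congr_deriv ?_
    rw [logDeriv_apply]
    field_simp
  · filter_upwards [hg.continuousAt.eventually_ne h0] with z hz
    have h2 : Real.log ‖g z‖ = Real.log ‖g z / g w‖ + Real.log ‖g w‖ := by
      rw [norm_div, Real.log_div (norm_ne_zero_iff.mpr hz) (norm_ne_zero_iff.mpr h0)]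
      ring
    have h3 := re_eq_add_conj (Complex.log (g z / g w))
    rw [h2, ← Complex.log_re, ofReal_add, h3]
    simp only [map_add, conj_ofReal]
    ring

lemma contDiffAt_log_norm {g : ℂ → ℂ} {w : ℂ} (hg : AnalyticAt ℂ g w) (h0 : g w ≠ 0) :
    ContDiffAt ℝ ∞ (fun z ↦ (Real.log ‖g z‖ : ℂ)) w := by
  obtain ⟨F, hF, -, hE⟩ := exists_eventuallyEq_log_norm hg h0
  have h1 : ContDiffAt ℝ ∞ F w := hF.contDiffAt.restrict_scalars ℝ
  refine ContDiffAt.congr_of_eventuallyEq ?_ hE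
  exact contDiffAt_const.mul (h1.add ((conjCLE : ℂ ≃L[ℝ] ℂ).contDiff.contDiffAt.comp w h1))

lemma dbarC_log_norm {g : ℂ → ℂ} {w : ℂ} (hg : AnalyticAt ℂ g w) (h0 : g w ≠ 0) :
    dbarC (fun z ↦ (Real.log ‖g z‖ : ℂ)) w = 1 / 2 * conj (logDeriv g w) := by
  obtain ⟨F, hF, hF', hE⟩ := exists_eventuallyEq_log_norm hg h0
  have h1 : DifferentiableAt ℝ F w := hF.differentiableAt.restrictScalars ℝ
  have h2 : DifferentiableAt ℝ (fun z ↦ conj (F z)) w :=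
    (hasFDerivAt_conj_comp hF').differentiableAt
  rw [dbarC_congr hE, dbarC_const_mul _ (h1.fun_add h2), dbarC_add h1 h2,
    dbarC_of_differentiableAt hF.differentiableAt, dbarC_conj hF', zero_add]

namespace IsFactoredOn

variable {f : ℂ → ℂ} {W : Set ℂ} {s : Finset ℂ} {n : ℂ → ℤ} {g : ℂ → ℂ}

lemma integrable_mul_logDeriv (h : IsFactoredOn f W s n g) {φ : ℂ → ℂ} (hφ : Continuous φ)
    (hc : HasCompactSupport φ) (hφW : tsupport φ ⊆ W) :
    Integrable (fun w ↦ φ w * logDeriv f w) := by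
  have h1 : Integrable (fun w ↦ (∑ u ∈ s, n u * (φ w * (w - u)⁻¹)) + φ w * logDeriv g w) := by
    refine (integrable_finsetSum _ fun u _ ↦
      (integrable_mul_inv_sub hφ hc u).const_mul _).add ?_
    exact (continuous_mul_of_tsupport_subset h.isOpen hφ hφW
      h.continuousOn_logDeriv).integrable_of_hasCompactSupport hc.mul_right
  refine h1.congr ?_
  filter_upwards [ae_notMem s] with w hw
  rcases mul_eq_zero_or hφW w with h0 | hwW
  · simp [h0]
  · rw [h.logDeriv_eq hwW hw, mul_add, Finset.mul_sum]
    congr 1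
    exact Finset.sum_congr rfl fun u _ ↦ by ring

lemma integrable_mul_log_norm (h : IsFactoredOn f W s n g) {φ : ℂ → ℂ} (hφ : Continuous φ)
    (hc : HasCompactSupport φ) (hφW : tsupport φ ⊆ W) :
    Integrable (fun w ↦ φ w * (Real.log ‖f w‖ : ℂ)) := by
  have h1 : Integrable (fun w ↦ (∑ u ∈ s, n u * (φ w * (Real.log ‖w - u‖ : ℂ))) +
      φ w * (Real.log ‖g w‖ : ℂ)) := by
    refine (integrable_finsetSum _ fun u _ ↦
      (integrable_mul_log_sub hφ hc u).const_mul _).add ?_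
    refine (continuous_mul_of_tsupport_subset h.isOpen hφ hφW
      fun w hw ↦ ?_).integrable_of_hasCompactSupport hc.mul_right
    exact (contDiffAt_log_norm (h.analyticAt w hw) (h.ne_zero w hw)).continuousAt.continuousWithinAt
  refine h1.congr ?_
  filter_upwards [ae_notMem s] with w hw
  rcases mul_eq_zero_or hφW w with h0 | hwW
  · simp [h0]
  · rw [h.log_norm_eq hwW hw]
    push_cast
    rw [mul_add, Finset.mul_sum]
    congr 1
    exact Finset.sum_congr rfl fun u _ ↦ by ring

lemma horizontal_notMem {y : ℝ} (hy : ∀ u ∈ s, u.im ≠ y) (t : ℝ) : (t : ℂ) + y * I ∉ s :=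
  fun h ↦ hy _ h (by simp)

/-- Green's formula on the half plane `Im w ≤ y` for a test function times `f' / f`. -/
lemma integral_dbarC_mul_logDeriv (h : IsFactoredOn f W s n g) {ψ : ℂ → ℂ} (hψ : ContDiff ℝ 1 ψ)
    (hc : HasCompactSupport ψ) (hψW : tsupport ψ ⊆ W) {y : ℝ} (hy : ∀ u ∈ s, u.im ≠ y) :
    ∫ w in {w : ℂ | w.im ≤ y}, 2 * I * (dbarC ψ w * logDeriv f w) =
      - (∫ t : ℝ, ψ (t + y * I) * logDeriv f (t + y * I)) -
        2 * π * I * ∑ u ∈ s, n u * (if u.im < y then ψ u else 0) := by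
  have hcd := continuous_dbarC hψ
  have hsd := hasCompactSupport_dbarC hc
  have hdW := (tsupport_dbarC_subset ψ).trans hψW
  have hreg := integral_dbarC_mul_halfPlane h.isOpen hψ hc hψW h.contDiffOn_logDeriv y
  have hregi : Integrable (fun w ↦ 2 * I * (dbarC ψ w * logDeriv g w + ψ w * dbarC (logDeriv g) w))
      := by
    have h2 : (fun w ↦ 2 * I * (dbarC ψ w * logDeriv g w + ψ w * dbarC (logDeriv g) w)) =
        fun w ↦ 2 * I * (dbarC ψ w * logDeriv g w) := by
      ext w
      rcases mul_eq_zero_or hψW w with h0 | hwW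
      · simp [h0]
      · simp [h.dbarC_logDeriv hwW]
    rw [h2]
    exact ((continuous_mul_of_tsupport_subset h.isOpen hcd hdW
      h.continuousOn_logDeriv).integrable_of_hasCompactSupport hsd.mul_right).const_mul _
  -- The partial fraction decomposition of `f'/f` holds off the null set `s`, and each summand is
  -- integrable by itself.
  have hL : ∫ w in {w : ℂ | w.im ≤ y}, 2 * I * (dbarC ψ w * logDeriv f w) =
      (∑ u ∈ s, n u * ∫ w in {w : ℂ | w.im ≤ y}, 2 * I * (dbarC ψ w * (w - u)⁻¹)) +
      ∫ w in {w : ℂ | w.im ≤ y},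
        2 * I * (dbarC ψ w * logDeriv g w + ψ w * dbarC (logDeriv g) w) := by
    simp_rw [← integral_const_mul]
    rw [← integral_finsetSum, ← integral_add]
    · refine integral_congr_ae (ae_restrict_of_ae ?_)
      filter_upwards [ae_notMem s] with w hw
      rcases mul_eq_zero_or hψW w with h0 | hwW
      · rcases mul_eq_zero_or hdW w with h0' | hwW
        · simp [h0, h0']
        · rw [h.logDeriv_eq hwW hw, h0, mul_add, mul_add, Finset.mul_sum, Finset.mul_sum, zero_mul,
            add_zero]
          congr 1
          exact Finset.sum_congr rfl fun u _ ↦ by ring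
      · rw [h.logDeriv_eq hwW hw, h.dbarC_logDeriv hwW, mul_add, mul_add, Finset.mul_sum,
          Finset.mul_sum, mul_zero, add_zero]
        congr 1
        exact Finset.sum_congr rfl fun u _ ↦ by ring
    · exact (integrable_finsetSum _ fun u _ ↦
        ((integrable_mul_inv_sub hcd hsd u).const_mul _).const_mul _).integrableOn
    · exact hregi.integrableOn
    · exact fun u _ ↦ (((integrable_mul_inv_sub hcd hsd u).const_mul _).const_mul _).integrableOn
  have hline (u : ℂ) (hu : u ∈ s) : Integrable (fun t : ℝ ↦ ψ (t + y * I) * (t + y * I - u)⁻¹) := by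
    refine Continuous.integrable_of_hasCompactSupport ?_ ?_
    · refine (hψ.continuous.comp (isClosedEmbedding_horizontalLine y).continuous).mul ?_
      exact Continuous.inv₀ (by fun_prop) (horizontal_sub_ne_zero (hy u hu))
    · exact (hc.comp_isClosedEmbedding (isClosedEmbedding_horizontalLine y)).mul_right
  have hR : ∫ t : ℝ, ψ (t + y * I) * logDeriv f (t + y * I) =
      (∑ u ∈ s, n u * ∫ t : ℝ, ψ (t + y * I) * (t + y * I - u)⁻¹) +
      ∫ t : ℝ, ψ (t + y * I) * logDeriv g (t + y * I) := by
    simp_rw [← integral_const_mul]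
    rw [← integral_finsetSum _ (fun u hu ↦ (hline u hu).const_mul _), ← integral_add]
    · refine integral_congr_ae (Eventually.of_forall fun t ↦ ?_)
      simp only
      rcases mul_eq_zero_or hψW ((t : ℂ) + y * I) with h0 | hwW
      · simp [h0]
      · rw [h.logDeriv_eq hwW (horizontal_notMem hy t), mul_add, Finset.mul_sum]
        congr 1
        exact Finset.sum_congr rfl fun u _ ↦ by ring
    · exact integrable_finsetSum _ fun u hu ↦ (hline u hu).const_mul _
    · exact integrable_horizontal (continuous_mul_of_tsupport_subset h.isOpen hψ.continuous hψW
        h.continuousOn_logDeriv) hc.mul_right y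
  rw [hL, hreg, hR, Finset.sum_congr rfl fun u hu ↦ by
    rw [integral_dbarC_mul_inv_halfPlane hψ hc (hy u hu)]]
  simp only [mul_sub, Finset.sum_sub_distrib, mul_neg, Finset.sum_neg_distrib]
  rw [Finset.mul_sum]
  have : ∑ u ∈ s, (n u : ℂ) * (2 * π * I * if u.im < y then ψ u else 0) =
      ∑ u ∈ s, 2 * π * I * (n u * if u.im < y then ψ u else 0) :=
    Finset.sum_congr rfl fun u _ ↦ by ring
  rw [this]
  ring

/-- Green's formula on the half plane `Im w ≤ y` for a test function times `log |f|`. -/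
lemma integral_dbarC_mul_log_norm (h : IsFactoredOn f W s n g) {ψ : ℂ → ℂ} (hψ : ContDiff ℝ 1 ψ)
    (hc : HasCompactSupport ψ) (hψW : tsupport ψ ⊆ W) {y : ℝ} (hy : ∀ u ∈ s, u.im ≠ y) :
    ∫ w in {w : ℂ | w.im ≤ y}, 2 * I * (dbarC ψ w * (Real.log ‖f w‖ : ℂ) +
        ψ w * (1 / 2 * conj (logDeriv f w))) =
      - ∫ t : ℝ, ψ (t + y * I) * (Real.log ‖f (t + y * I)‖ : ℂ) := by
  have hcd := continuous_dbarC hψ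
  have hsd := hasCompactSupport_dbarC hc
  have hdW := (tsupport_dbarC_subset ψ).trans hψW
  set ℓ : ℂ → ℂ := fun w ↦ (Real.log ‖g w‖ : ℂ)
  have hℓ : ContDiffOn ℝ 1 ℓ W := fun w hw ↦
    ((contDiffAt_log_norm (h.analyticAt w hw) (h.ne_zero w hw)).of_le (by simp)).contDiffWithinAt
  have hreg := integral_dbarC_mul_halfPlane h.isOpen hψ hc hψW hℓ y
  have hdℓ {w : ℂ} (hw : w ∈ W) : dbarC ℓ w = 1 / 2 * conj (logDeriv g w) :=
    dbarC_log_norm (h.analyticAt w hw) (h.ne_zero w hw)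
  have hregi : Integrable (fun w ↦ 2 * I * (dbarC ψ w * ℓ w + ψ w * dbarC ℓ w)) := by
    refine Integrable.const_mul (Integrable.add ?_ ?_) _
    · exact (continuous_mul_of_tsupport_subset h.isOpen hcd hdW
        hℓ.continuousOn).integrable_of_hasCompactSupport hsd.mul_right
    · refine (continuous_mul_of_tsupport_subset h.isOpen hψ.continuous hψW
        ?_).integrable_of_hasCompactSupport hc.mul_right
      refine ContinuousOn.congr (f := fun w ↦ 1 / 2 * conj (logDeriv g w)) ?_ fun w hw ↦ hdℓ hw
      exact continuousOn_const.mul (continuous_conj.comp_continuousOn h.continuousOn_logDeriv)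
  have hsing (u : ℂ) : Integrable (fun w ↦ 2 * I * (dbarC ψ w * (Real.log ‖w - u‖ : ℂ) +
        ψ w * (1 / 2 * conj (w - u)⁻¹))) := by
    refine Integrable.const_mul (Integrable.add (integrable_mul_log_sub hcd hsd u) ?_) _
    refine integrable_mul_of_norm_le_inv hψ.continuous hc ?_ u (C := 0) fun w ↦ ?_
    · have h3 : Measurable (fun w : ℂ ↦ conj (w - u)⁻¹) :=
        continuous_conj.measurable.comp (measurable_id.sub_const u).inv
      exact (h3.const_mul _).aestronglyMeasurable
    · rw [norm_mul, RCLike.norm_conj, norm_inv]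
      norm_num
      have := inv_nonneg.mpr (norm_nonneg (w - u))
      linarith
  have hL : ∫ w in {w : ℂ | w.im ≤ y}, 2 * I * (dbarC ψ w * (Real.log ‖f w‖ : ℂ) +
        ψ w * (1 / 2 * conj (logDeriv f w))) =
      (∑ u ∈ s, n u * ∫ w in {w : ℂ | w.im ≤ y}, 2 * I * (dbarC ψ w * (Real.log ‖w - u‖ : ℂ) +
        ψ w * (1 / 2 * conj (w - u)⁻¹))) +
      ∫ w in {w : ℂ | w.im ≤ y}, 2 * I * (dbarC ψ w * ℓ w + ψ w * dbarC ℓ w) := by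
    simp_rw [← integral_const_mul]
    rw [← integral_finsetSum, ← integral_add]
    · refine integral_congr_ae (ae_restrict_of_ae ?_)
      filter_upwards [ae_notMem s] with w hw
      by_cases hwW : w ∈ W
      · rw [h.log_norm_eq hwW hw, h.logDeriv_eq hwW hw, hdℓ hwW]
        simp only [ℓ]
        push_cast
        rw [map_add, map_sum]
        simp only [mul_add, Finset.mul_sum, map_mul, map_intCast, Finset.sum_add_distrib]
        rw [add_add_add_comm]
        congr 2 <;> exact Finset.sum_congr rfl fun u _ ↦ by ring
      · have h1 := (mul_eq_zero_or hψW w).resolve_right hwW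
        have h2 := (mul_eq_zero_or hdW w).resolve_right hwW
        simp [h1, h2]
    · exact (integrable_finsetSum _ fun u _ ↦ (hsing u).const_mul _).integrableOn
    · exact hregi.integrableOn
    · exact fun u _ ↦ ((hsing u).const_mul _).integrableOn
  have hline (u : ℂ) (hu : u ∈ s) :
      Integrable (fun t : ℝ ↦ ψ (t + y * I) * (Real.log ‖t + y * I - u‖ : ℂ)) := by
    refine Continuous.integrable_of_hasCompactSupport ?_ ?_
    · refine (hψ.continuous.comp (isClosedEmbedding_horizontalLine y).continuous).mul ?_
      refine continuous_ofReal.comp (Continuous.log (by fun_prop) fun t ↦ ?_)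
      exact norm_ne_zero_iff.mpr (horizontal_sub_ne_zero (hy u hu) t)
    · exact (hc.comp_isClosedEmbedding (isClosedEmbedding_horizontalLine y)).mul_right
  have hR : ∫ t : ℝ, ψ (t + y * I) * (Real.log ‖f (t + y * I)‖ : ℂ) =
      (∑ u ∈ s, n u * ∫ t : ℝ, ψ (t + y * I) * (Real.log ‖t + y * I - u‖ : ℂ)) +
      ∫ t : ℝ, ψ (t + y * I) * ℓ (t + y * I) := by
    simp_rw [← integral_const_mul]
    rw [← integral_finsetSum _ (fun u hu ↦ (hline u hu).const_mul _), ← integral_add]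
    · refine integral_congr_ae (Eventually.of_forall fun t ↦ ?_)
      simp only
      rcases mul_eq_zero_or hψW ((t : ℂ) + y * I) with h0 | hwW
      · simp [h0]
      · rw [h.log_norm_eq hwW (horizontal_notMem hy t)]
        push_cast
        rw [mul_add, Finset.mul_sum]
        congr 1
        exact Finset.sum_congr rfl fun u _ ↦ by ring
    · exact integrable_finsetSum _ fun u hu ↦ (hline u hu).const_mul _
    · exact integrable_horizontal (continuous_mul_of_tsupport_subset h.isOpen hψ.continuous hψW
        hℓ.continuousOn) hc.mul_right y
  rw [hL, hreg, hR, Finset.sum_congr rfl fun u hu ↦ by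
    rw [integral_dbarC_mul_log_halfPlane hψ hc (hy u hu)]]
  simp only [mul_neg, Finset.sum_neg_distrib]
  ring

end IsFactoredOn

end RohrlichDivisor

end

noncomputable section

namespace RohrlichDivisor

/-! ### Functions on the upper half plane -/

lemma exists_bump {K V : Set ℂ} (hK : IsCompact K) (hV : IsOpen V) (hKV : K ⊆ V) :
    ∃ b : ℂ → ℝ, ContDiff ℝ ∞ b ∧ HasCompactSupport b ∧ tsupport b ⊆ V ∧
      (∀ x ∈ K, b x = 1) ∧ ∀ x, b x ∈ Set.Icc 0 1 := by
  obtain ⟨U, hU, hKU, hUV⟩ := exists_compact_between hK hV hKV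
  obtain ⟨b, h1, h0, hb⟩ := exists_contMDiffMap_one_nhds_of_subset_interior (n := ⊤)
    (modelWithCornersSelf ℝ ℂ) hK.isClosed hKU
  have hsub : tsupport b ⊆ U :=
    closure_minimal (fun x hx ↦ by_contra fun h ↦ hx (h0 x h)) hU.isClosed
  exact ⟨b, b.contMDiff.contDiff, hU.of_isClosed_subset (isClosed_tsupport _) hsub,
    hsub.trans hUV, fun x hx ↦ h1.self_of_nhdsSet x hx, hb⟩

lemma ofComplex_im {w : ℂ} (hw : w ∈ upperHalfPlaneSet) : (ofComplex w).im = w.im := by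
  rw [ofComplex_apply_of_im_pos hw]
  rfl

lemma coe_ofComplex {w : ℂ} (hw : w ∈ upperHalfPlaneSet) : ((ofComplex w : ℍ) : ℂ) = w := by
  rw [ofComplex_apply_of_im_pos hw]

lemma measurable_density :
    Measurable fun z : ℍ ↦ ((1 / NNReal.mk z.im z.im_pos.le : NNReal) ^ 2) := by
  refine (Measurable.div measurable_const ?_).pow_const 2
  exact (UpperHalfPlane.continuous_im.subtype_mk _).measurable

lemma density_smul (τ : ℍ) (c : ℂ) :
    ((1 / NNReal.mk τ.im τ.im_pos.le : NNReal) ^ 2) • c = c / (τ.im : ℂ) ^ 2 := by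
  rw [NNReal.smul_def, real_smul, NNReal.coe_pow, NNReal.coe_div, NNReal.coe_mk]
  push_cast
  ring

/-- The density `v⁻²` of the invariant measure is absorbed into `Q`. The right side runs over all of
`S ⊆ ℂ`, hence the vanishing of `Q` off the half plane. -/
lemma integral_upperHalfPlane (q : ℍ → ℂ) {Q : ℂ → ℂ}
    (hQ : ∀ τ : ℍ, Q τ = q τ / (τ.im : ℂ) ^ 2) (hQ0 : ∀ w ∉ upperHalfPlaneSet, Q w = 0)
    {S : Set ℂ} (hS : MeasurableSet S) :
    ∫ τ in {τ : ℍ | (τ : ℂ) ∈ S}, q τ = ∫ w in S, Q w := by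
  have hS' : MeasurableSet {τ : ℍ | (τ : ℂ) ∈ S} := measurable_coe hS
  rw [volume_def, restrict_withDensity hS',
    integral_withDensity_eq_integral_smul measurable_density]
  simp_rw [density_smul, ← hQ]
  have h2 : (volume.comap UpperHalfPlane.coe).restrict {τ : ℍ | (τ : ℂ) ∈ S} =
      (volume.restrict S).comap UpperHalfPlane.coe := by
    rw [measurableEmbedding_coe.comap_restrict]
    rfl
  rw [h2, ← measurableEmbedding_coe.integral_map, measurableEmbedding_coe.map_comap,
    UpperHalfPlane.range_coe, Measure.restrict_restrict isOpen_upperHalfPlaneSet.measurableSet]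
  exact (setIntegral_eq_of_subset_of_forall_sdiff_eq_zero hS Set.inter_subset_right
    fun w hw ↦ hQ0 w fun h ↦ hw.2 ⟨h, hw.1⟩).symm

lemma integrable_upperHalfPlane (q : ℍ → ℂ) {Q : ℂ → ℂ}
    (hQ : ∀ τ : ℍ, Q τ = q τ / (τ.im : ℂ) ^ 2) (hi : Integrable Q) : Integrable q := by
  rw [volume_def, integrable_withDensity_iff_integrable_smul measurable_density]
  simp_rw [density_smul, ← hQ]
  have h3 : Integrable Q ((volume.comap UpperHalfPlane.coe).map UpperHalfPlane.coe) := by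
    rw [measurableEmbedding_coe.map_comap]
    exact hi.integrableOn
  exact (measurableEmbedding_coe.integrable_map_iff).mp h3

lemma contDiffOn_im_zpow (m : ℤ) :
    ContDiffOn ℝ ∞ (fun w : ℂ ↦ (w.im : ℂ) ^ m) upperHalfPlaneSet := fun w hw ↦ by
  have hw : 0 < w.im := hw
  have h1 : ContDiffAt ℝ ∞ (fun w : ℂ ↦ (w.im : ℂ)) w :=
    (ofRealCLM ∘L imCLM).contDiff.contDiffAt
  have h0 : ((w.im : ℝ) : ℂ) ≠ 0 := by exact_mod_cast hw.ne'
  rcases m with n | n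
  · simpa using (h1.pow n).contDiffWithinAt
  · simp only [zpow_negSucc]
    exact ((h1.pow (n + 1)).inv (pow_ne_zero _ h0)).contDiffWithinAt

lemma contDiffOn_dbarC {φ : ℂ → ℂ} {V : Set ℂ} (hV : IsOpen V) (hφ : ContDiffOn ℝ ∞ φ V) :
    ContDiffOn ℝ ∞ (dbarC φ) V := by
  have h := hφ.fderiv_of_isOpen (m := ∞) hV (by simp)
  have h1 (v : ℂ) : ContDiffOn ℝ ∞ (fun w ↦ fderiv ℝ φ w v) V := h.clm_apply contDiffOn_const
  exact contDiffOn_const.mul ((h1 1).add (contDiffOn_const.mul (h1 I)))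

lemma xiOp_comp_ofComplex (m : ℤ) (φ : ℍ → ℂ) {w : ℂ} (hw : w ∈ upperHalfPlaneSet) :
    (xiOp m φ ∘ ofComplex) w = 2 * I * (w.im : ℂ) ^ m * conj (dbarC (φ ∘ ofComplex) w) := by
  rw [Function.comp_apply, xiOp, dbar_eq_dbarC, ofComplex_im hw, coe_ofComplex hw]

lemma contDiffOn_xiOp (m : ℤ) {φ : ℍ → ℂ}
    (hφ : ContDiffOn ℝ ∞ (φ ∘ ofComplex) upperHalfPlaneSet) :
    ContDiffOn ℝ ∞ (xiOp m φ ∘ ofComplex) upperHalfPlaneSet := by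
  refine ContDiffOn.congr ?_ fun w hw ↦ xiOp_comp_ofComplex m φ hw
  exact (contDiffOn_const.mul (contDiffOn_im_zpow m)).mul
    ((conjCLE : ℂ ≃L[ℝ] ℂ).contDiff.comp_contDiffOn
      (contDiffOn_dbarC isOpen_upperHalfPlaneSet hφ))

lemma contDiffOn_lapOp (m : ℤ) {φ : ℍ → ℂ}
    (hφ : ContDiffOn ℝ ∞ (φ ∘ ofComplex) upperHalfPlaneSet) :
    ContDiffOn ℝ ∞ (lapOp m φ ∘ ofComplex) upperHalfPlaneSet :=
  (contDiffOn_xiOp (2 - m) (contDiffOn_xiOp m hφ)).neg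

lemma logDerivOp_comp_ofComplex (k : ℤ) (f : ℍ → ℂ) {w : ℂ} (hw : w ∈ upperHalfPlaneSet) :
    logDerivOp k f (ofComplex w) =
      (2 * π * I)⁻¹ * logDeriv (f ∘ ofComplex) w - k / (4 * π) * (w.im : ℂ)⁻¹ := by
  rw [logDerivOp, Derivative.normalizedDerivOfComplex, ofComplex_im hw, coe_ofComplex hw,
    logDeriv_apply, Function.comp_apply]
  ring

/-- At a zero of `f` the left side is the default `Real.log 0 = 0`, and the splitting can fail; it
is therefore used almost everywhere. -/
lemma logNorm_eq {k : ℤ} {f : ℍ → ℂ} {τ : ℍ} (h : f τ ≠ 0) :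
    logNorm k f τ = (Real.log ‖f τ‖ : ℂ) + k / 2 * (Real.log τ.im : ℂ) := by
  rw [logNorm, Real.log_mul (Real.rpow_pos_of_pos τ.im_pos _).ne' (norm_ne_zero_iff.mpr h),
    Real.log_rpow τ.im_pos]
  push_cast
  ring

lemma logNorm_comp_ofComplex {k : ℤ} {f : ℍ → ℂ} {w : ℂ} (hw : w ∈ upperHalfPlaneSet)
    (h : f (ofComplex w) ≠ 0) :
    logNorm k f (ofComplex w) =
      (Real.log ‖(f ∘ ofComplex) w‖ : ℂ) + k / 2 * (Real.log w.im : ℂ) := by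
  rw [logNorm_eq h, ofComplex_im hw, Function.comp_apply]

lemma conj_logNorm (k : ℤ) (f : ℍ → ℂ) (τ : ℍ) : conj (logNorm k f τ) = logNorm k f τ :=
  conj_ofReal _

lemma contDiffOn_log_im :
    ContDiffOn ℝ ∞ (fun w : ℂ ↦ (Real.log w.im : ℂ)) upperHalfPlaneSet := fun w hw ↦ by
  have hw : 0 < w.im := hw
  exact (ofRealCLM.contDiff.contDiffAt.comp w
    (imCLM.contDiff.contDiffAt.log hw.ne')).contDiffWithinAt

lemma dbarC_log_im {w : ℂ} (hw : w ∈ upperHalfPlaneSet) :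
    dbarC (fun w : ℂ ↦ (Real.log w.im : ℂ)) w = (w.im : ℂ)⁻¹ * (I / 2) := by
  have hw : 0 < w.im := hw
  rw [dbarC_ofReal_comp (φ := Complex.im) (Real.hasDerivAt_log hw.ne') imCLM.differentiableAt,
    dbarC_im]
  push_cast
  rfl

lemma dbarC_inv_im {w : ℂ} (hw : w ∈ upperHalfPlaneSet) :
    dbarC (fun w : ℂ ↦ (w.im : ℂ)⁻¹) w = -((w.im : ℂ) ^ 2)⁻¹ * (I / 2) := by
  have hw : 0 < w.im := hw
  have h : (fun w : ℂ ↦ (w.im : ℂ)⁻¹) = fun w ↦ ((w.im⁻¹ : ℝ) : ℂ) := by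
    ext w
    push_cast
    rfl
  rw [h, dbarC_ofReal_comp (φ := Complex.im) (hasDerivAt_inv hw.ne') imCLM.differentiableAt,
    dbarC_im]
  push_cast
  rfl

/-- The data of the meromorphic function in Green's formula: it is in normal form on `ℍ` and
nowhere locally zero. -/
structure IsNonzeroMeromorphic (f : ℍ → ℂ) : Prop where
  meromorphicNFOn : MeromorphicNFOn (f ∘ ofComplex) upperHalfPlaneSet
  order_ne_top : ∀ z ∈ upperHalfPlaneSet, meromorphicOrderAt (f ∘ ofComplex) z ≠ ⊤

lemma IsNonzeroMeromorphic.exists_isFactoredOn {f : ℍ → ℂ} (hf : IsNonzeroMeromorphic f)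
    {K : Set ℂ} (hK : IsCompact K) (hKV : K ⊆ upperHalfPlaneSet) :
    ∃ (W : Set ℂ) (s : Finset ℂ) (g : ℂ → ℂ), K ⊆ W ∧ W ⊆ upperHalfPlaneSet ∧
      ↑s ⊆ upperHalfPlaneSet ∧ (∀ z ∈ s, (f ∘ ofComplex) z = 0) ∧
      (∀ z ∈ W, z ∉ s → (meromorphicOrderAt (f ∘ ofComplex) z).untop₀ = 0) ∧
      IsFactoredOn (f ∘ ofComplex) W s
        (fun z ↦ (meromorphicOrderAt (f ∘ ofComplex) z).untop₀) g := by
  obtain ⟨W, s, g, h1, h2, h3, h4, h5, h6, h7, h8⟩ :=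
    exists_factorization isOpen_upperHalfPlaneSet hf.meromorphicNFOn hf.order_ne_top hK hKV
  exact ⟨W, s, g, h2, h3, h4, h5, h6, h1, fun w hw ↦ (h7 w hw).1, fun w hw ↦ (h7 w hw).2, h8⟩

lemma IsFactoredOn.apply_ne_zero {f : ℂ → ℂ} {W : Set ℂ} {s : Finset ℂ} {n : ℂ → ℤ} {g : ℂ → ℂ}
    (h : IsFactoredOn f W s n g) {w : ℂ} (hw : w ∈ W) (hs : w ∉ s) : f w ≠ 0 := by
  rw [h.eq_prod w hw]
  refine mul_ne_zero (Finset.prod_ne_zero_iff.mpr fun u hu ↦ zpow_ne_zero _ fun h0 ↦ hs ?_)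
    (h.ne_zero w hw)
  rwa [sub_eq_zero.mp h0]

lemma IsNonzeroMeromorphic.integrable_mul_logNorm {f : ℍ → ℂ} (hf : IsNonzeroMeromorphic f)
    (k : ℤ) {φ : ℂ → ℂ} (hφ : Continuous φ) (hc : HasCompactSupport φ)
    (hφV : tsupport φ ⊆ upperHalfPlaneSet) :
    Integrable (fun w ↦ φ w * logNorm k f (ofComplex w)) := by
  obtain ⟨W, s, g, hKW, hWV, -, -, -, hfac⟩ := hf.exists_isFactoredOn hc hφV
  have h2 : Continuous (fun w ↦ φ w * (k / 2 * (Real.log w.im : ℂ))) :=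
    continuous_mul_of_tsupport_subset isOpen_upperHalfPlaneSet hφ hφV
      (continuousOn_const.mul contDiffOn_log_im.continuousOn)
  refine ((hfac.integrable_mul_log_norm hφ hc hKW).add
    (h2.integrable_of_hasCompactSupport hc.mul_right)).congr ?_
  filter_upwards [IsFactoredOn.ae_notMem s] with w hw
  rcases IsFactoredOn.mul_eq_zero_or hKW w with h0 | hwW
  · simp [h0]
  · rw [logNorm_comp_ofComplex (hWV hwW) (hfac.apply_ne_zero hwW hw)]
    simp only [Pi.add_apply]
    ring

lemma IsNonzeroMeromorphic.integrable_mul_logDerivOp {f : ℍ → ℂ} (hf : IsNonzeroMeromorphic f)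
    (k : ℤ) {φ : ℂ → ℂ} (hφ : Continuous φ) (hc : HasCompactSupport φ)
    (hφV : tsupport φ ⊆ upperHalfPlaneSet) :
    Integrable (fun w ↦ φ w * logDerivOp k f (ofComplex w)) := by
  obtain ⟨W, s, g, hKW, hWV, -, -, -, hfac⟩ := hf.exists_isFactoredOn hc hφV
  have h2 : Continuous (fun w ↦ φ w * (k / (4 * π) * (w.im : ℂ) ^ (-1 : ℤ))) :=
    continuous_mul_of_tsupport_subset isOpen_upperHalfPlaneSet hφ hφV
      (continuousOn_const.mul (contDiffOn_im_zpow _).continuousOn)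
  refine (((hfac.integrable_mul_logDeriv hφ hc hKW).const_mul (2 * π * I)⁻¹).sub
    (h2.integrable_of_hasCompactSupport hc.mul_right)).congr (Eventually.of_forall fun w ↦ ?_)
  rcases IsFactoredOn.mul_eq_zero_or hKW w with h0 | hwW
  · simp [h0]
  · simp only [Pi.sub_apply, zpow_neg_one]
    rw [logDerivOp_comp_ofComplex k f (hWV hwW)]
    ring

lemma horizontal_mem {y : ℝ} (hy : 0 < y) (t : ℝ) : (t : ℂ) + y * I ∈ upperHalfPlaneSet := by
  simpa [upperHalfPlaneSet] using hy

lemma integrable_horizontal_mul {ψ h : ℂ → ℂ} {y : ℝ} (hψ : Continuous ψ)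
    (hc : HasCompactSupport ψ) (hh : ∀ t : ℝ, ContinuousAt h (t + y * I)) :
    Integrable fun t : ℝ ↦ ψ (t + y * I) * h (t + y * I) := by
  have hemb := isClosedEmbedding_horizontalLine y
  refine Continuous.integrable_of_hasCompactSupport ((hψ.comp hemb.continuous).mul ?_)
    ((hc.comp_isClosedEmbedding hemb).mul_right)
  exact continuous_iff_continuousAt.mpr fun t ↦
    ContinuousAt.comp (f := fun t : ℝ ↦ (t + y * I : ℂ)) (hh t) hemb.continuous.continuousAt

lemma IsNonzeroMeromorphic.analyticAt {f : ℍ → ℂ} (hf : IsNonzeroMeromorphic f) {w : ℂ}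
    (hw : w ∈ upperHalfPlaneSet) (h : f (ofComplex w) ≠ 0) : AnalyticAt ℂ (f ∘ ofComplex) w := by
  have h1 := hf.meromorphicNFOn hw
  rw [← h1.meromorphicOrderAt_nonneg_iff_analyticAt]
  exact (h1.meromorphicOrderAt_eq_zero_iff.mpr h).ge

lemma IsNonzeroMeromorphic.horizontal_ne_zero {f : ℍ → ℂ} (_ : IsNonzeroMeromorphic f) {y : ℝ}
    (hy : 0 < y) (hfy : ∀ τ : ℍ, y ≤ τ.im → f τ ≠ 0) (t : ℝ) :
    f (ofComplex (t + y * I)) ≠ 0 :=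
  hfy _ (by rw [ofComplex_im (horizontal_mem hy t)]; simp)

/-- Green's formula for a test function times `𝒟_k f`. -/
lemma IsNonzeroMeromorphic.integral_dbarC_mul_logDerivOp {f : ℍ → ℂ} (hf : IsNonzeroMeromorphic f)
    (k : ℤ) {ψ : ℂ → ℂ} (hψ : ContDiff ℝ 1 ψ) (hc : HasCompactSupport ψ)
    (hψV : tsupport ψ ⊆ upperHalfPlaneSet) {y : ℝ} (hy : 0 < y)
    (hfy : ∀ τ : ℍ, y ≤ τ.im → f τ ≠ 0) :
    ∫ w in {w : ℂ | w.im ≤ y}, 2 * I * (dbarC ψ w * logDerivOp k f (ofComplex w) +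
        ψ w * (k * I / (8 * π) * (w.im : ℂ) ^ (-2 : ℤ))) =
      - (∫ t : ℝ, ψ (t + y * I) * logDerivOp k f (ofComplex (t + y * I))) -
        ∑ᶠ z : ℍ, ordAt f z * ψ z := by
  obtain ⟨W, s, g, hKW, hWV, hsV, hs0, hs1, hfac⟩ := hf.exists_isFactoredOn hc hψV
  -- The points split off, poles included, have `f u = 0`, so they lie strictly below height `y` and
  -- the condition `u.im < y` on the point terms is always met.
  have hsy : ∀ u ∈ s, u.im < y := fun u hu ↦ by
    by_contra! h
    refine hfy (ofComplex u) ?_ (hs0 u hu)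
    rwa [ofComplex_im (hsV hu)]
  have hmeas : MeasurableSet {w : ℂ | w.im ≤ y} := measurableSet_le measurable_im measurable_const
  have hcd := continuous_dbarC hψ
  have hsd := hasCompactSupport_dbarC hc
  have hdW := (tsupport_dbarC_subset ψ).trans hKW
  have hdV := (tsupport_dbarC_subset ψ).trans hψV
  have hA := hfac.integral_dbarC_mul_logDeriv hψ hc hKW fun u hu ↦ (hsy u hu).ne
  have hinv : ContDiffOn ℝ ∞ (fun w : ℂ ↦ (w.im : ℂ)⁻¹) upperHalfPlaneSet := by
    simpa using contDiffOn_im_zpow (-1)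
  have hB := integral_dbarC_mul_halfPlane isOpen_upperHalfPlaneSet hψ hc hψV
    (hinv.of_le (by simp)) y
  have hiA : Integrable (fun w ↦ 2 * I * (dbarC ψ w * logDeriv (f ∘ ofComplex) w)) :=
    (hfac.integrable_mul_logDeriv hcd hsd hdW).const_mul _
  have hiB : Integrable (fun w ↦ 2 * I * (dbarC ψ w * (w.im : ℂ)⁻¹ +
      ψ w * dbarC (fun w ↦ (w.im : ℂ)⁻¹) w)) := by
    refine Integrable.const_mul (.add ?_ ?_) _
    · exact (continuous_mul_of_tsupport_subset isOpen_upperHalfPlaneSet hcd hdV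
        hinv.continuousOn).integrable_of_hasCompactSupport hsd.mul_right
    · exact (continuous_mul_of_tsupport_subset isOpen_upperHalfPlaneSet hψ.continuous hψV
        (contDiffOn_dbarC isOpen_upperHalfPlaneSet
          hinv).continuousOn).integrable_of_hasCompactSupport hc.mul_right
  have hline (t : ℝ) : ψ (t + y * I) * logDerivOp k f (ofComplex (t + y * I)) =
      (2 * π * I)⁻¹ * (ψ (t + y * I) * logDeriv (f ∘ ofComplex) (t + y * I)) -
        k / (4 * π) * (ψ (t + y * I) * (((t + y * I : ℂ).im : ℂ))⁻¹) := by
    rw [logDerivOp_comp_ofComplex k f (horizontal_mem hy t)]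
    ring
  have hiA' : Integrable fun t : ℝ ↦ ψ (t + y * I) * logDeriv (f ∘ ofComplex) (t + y * I) := by
    refine integrable_horizontal_mul hψ.continuous hc fun t ↦ ?_
    have h0 := hf.horizontal_ne_zero hy hfy t
    have han := hf.analyticAt (horizontal_mem hy t) h0
    exact han.deriv.continuousAt.div han.continuousAt h0
  have hiB' : Integrable fun t : ℝ ↦ ψ (t + y * I) * (((t + y * I : ℂ).im : ℂ))⁻¹ :=
    integrable_horizontal (continuous_mul_of_tsupport_subset isOpen_upperHalfPlaneSet
      hψ.continuous hψV hinv.continuousOn) hc.mul_right y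
  have hsum : ∑ᶠ z : ℍ, (ordAt f z : ℂ) * ψ z =
      ∑ u ∈ s, ((meromorphicOrderAt (f ∘ ofComplex) u).untop₀ : ℂ) *
        (if u.im < y then ψ u else 0) := by
    classical
    have h1 : ∀ z : ℍ, z ∈ Function.support (fun z : ℍ ↦ (ordAt f z : ℂ) * ψ z) → (z : ℂ) ∈ s := by
      intro z hz
      rcases IsFactoredOn.mul_eq_zero_or hKW (z : ℂ) with h0 | hw
      · simp [h0] at hz
      · by_contra h
        exact hz (by simp [ordAt, hs1 z hw h])
    rw [finsum_eq_sum_of_support_subset (s := s.preimage UpperHalfPlane.coe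
      UpperHalfPlane.coe_injective.injOn) _ fun z hz ↦ by simpa using h1 z hz]
    rw [← Finset.sum_preimage UpperHalfPlane.coe s UpperHalfPlane.coe_injective.injOn
      (fun u ↦ ((meromorphicOrderAt (f ∘ ofComplex) u).untop₀ : ℂ) *
        (if u.im < y then ψ u else 0)) ?_]
    · refine Finset.sum_congr rfl fun z hz ↦ ?_
      rw [if_pos (hsy _ (by simpa using hz))]
      rfl
    · intro u hu hu'
      exact absurd ⟨⟨u, hsV hu⟩, rfl⟩ hu'
  -- The non-holomorphic part `-k / (4 π v)` has the `w̄`-derivative `k i / (8 π v²)`: this is the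
  -- extra area term.
  have hpt : ∀ w, 2 * I * (dbarC ψ w * logDerivOp k f (ofComplex w) +
        ψ w * (k * I / (8 * π) * (w.im : ℂ) ^ (-2 : ℤ))) =
      (2 * π * I)⁻¹ * (2 * I * (dbarC ψ w * logDeriv (f ∘ ofComplex) w)) -
        k / (4 * π) * (2 * I * (dbarC ψ w * (w.im : ℂ)⁻¹ +
      ψ w * dbarC (fun w ↦ (w.im : ℂ)⁻¹) w)) := fun w ↦ by
    rcases IsFactoredOn.mul_eq_zero_or hψV w with h0 | hw
    · rcases IsFactoredOn.mul_eq_zero_or hdV w with h1 | hw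
      · simp [h0, h1]
      · rw [h0, logDerivOp_comp_ofComplex k f hw]
        ring
    · rw [logDerivOp_comp_ofComplex k f hw, dbarC_inv_im hw]
      rw [show (-2 : ℤ) = -(2 : ℕ) from rfl, zpow_neg, zpow_natCast]
      ring
  simp_rw [hpt, hline]
  rw [integral_sub (hiA.const_mul _).integrableOn (hiB.const_mul _).integrableOn,
    integral_sub (hiA'.const_mul _) (hiB'.const_mul _), hsum]
  simp only [integral_const_mul] at hA hB ⊢
  have h2 : (2 * π * I : ℂ) ≠ 0 := by simp [Real.pi_ne_zero]
  linear_combination (2 * π * I : ℂ)⁻¹ * hA - k / (4 * π) * hB +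
      (-∑ u ∈ s, ((meromorphicOrderAt (f ∘ ofComplex) u).untop₀ : ℂ) *
        (if u.im < y then ψ u else 0)) * inv_mul_cancel₀ h2

/-- Green's formula for a test function times `log (v^{k/2} |f|)`. -/
lemma IsNonzeroMeromorphic.integral_dbarC_mul_logNorm {f : ℍ → ℂ} (hf : IsNonzeroMeromorphic f)
    (k : ℤ) {ψ : ℂ → ℂ} (hψ : ContDiff ℝ 1 ψ) (hc : HasCompactSupport ψ)
    (hψV : tsupport ψ ⊆ upperHalfPlaneSet) {y : ℝ} (hy : 0 < y)
    (hfy : ∀ τ : ℍ, y ≤ τ.im → f τ ≠ 0) :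
    ∫ w in {w : ℂ | w.im ≤ y}, 2 * I * (dbarC ψ w * logNorm k f (ofComplex w) +
        ψ w * (-π * I * conj (logDerivOp k f (ofComplex w)))) =
      - ∫ t : ℝ, ψ (t + y * I) * logNorm k f (ofComplex (t + y * I)) := by
  obtain ⟨W, s, g, hKW, hWV, hsV, hs0, hs1, hfac⟩ := hf.exists_isFactoredOn hc hψV
  have hsy : ∀ u ∈ s, u.im ≠ y := fun u hu h ↦ by
    refine hfy (ofComplex u) ?_ (hs0 u hu)
    rw [ofComplex_im (hsV hu), h]
  have hcd := continuous_dbarC hψ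
  have hsd := hasCompactSupport_dbarC hc
  have hdW := (tsupport_dbarC_subset ψ).trans hKW
  have hdV := (tsupport_dbarC_subset ψ).trans hψV
  have hA := hfac.integral_dbarC_mul_log_norm hψ hc hKW hsy
  have hB := integral_dbarC_mul_halfPlane isOpen_upperHalfPlaneSet hψ hc hψV
    (contDiffOn_log_im.of_le (by simp)) y
  have hiA : Integrable (fun w ↦ 2 * I * (dbarC ψ w * (Real.log ‖(f ∘ ofComplex) w‖ : ℂ) +
        ψ w * (1 / 2 * conj (logDeriv (f ∘ ofComplex) w)))) := by
    refine Integrable.const_mul ((hfac.integrable_mul_log_norm hcd hsd hdW).add ?_) _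
    have h1 := hfac.integrable_mul_logDeriv (φ := fun w ↦ conj (ψ w))
      (continuous_conj.comp hψ.continuous) (hc.comp_left (g := conj) (map_zero _))
      ((tsupport_comp_subset (g := conj) (map_zero _) ψ).trans hKW)
    refine (((LinearIsometryEquiv.integrable_comp_iff conjLIE).mpr h1).const_mul (1 / 2)).congr
      (Eventually.of_forall fun w ↦ ?_)
    simp only [conjLIE_apply, map_mul, conj_conj]
    ring
  have hiB : Integrable (fun w ↦ 2 * I * (dbarC ψ w * (Real.log w.im : ℂ) +
      ψ w * dbarC (fun w ↦ (Real.log w.im : ℂ)) w)) := by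
    refine Integrable.const_mul (.add ?_ ?_) _
    · exact (continuous_mul_of_tsupport_subset isOpen_upperHalfPlaneSet hcd hdV
        contDiffOn_log_im.continuousOn).integrable_of_hasCompactSupport hsd.mul_right
    · exact (continuous_mul_of_tsupport_subset isOpen_upperHalfPlaneSet hψ.continuous hψV
        (contDiffOn_dbarC isOpen_upperHalfPlaneSet
          contDiffOn_log_im).continuousOn).integrable_of_hasCompactSupport hc.mul_right
  have hline (t : ℝ) : ψ (t + y * I) * logNorm k f (ofComplex (t + y * I)) =
      ψ (t + y * I) * (Real.log ‖(f ∘ ofComplex) (t + y * I)‖ : ℂ) +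
        k / 2 * (ψ (t + y * I) * (Real.log (t + y * I : ℂ).im : ℂ)) := by
    rw [logNorm_comp_ofComplex (horizontal_mem hy t) (hf.horizontal_ne_zero hy hfy t)]
    ring
  have hiA' : Integrable fun t : ℝ ↦
      ψ (t + y * I) * (Real.log ‖(f ∘ ofComplex) (t + y * I)‖ : ℂ) := by
    refine integrable_horizontal_mul (h := fun w ↦ (Real.log ‖(f ∘ ofComplex) w‖ : ℂ))
      hψ.continuous hc fun t ↦ ?_
    have h0 := hf.horizontal_ne_zero hy hfy t
    exact (contDiffAt_log_norm (hf.analyticAt (horizontal_mem hy t) h0) h0).continuousAt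
  have hiB' : Integrable fun t : ℝ ↦ ψ (t + y * I) * (Real.log (t + y * I : ℂ).im : ℂ) :=
    integrable_horizontal (continuous_mul_of_tsupport_subset isOpen_upperHalfPlaneSet
      hψ.continuous hψV contDiffOn_log_im.continuousOn) hc.mul_right y
  -- The identity behind this is `∂L/∂w̄ = -π i conj (𝒟_k f)` for `L = log (v^{k/2} |f|)`. At the
  -- finitely many points of `s` the logarithm takes its default value, hence the restriction to
  -- almost all `w`.
  have hpt : ∀ᵐ w, 2 * I * (dbarC ψ w * logNorm k f (ofComplex w) +
        ψ w * (-π * I * conj (logDerivOp k f (ofComplex w)))) =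
      2 * I * (dbarC ψ w * (Real.log ‖(f ∘ ofComplex) w‖ : ℂ) +
        ψ w * (1 / 2 * conj (logDeriv (f ∘ ofComplex) w))) +
        k / 2 * (2 * I * (dbarC ψ w * (Real.log w.im : ℂ) +
      ψ w * dbarC (fun w ↦ (Real.log w.im : ℂ)) w)) := by
    filter_upwards [IsFactoredOn.ae_notMem s] with w hws
    by_cases hw : w ∈ W
    · rw [logNorm_comp_ofComplex (hWV hw) (hfac.apply_ne_zero hw hws),
        logDerivOp_comp_ofComplex k f (hWV hw), dbarC_log_im (hWV hw)]
      simp only [map_sub, map_mul, map_inv₀, conj_I, conj_ofReal, map_div₀, map_intCast,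
        map_ofNat]
      have hπ : (π : ℂ) ≠ 0 := by simp [Real.pi_ne_zero]
      have h1 : (-π * I) * (2 * π * -I : ℂ)⁻¹ = 1 / 2 := by
        field_simp
      have h2 : (-π * I) * ((k : ℂ) / (4 * π)) = -(k / 4 * I) := by
        field_simp
      linear_combination (2 * I * ψ w * conj (logDeriv (f ∘ ofComplex) w)) * h1 -
        (2 * I * ψ w * (w.im : ℂ)⁻¹) * h2
    · have h1 := (IsFactoredOn.mul_eq_zero_or hKW w).resolve_right hw
      have h2 := (IsFactoredOn.mul_eq_zero_or hdW w).resolve_right hw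
      simp [h1, h2]
  rw [integral_congr_ae (ae_restrict_of_ae hpt)]
  simp_rw [hline]
  rw [integral_add hiA.integrableOn (hiB.const_mul _).integrableOn,
    integral_add hiA' (hiB'.const_mul _)]
  simp only [integral_const_mul] at hA hB ⊢
  linear_combination hA + k / 2 * hB

/-! ### Green's formula for the two pairings -/

/-- The integrand `𝒟_k f · ξ_2 g` of the first cusp term. -/
def pairing₁ (k : ℤ) (f g : ℍ → ℂ) (τ : ℍ) : ℂ :=
  logDerivOp k f τ * xiOp 2 g τ

/-- The integrand `log (v^{k/2} |f|) · Δ_2 g + (k / 2) g` of the second cusp term. -/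
def pairing₂ (k : ℤ) (f g : ℍ → ℂ) (τ : ℍ) : ℂ :=
  logNorm k f τ * lapOp 2 g τ + (k : ℂ) / 2 * g τ

lemma zpow_neg_two_eq (v : ℂ) : v ^ (-2 : ℤ) = (v ^ 2)⁻¹ := by
  rw [show (-2 : ℤ) = -(2 : ℕ) from rfl, zpow_neg, zpow_natCast]

/-- The definition of `ξ_2`, solved for the `w̄`-derivative. -/
lemma dbarC_of_xiOp_two (g : ℍ → ℂ) {w : ℂ} (hw : w ∈ upperHalfPlaneSet) :
    2 * I * dbarC (g ∘ ofComplex) w = - conj (xiOp 2 g (ofComplex w)) * (w.im : ℂ) ^ (-2 : ℤ) := by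
  have hv : (w.im : ℂ) ≠ 0 := by
    have hw : 0 < w.im := hw
    exact_mod_cast hw.ne'
  have h := xiOp_comp_ofComplex 2 g hw
  rw [Function.comp_apply] at h
  rw [h, zpow_neg_two_eq]
  simp only [map_mul, map_ofNat, conj_I, map_zpow₀, conj_ofReal, conj_conj]
  rw [show (2 : ℤ) = (2 : ℕ) from rfl, zpow_natCast]
  field_simp

/-- The same for `ξ_0`, in view of `ξ_0 ξ_2 = -Δ_2`; no power of `v` appears in weight `0`. -/
lemma dbarC_of_lapOp_two (g : ℍ → ℂ) {w : ℂ} (hw : w ∈ upperHalfPlaneSet) :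
    2 * I * dbarC (xiOp 2 g ∘ ofComplex) w = conj (lapOp 2 g (ofComplex w)) := by
  have h := xiOp_comp_ofComplex 0 (xiOp 2 g) hw
  rw [Function.comp_apply] at h
  rw [lapOp, sub_self, h]
  simp only [map_neg, map_mul, map_ofNat, conj_I, zpow_zero, map_one, conj_conj]
  ring

lemma tsupport_mul_subset (X h : ℂ → ℂ) : tsupport (fun w ↦ X w * h w) ⊆ tsupport X :=
  closure_mono fun w hw h0 ↦ hw (by simp [h0])

lemma IsNonzeroMeromorphic.contDiffAt_logNorm {f : ℍ → ℂ} (hf : IsNonzeroMeromorphic f) (k : ℤ)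
    {w : ℂ} (hw : w ∈ upperHalfPlaneSet) (h0 : f (ofComplex w) ≠ 0) :
    ContDiffAt ℝ ∞ (fun w ↦ logNorm k f (ofComplex w)) w := by
  have hO := isOpen_upperHalfPlaneSet.mem_nhds hw
  have h5 := hf.analyticAt hw h0
  have h6 : (fun w ↦ logNorm k f (ofComplex w)) =ᶠ[𝓝 w] fun w ↦
      (Real.log ‖(f ∘ ofComplex) w‖ : ℂ) + k / 2 * (Real.log w.im : ℂ) := by
    filter_upwards [h5.continuousAt.eventually_ne h0, hO] with w hw1 hw2
    exact logNorm_comp_ofComplex hw2 hw1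
  exact ((contDiffAt_log_norm h5 h0).add (contDiffAt_const.mul
    (contDiffOn_log_im.contDiffAt hO))).congr_of_eventuallyEq h6

lemma IsNonzeroMeromorphic.continuousAt_logNorm {f : ℍ → ℂ} (hf : IsNonzeroMeromorphic f) (k : ℤ)
    {w : ℂ} (hw : w ∈ upperHalfPlaneSet) (h0 : f (ofComplex w) ≠ 0) :
    ContinuousAt (fun w ↦ logNorm k f (ofComplex w)) w :=
  (hf.contDiffAt_logNorm k hw h0).continuousAt

lemma integral_sub_sub_sub_add {α : Type*} [MeasurableSpace α] {μ : Measure α} {a b c d e : α → ℂ}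
    (ha : Integrable a μ) (hb : Integrable b μ) (hc : Integrable c μ) (hd : Integrable d μ)
    (he : Integrable e μ) :
    ∫ x, a x - b x - c x - d x + e x ∂μ =
      (∫ x, a x ∂μ) - (∫ x, b x ∂μ) - (∫ x, c x ∂μ) - (∫ x, d x ∂μ) + ∫ x, e x ∂μ := by
  have h1 : Integrable (fun x ↦ a x - b x) μ := ha.sub hb
  have h2 : Integrable (fun x ↦ a x - b x - c x) μ := h1.sub hc
  have h3 : Integrable (fun x ↦ a x - b x - c x - d x) μ := h2.sub hd
  rw [integral_add h3 he, integral_sub h2 hd, integral_sub h1 hc, integral_sub ha hb]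

set_option maxHeartbeats 1000000 in
/-- Green's formula on the part `Im τ ≤ y` of the upper half plane. -/
lemma IsNonzeroMeromorphic.green_complex {f g : ℍ → ℂ} (hf : IsNonzeroMeromorphic f) (k : ℤ)
    (hg : ContDiffOn ℝ ∞ (g ∘ ofComplex) upperHalfPlaneSet) {X : ℂ → ℝ} (hX : ContDiff ℝ ∞ X)
    (hc : HasCompactSupport X) (hXV : tsupport X ⊆ upperHalfPlaneSet) {y : ℝ} (hy : 0 < y)
    (hfy : ∀ τ : ℍ, y ≤ τ.im → f τ ≠ 0) :
    ∫ w in {w : ℂ | w.im ≤ y}, X w * (xiOp 2 (lapOp 2 g) (ofComplex w) *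
        logNorm k f (ofComplex w)) * (w.im : ℂ) ^ (-2 : ℤ) =
      -2 * π * (∫ t : ℝ, X (t + y * I) * pairing₁ k f g (ofComplex (t + y * I)))
      + conj (∫ t : ℝ, X (t + y * I) * pairing₂ k f g (ofComplex (t + y * I)))
      - 2 * π * (∑ᶠ z : ℍ, X z * (ordAt f z * xiOp 2 g z))
      - 2 * π * (∫ w in {w : ℂ | w.im ≤ y},
          2 * I * dbarC (fun w ↦ (X w : ℂ)) w * pairing₁ k f g (ofComplex w))
      + conj (∫ w in {w : ℂ | w.im ≤ y},
          2 * I * dbarC (fun w ↦ (X w : ℂ)) w * pairing₂ k f g (ofComplex w)) := by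
  set Xc : ℂ → ℂ := fun w ↦ (X w : ℂ) with hXc
  have hXs : ContDiff ℝ ∞ Xc := ofRealCLM.contDiff.comp hX
  have hXcc : HasCompactSupport Xc := hc.comp_left (g := ofReal) ofReal_zero
  have hXcV : tsupport Xc ⊆ upperHalfPlaneSet :=
    (tsupport_comp_subset (g := ofReal) ofReal_zero X).trans hXV
  have hO := isOpen_upperHalfPlaneSet
  set G : ℂ → ℂ := xiOp 2 g ∘ ofComplex with hGdef
  set h : ℂ → ℂ := lapOp 2 g ∘ ofComplex with hhdef
  set Φ : ℂ → ℂ := xiOp 2 (lapOp 2 g) ∘ ofComplex with hΦdef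
  set g' : ℂ → ℂ := g ∘ ofComplex with hgdef
  have hG : ContDiffOn ℝ ∞ G upperHalfPlaneSet := contDiffOn_xiOp 2 hg
  have hh : ContDiffOn ℝ ∞ h upperHalfPlaneSet := contDiffOn_lapOp 2 hg
  have h1 (q : ℂ → ℂ) (hq : ContDiffOn ℝ ∞ q upperHalfPlaneSet) :
      ContDiff ℝ ∞ (fun w ↦ Xc w * q w) := contDiff_mul_of_tsupport_subset hO hXs hXcV hq
  have h2 (q : ℂ → ℂ) : HasCompactSupport (fun w ↦ Xc w * q w) := hXcc.mul_right
  have h3 (q : ℂ → ℂ) : tsupport (fun w ↦ Xc w * q w) ⊆ upperHalfPlaneSet :=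
    (tsupport_mul_subset Xc q).trans hXcV
  have h4 {q : ℂ → ℂ} (hq : ContDiffOn ℝ ∞ q upperHalfPlaneSet) {w : ℂ}
      (hw : w ∈ upperHalfPlaneSet) :
      dbarC (fun w ↦ Xc w * q w) w = dbarC Xc w * q w + Xc w * dbarC q w :=
    dbarC_mul (hXs.differentiable (by simp) w)
      ((hq.contDiffAt (hO.mem_nhds hw)).differentiableAt (by simp))
  have hdc := continuous_dbarC (hXs.of_le (by simp))
  have hds := hasCompactSupport_dbarC hXcc
  have hdV := (tsupport_dbarC_subset Xc).trans hXcV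
  -- integrability of a smooth function times the singular ones
  have hcm {ψ q : ℂ → ℂ} (hψ : Continuous ψ) (hψV : tsupport ψ ⊆ upperHalfPlaneSet)
      (hq : ContDiffOn ℝ ∞ q upperHalfPlaneSet) : Continuous (fun w ↦ ψ w * q w) :=
    continuous_mul_of_tsupport_subset hO hψ hψV hq.continuousOn
  have hA := hf.integral_dbarC_mul_logDerivOp k ((h1 G hG).of_le (by simp)) (h2 G) (h3 G) hy hfy
  have hB := hf.integral_dbarC_mul_logNorm k ((h1 h hh).of_le (by simp)) (h2 h) (h3 h) hy hfy
  have hC := integral_dbarC_halfPlane ((h1 g' hg).of_le (by simp)) (h2 g') y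
  have hdp {q : ℂ → ℂ} (hq : ContDiffOn ℝ ∞ q upperHalfPlaneSet) :=
    continuous_dbarC ((h1 q hq).of_le (m := 1) (by simp))
  have hdpc (q : ℂ → ℂ) := hasCompactSupport_dbarC (h2 q)
  have hdpV (q : ℂ → ℂ) := (tsupport_dbarC_subset _).trans (h3 q)
  have iA : Integrable (fun w ↦ 2 * I * (dbarC (fun w ↦ Xc w * G w) w *
      logDerivOp k f (ofComplex w) + Xc w * G w * (k * I / (8 * π) * (w.im : ℂ) ^ (-2 : ℤ)))) :=
    ((hf.integrable_mul_logDerivOp k (hdp hG) (hdpc G) (hdpV G)).add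
      ((hcm (h1 G hG).continuous (h3 G) (contDiffOn_const.mul
        (contDiffOn_im_zpow (-2)))).integrable_of_hasCompactSupport
          (h2 G).mul_right)).const_mul _
  have iB : Integrable (fun w ↦ 2 * I * (dbarC (fun w ↦ Xc w * h w) w * logNorm k f (ofComplex w) +
        Xc w * h w * (-π * I * conj (logDerivOp k f (ofComplex w))))) := by
    refine Integrable.const_mul
      ((hf.integrable_mul_logNorm k (hdp hh) (hdpc h) (hdpV h)).add ?_) _
    have h5 := hf.integrable_mul_logDerivOp k (φ := fun w ↦ conj (Xc w * h w))
      (continuous_conj.comp (h1 h hh).continuous) ((h2 h).comp_left (g := conj) (map_zero _))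
      ((tsupport_comp_subset (g := conj) (map_zero _) _).trans (h3 h))
    refine (((LinearIsometryEquiv.integrable_comp_iff conjLIE).mpr h5).const_mul (-π * I)).congr
      (Eventually.of_forall fun w ↦ ?_)
    simp only [conjLIE_apply, map_mul, conj_conj]
    ring
  have iC : Integrable (fun w ↦ 2 * I * dbarC (fun w ↦ Xc w * g' w) w) :=
    ((hdp hg).integrable_of_hasCompactSupport (hdpc g')).const_mul _
  have iP : Integrable (fun w ↦ 2 * I * dbarC Xc w * pairing₁ k f g (ofComplex w)) := by
    refine ((hf.integrable_mul_logDerivOp k (hcm hdc hdV hG) hds.mul_right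
      ((tsupport_mul_subset _ _).trans hdV)).const_mul (2 * I)).congr
        (Eventually.of_forall fun w ↦ ?_)
    simp only [pairing₁, hGdef, Function.comp_apply]
    ring
  have iQ : Integrable (fun w ↦ 2 * I * dbarC Xc w * pairing₂ k f g (ofComplex w)) := by
    refine (((hf.integrable_mul_logNorm k (hcm hdc hdV hh) hds.mul_right
      ((tsupport_mul_subset _ _).trans hdV)).const_mul (2 * I)).add
        (((hcm hdc hdV hg).integrable_of_hasCompactSupport hds.mul_right).const_mul
          (2 * I * (k / 2)))).congr
        (Eventually.of_forall fun w ↦ ?_)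
    simp only [pairing₂, hhdef, hgdef, Function.comp_apply, Pi.add_apply]
    ring
  have iconj {q : ℂ → ℂ} (hq : Integrable q) : Integrable fun w ↦ conj (q w) :=
    (LinearIsometryEquiv.integrable_comp_iff conjLIE).mpr hq
  -- The combination `2π A - conj B - (k/2) conj C` of the three Green integrands. The terms `2π X D
  -- conj h` of `A` and `B` cancel, as do the terms `(k/2) X G v⁻²` of `A` and `C`. From `∂h/∂w̄` in
  -- `B` comes the left side; what contains `∂X/∂w̄` is removed by the last two summands.
  have key : ∀ w, X w * (xiOp 2 (lapOp 2 g) (ofComplex w) *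
        logNorm k f (ofComplex w)) * (w.im : ℂ) ^ (-2 : ℤ) =
      2 * π * (2 * I * (dbarC (fun w ↦ Xc w * G w) w *
      logDerivOp k f (ofComplex w) + Xc w * G w * (k * I / (8 * π) * (w.im : ℂ) ^ (-2 : ℤ))))
      - conj (2 * I * (dbarC (fun w ↦ Xc w * h w) w * logNorm k f (ofComplex w) +
        Xc w * h w * (-π * I * conj (logDerivOp k f (ofComplex w)))))
      - k / 2 * conj (2 * I * dbarC (fun w ↦ Xc w * g' w) w)
      - 2 * π * (2 * I * dbarC Xc w * pairing₁ k f g (ofComplex w))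
      + conj (2 * I * dbarC Xc w * pairing₂ k f g (ofComplex w)) := by
    intro w
    by_cases hw : w ∈ upperHalfPlaneSet
    · rw [h4 hG hw, h4 hh hw, h4 hg hw]
      have e1 : 2 * I * dbarC g' w = - conj (G w) * (w.im : ℂ) ^ (-2 : ℤ) :=
        dbarC_of_xiOp_two g hw
      have e2 : 2 * I * dbarC G w = conj (h w) := dbarC_of_lapOp_two g hw
      have e3 : 2 * I * dbarC h w = - conj (Φ w) * (w.im : ℂ) ^ (-2 : ℤ) :=
        dbarC_of_xiOp_two (lapOp 2 g) hw
      apply_fun conj at e1 e3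
      have hπ : (π : ℂ) ≠ 0 := by simp [Real.pi_ne_zero]
      have e4 : (2 * π : ℂ) * (2 * I * (k * I / (8 * π))) = - (k / 2) := by
        field_simp
        linear_combination (8 * k : ℂ) * I_sq
      simp only [map_mul, map_ofNat, conj_I, map_neg, map_zpow₀, conj_ofReal, conj_conj] at e1 e3
      have hL := conj_logNorm k f (ofComplex w)
      have hcX : conj (Xc w) = Xc w := conj_ofReal _
      simp only [pairing₁, pairing₂, map_mul, map_add, map_ofNat, conj_I, map_neg,
        conj_ofReal, conj_conj, hL, hcX, map_div₀, map_intCast]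
      change X w * (Φ w * logNorm k f (ofComplex w)) * _ = 2 * π * _ - _ - _ -
        2 * π * (2 * I * dbarC Xc w * (_ * G w)) +
        2 * -I * conj (dbarC Xc w) * (_ * conj (h w) + k / 2 * conj (g' w))
      rw [show (X w : ℂ) = Xc w from rfl]
      set D := logDerivOp k f (ofComplex w)
      set L := logNorm k f (ofComplex w)
      linear_combination (-(2 * π * Xc w * D)) * e2 + Xc w * L * e3 + (k / 2 * Xc w) * e1
        - Xc w * G w * (w.im : ℂ) ^ (-2 : ℤ) * e4 - 2 * π * Xc w * conj (h w) * D * I_sq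
    · have z1 (q : ℂ → ℂ) : Xc w * q w = 0 := by
        rw [(IsFactoredOn.mul_eq_zero_or hXcV w).resolve_right hw, zero_mul]
      have z2 (q : ℂ → ℂ) : dbarC (fun w ↦ Xc w * q w) w = 0 :=
        (IsFactoredOn.mul_eq_zero_or (hdpV q) w).resolve_right hw
      have z3 : dbarC Xc w = 0 := (IsFactoredOn.mul_eq_zero_or hdV w).resolve_right hw
      have z4 : (X w : ℂ) = 0 := (IsFactoredOn.mul_eq_zero_or hXcV w).resolve_right hw
      simp [z1, z2, z3, z4]
  simp_rw [key]
  have iA' := (iA.const_mul (2 * π : ℂ)).integrableOn (s := {w : ℂ | w.im ≤ y})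
  have iB' := (iconj iB).integrableOn (s := {w : ℂ | w.im ≤ y})
  have iC' := ((iconj iC).const_mul (k / 2 : ℂ)).integrableOn (s := {w : ℂ | w.im ≤ y})
  have iP' := (iP.const_mul (2 * π : ℂ)).integrableOn (s := {w : ℂ | w.im ≤ y})
  have iQ' := (iconj iQ).integrableOn (s := {w : ℂ | w.im ≤ y})
  rw [integral_sub_sub_sub_add iA' iB' iC' iP' iQ', integral_const_mul (2 * π : ℂ),
    integral_const_mul (2 * π : ℂ), integral_const_mul (k / 2 : ℂ), integral_conj, integral_conj,
    integral_conj, hA, hB, hC]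
  have hline : ∫ t : ℝ, X (t + y * I) * pairing₂ k f g (ofComplex (t + y * I)) =
      (∫ t : ℝ, Xc (t + y * I) * h (t + y * I) * logNorm k f (ofComplex (t + y * I))) +
      k / 2 * ∫ t : ℝ, Xc (t + y * I) * g' (t + y * I) := by
    rw [← integral_const_mul, ← integral_add]
    · refine integral_congr_ae (Eventually.of_forall fun t ↦ ?_)
      simp only [pairing₂, hXc, hhdef, hgdef, Function.comp_apply]
      ring
    · exact integrable_horizontal_mul (h := fun w ↦ logNorm k f (ofComplex w))
        (h1 h hh).continuous (h2 h) fun t ↦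
          hf.continuousAt_logNorm k (horizontal_mem hy t) (hf.horizontal_ne_zero hy hfy t)
    · exact (integrable_horizontal (h1 g' hg).continuous (h2 g') y).const_mul _
  have hline1 : ∫ t : ℝ, X (t + y * I) * pairing₁ k f g (ofComplex (t + y * I)) =
      ∫ t : ℝ, Xc (t + y * I) * G (t + y * I) * logDerivOp k f (ofComplex (t + y * I)) := by
    refine integral_congr_ae (Eventually.of_forall fun t ↦ ?_)
    simp only [pairing₁, hXc, hGdef, Function.comp_apply]
    ring
  have hsum : ∑ᶠ z : ℍ, (X z : ℂ) * (ordAt f z * xiOp 2 g z) =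
      ∑ᶠ z : ℍ, (ordAt f z : ℂ) * (Xc z * G z) := by
    refine finsum_congr fun z ↦ ?_
    simp only [hXc, hGdef, Function.comp_apply, ofComplex_apply]
    ring
  rw [hline, hline1, hsum]
  simp only [map_add, map_mul, map_neg, map_div₀, map_ofNat, map_intCast]
  ring

end RohrlichDivisor

end

noncomputable section

namespace RohrlichDivisor

lemma dbar_coe (ψ : ℂ → ℂ) (τ : ℍ) : dbar (fun τ ↦ ψ τ) τ = dbarC ψ τ := by
  rw [dbar_eq_dbarC]
  refine dbarC_congr ?_
  filter_upwards [isOpen_upperHalfPlaneSet.mem_nhds τ.im_pos] with w hw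
  rw [Function.comp_apply, coe_ofComplex hw]

lemma im_pow_ne_zero (τ : ℍ) (n : ℕ) : (τ.im : ℂ) ^ n ≠ 0 :=
  pow_ne_zero _ (by exact_mod_cast τ.im_ne_zero)

/-- Green's formula on the part `Im τ ≤ y` of the upper half plane, for the invariant measure. -/
lemma IsNonzeroMeromorphic.green {f g : ℍ → ℂ} (hf : IsNonzeroMeromorphic f) (k : ℤ)
    (hg : ContDiffOn ℝ ∞ (g ∘ ofComplex) upperHalfPlaneSet) {X : ℂ → ℝ} (hX : ContDiff ℝ ∞ X)
    (hc : HasCompactSupport X) (hXV : tsupport X ⊆ upperHalfPlaneSet) {y : ℝ} (hy : 0 < y)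
    (hfy : ∀ τ : ℍ, y ≤ τ.im → f τ ≠ 0) :
    ∫ τ in {τ : ℍ | τ.im ≤ y}, (X τ : ℂ) * (xiOp 2 (lapOp 2 g) τ * logNorm k f τ) =
      -2 * π * (∫ t : ℝ, X (t + y * I) * pairing₁ k f g (ofComplex (t + y * I)))
      + conj (∫ t : ℝ, X (t + y * I) * pairing₂ k f g (ofComplex (t + y * I)))
      - 2 * π * (∑ᶠ z : ℍ, X z * (ordAt f z * xiOp 2 g z))
      - 2 * π * (∫ τ in {τ : ℍ | τ.im ≤ y},
          2 * I * ((τ.im : ℂ) ^ 2 * dbar (fun τ ↦ (X τ : ℂ)) τ * pairing₁ k f g τ))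
      + conj (∫ τ in {τ : ℍ | τ.im ≤ y},
          2 * I * ((τ.im : ℂ) ^ 2 * dbar (fun τ ↦ (X τ : ℂ)) τ * pairing₂ k f g τ)) := by
  have hXcV : tsupport (fun w ↦ (X w : ℂ)) ⊆ upperHalfPlaneSet :=
    (tsupport_comp_subset (g := ofReal) ofReal_zero X).trans hXV
  have z1 {w : ℂ} (hw : w ∉ upperHalfPlaneSet) : (X w : ℂ) = 0 :=
    (IsFactoredOn.mul_eq_zero_or hXcV w).resolve_right hw
  have z2 {w : ℂ} (hw : w ∉ upperHalfPlaneSet) : dbarC (fun w ↦ (X w : ℂ)) w = 0 :=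
    (IsFactoredOn.mul_eq_zero_or ((tsupport_dbarC_subset _).trans hXcV) w).resolve_right hw
  have hmeas : MeasurableSet {w : ℂ | w.im ≤ y} := measurableSet_le measurable_im measurable_const
  have h1 := integral_upperHalfPlane
    (fun τ ↦ (X τ : ℂ) * (xiOp 2 (lapOp 2 g) τ * logNorm k f τ))
    (Q := fun w ↦ X w * (xiOp 2 (lapOp 2 g) (ofComplex w) *
        logNorm k f (ofComplex w)) * (w.im : ℂ) ^ (-2 : ℤ))
    (fun τ ↦ by rw [ofComplex_apply, zpow_neg_two_eq]; rfl) (fun w hw ↦ by simp [z1 hw]) hmeas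
  have h2 (P : ℍ → ℂ) := integral_upperHalfPlane
    (fun τ ↦ 2 * I * ((τ.im : ℂ) ^ 2 * dbar (fun τ ↦ (X τ : ℂ)) τ * P τ))
    (Q := fun w ↦ 2 * I * dbarC (fun w ↦ (X w : ℂ)) w * P (ofComplex w))
    (fun τ ↦ by
      rw [ofComplex_apply, dbar_coe (fun w ↦ (X w : ℂ)), eq_div_iff (im_pow_ne_zero τ 2)]
      ring) (fun w hw ↦ by simp [z2 hw]) hmeas
  exact h1.trans ((hf.green_complex k hg hX hc hXV hy hfy).trans (by rw [← h2, ← h2]; rfl))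

/-! ### Local integrability -/

lemma continuousOn_ofComplex : ContinuousOn (ofComplex : ℂ → ℍ) upperHalfPlaneSet := fun _ hw ↦
  (contMDiffAt_ofComplex (n := 0) hw).continuousAt.continuousWithinAt

/-- A cutoff equal to `1` on `K`, multiplied by `φ` and the density `v⁻²`, is an admissible test
function on `ℂ`. -/
lemma integrableOn_mul_of_integrable {L : ℍ → ℂ}
    (hL : ∀ φ : ℂ → ℂ, Continuous φ → HasCompactSupport φ → tsupport φ ⊆ upperHalfPlaneSet →
      Integrable (fun w ↦ φ w * L (ofComplex w)))
    {φ : ℍ → ℂ} (hφ : Continuous φ) {K : Set ℍ} (hK : IsCompact K) :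
    IntegrableOn (fun τ ↦ φ τ * L τ) K := by
  have hO := isOpen_upperHalfPlaneSet
  obtain ⟨b, hb, hbc, hbV, hb1, -⟩ := exists_bump (hK.image UpperHalfPlane.continuous_coe) hO
    (Set.image_subset_iff.mpr fun τ _ ↦ τ.im_pos)
  have hbcV : tsupport (fun w ↦ (b w : ℂ)) ⊆ upperHalfPlaneSet :=
    (tsupport_comp_subset (g := ofReal) ofReal_zero b).trans hbV
  have hc : HasCompactSupport (fun w ↦ (b w : ℂ)) := hbc.comp_left (g := ofReal) ofReal_zero
  have h1 : ContinuousOn (fun w ↦ φ (ofComplex w) * (w.im : ℂ) ^ (-2 : ℤ)) upperHalfPlaneSet :=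
    (hφ.comp_continuousOn continuousOn_ofComplex).mul (contDiffOn_im_zpow _).continuousOn
  have h2 := hL _ (continuous_mul_of_tsupport_subset hO (continuous_ofReal.comp hb.continuous)
    hbcV h1) hc.mul_right ((tsupport_mul_subset _ _).trans hbcV)
  have h3 := integrable_upperHalfPlane (fun τ ↦ b τ * (φ τ * L τ)) (fun τ ↦ by
    simp only [Function.comp_apply, ofComplex_apply, zpow_neg_two_eq, div_eq_mul_inv, coe_im]
    ring) h2
  refine h3.integrableOn.congr_fun (fun τ hτ ↦ ?_) hK.measurableSet
  simp [hb1 _ (Set.mem_image_of_mem _ hτ)]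

lemma IsNonzeroMeromorphic.integrableOn_mul_logNorm {f : ℍ → ℂ} (hf : IsNonzeroMeromorphic f)
    (k : ℤ) {φ : ℍ → ℂ} (hφ : Continuous φ) {K : Set ℍ} (hK : IsCompact K) :
    IntegrableOn (fun τ ↦ φ τ * logNorm k f τ) K :=
  integrableOn_mul_of_integrable (fun _ h1 h2 h3 ↦ hf.integrable_mul_logNorm k h1 h2 h3) hφ hK

lemma IsNonzeroMeromorphic.integrableOn_mul_logDerivOp {f : ℍ → ℂ} (hf : IsNonzeroMeromorphic f)
    (k : ℤ) {φ : ℍ → ℂ} (hφ : Continuous φ) {K : Set ℍ} (hK : IsCompact K) :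
    IntegrableOn (fun τ ↦ φ τ * logDerivOp k f τ) K :=
  integrableOn_mul_of_integrable (fun _ h1 h2 h3 ↦ hf.integrable_mul_logDerivOp k h1 h2 h3) hφ hK

lemma continuous_of_contDiffOn {φ : ℍ → ℂ}
    (hφ : ContDiffOn ℝ ∞ (φ ∘ ofComplex) upperHalfPlaneSet) : Continuous φ := by
  have h := hφ.continuousOn.comp_continuous UpperHalfPlane.continuous_coe fun τ : ℍ ↦ τ.im_pos
  simpa only [Function.comp_def, ofComplex_apply] using h

/-! ### Equivariance -/

lemma denom_ne (γ : SL(2, ℤ)) (τ : ℍ) : denom γ (τ : ℂ) ≠ 0 := denom_ne_zero _ τ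

lemma det_SL (γ : SL(2, ℤ)) : (γ : GL (Fin 2) ℝ).val.det = 1 := by
  rw [← Matrix.GeneralLinearGroup.val_det_apply]
  simp

lemma det_SL_pos (γ : SL(2, ℤ)) : 0 < (γ : GL (Fin 2) ℝ).val.det := by
  rw [det_SL]
  exact one_pos

lemma hasDerivAt_smul_SL (γ : SL(2, ℤ)) (τ : ℍ) :
    HasDerivAt (fun z ↦ ↑(γ • ofComplex z) : ℂ → ℂ) ((denom γ τ ^ 2)⁻¹) τ := by
  have h := (hasStrictDerivAt_smul (g := (γ : GL (Fin 2) ℝ)) (det_SL_pos γ) τ).hasDerivAt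
  rw [det_SL] at h
  simpa using h

lemma slash_comp_ofComplex (φ : ℍ → ℂ) (m : ℤ) (γ : SL(2, ℤ)) (τ : ℍ) :
    (φ ∣[m] γ) ∘ ofComplex =ᶠ[𝓝 (τ : ℂ)]
      fun z ↦ (φ ∘ ofComplex) ↑(γ • ofComplex z) * denom γ z ^ (-m) := by
  filter_upwards [isOpen_upperHalfPlaneSet.mem_nhds τ.im_pos] with w hw
  rw [Function.comp_apply, ModularForm.SL_slash_apply, Function.comp_apply, ofComplex_apply,
    coe_ofComplex hw]

lemma hasDerivAt_denom_zpow_SL (γ : SL(2, ℤ)) (m : ℤ) (τ : ℍ) :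
    HasDerivAt (fun z ↦ denom γ z ^ m) (m * (γ 1 0 : ℂ) * denom γ τ ^ (m - 1)) τ := by
  simpa using hasDerivAt_denom_zpow (γ : GL (Fin 2) ℝ) m τ

/-- The automorphy factor is holomorphic, so it passes through the derivative; the Möbius map
contributes the conjugate of its derivative `(cτ + d)⁻²`. -/
lemma dbar_slash {φ : ℍ → ℂ} (m : ℤ) (γ : SL(2, ℤ)) (τ : ℍ)
    (hφ : DifferentiableAt ℝ (φ ∘ ofComplex) ((γ • τ : ℍ) : ℂ)) :
    dbar (φ ∣[m] γ) τ =
      dbar φ (γ • τ) * conj ((denom γ τ ^ 2)⁻¹) * denom γ τ ^ (-m) := by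
  have h1 := hasDerivAt_smul_SL γ τ
  have h2 := (hasDerivAt_denom_zpow_SL γ (-m) τ).differentiableAt
  have hφ' : DifferentiableAt ℝ (φ ∘ ofComplex) ((γ • ofComplex (τ : ℂ) : ℍ) : ℂ) := by
    rwa [ofComplex_apply]
  have h3 : DifferentiableAt ℝ (fun z : ℂ ↦ (φ ∘ ofComplex) ((γ • ofComplex z : ℍ) : ℂ)) τ :=
    DifferentiableAt.comp (τ : ℂ) (g := φ ∘ ofComplex)
      (f := fun z : ℂ ↦ ((γ • ofComplex z : ℍ) : ℂ)) hφ' (h1.differentiableAt.restrictScalars ℝ)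
  rw [dbar_eq_dbarC, dbarC_congr (slash_comp_ofComplex φ m γ τ),
    dbarC_mul h3 (h2.restrictScalars ℝ), dbarC_of_differentiableAt h2, dbarC_comp (f := φ ∘ ofComplex)
      (g := fun z : ℂ ↦ ((γ • ofComplex z : ℍ) : ℂ)) hφ' h1,
    ofComplex_apply, dbar_eq_dbarC]
  ring

lemma im_smul_SL (γ : SL(2, ℤ)) (τ : ℍ) :
    ((γ • τ).im : ℂ) = τ.im * (denom γ τ)⁻¹ * (conj (denom γ τ))⁻¹ := by
  rw [ModularGroup.im_smul_eq_div_normSq]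
  push_cast
  rw [← mul_conj, div_eq_mul_inv, mul_inv, mul_assoc]

/-- Since `Im γτ = v / |cτ + d|²`, the factor `v^m` together with the conjugation in `ξ_m` trades
the conjugate automorphy factors for holomorphic ones of weight `2 - m`. -/
lemma xiOp_slash {φ : ℍ → ℂ} (m : ℤ) (γ : SL(2, ℤ))
    (hφ : ContDiffOn ℝ ∞ (φ ∘ ofComplex) upperHalfPlaneSet) :
    xiOp m (φ ∣[m] γ) = xiOp m φ ∣[2 - m] γ := by
  ext τ
  have hd := denom_ne γ τ
  have hd' : conj (denom γ (τ : ℂ)) ≠ 0 := (map_ne_zero _).mpr hd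
  rw [ModularForm.SL_slash_apply, xiOp, xiOp, dbar_slash m γ τ
    ((hφ.contDiffAt (isOpen_upperHalfPlaneSet.mem_nhds (γ • τ).im_pos)).differentiableAt
      (by simp)), im_smul_SL]
  simp only [map_mul, map_inv₀, map_pow, conj_conj, map_zpow₀, mul_zpow, inv_zpow', neg_sub]
  rw [sub_eq_add_neg, zpow_add₀ hd, show (-(2 : ℤ)) = -((2 : ℕ) : ℤ) from rfl, zpow_neg _ ((2 : ℕ) : ℤ)]
  rw [zpow_natCast, zpow_neg, zpow_neg]
  have := zpow_ne_zero m hd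
  have := zpow_ne_zero m hd'
  field_simp

lemma contDiffOn_slash {φ : ℍ → ℂ} (m : ℤ) (γ : SL(2, ℤ))
    (hφ : ContDiffOn ℝ ∞ (φ ∘ ofComplex) upperHalfPlaneSet) :
    ContDiffOn ℝ ∞ ((φ ∣[m] γ) ∘ ofComplex) upperHalfPlaneSet := fun w hw ↦ by
  lift w to ℍ using hw
  refine (ContDiffAt.congr_of_eventuallyEq ?_ (slash_comp_ofComplex φ m γ w)).contDiffWithinAt
  have h1 : AnalyticAt ℂ (fun z : ℂ ↦ ((γ • ofComplex z : ℍ) : ℂ)) w :=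
    analyticAt_smul (g := (γ : GL (Fin 2) ℝ)) (det_SL_pos γ) w
  have h2 : AnalyticAt ℂ (fun z : ℂ ↦ denom γ z ^ (-m)) w := by
    refine AnalyticAt.zpow ?_ (denom_ne γ w)
    unfold denom
    fun_prop
  refine ContDiffAt.mul (ContDiffAt.comp (w : ℂ) (g := φ ∘ ofComplex)
    (f := fun z : ℂ ↦ ((γ • ofComplex z : ℍ) : ℂ)) ?_ (h1.contDiffAt.restrict_scalars ℝ))
    (h2.contDiffAt.restrict_scalars ℝ)
  exact hφ.contDiffAt (isOpen_upperHalfPlaneSet.mem_nhds (γ • ofComplex (w : ℂ)).im_pos)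

lemma xiOp_two_slash {g : ℍ → ℂ} (γ : SL(2, ℤ))
    (hg : ContDiffOn ℝ ∞ (g ∘ ofComplex) upperHalfPlaneSet) :
    xiOp 2 (g ∣[(2 : ℤ)] γ) = xiOp 2 g ∣[(0 : ℤ)] γ := by
  simpa using xiOp_slash 2 γ hg

lemma lapOp_two_slash {g : ℍ → ℂ} (γ : SL(2, ℤ))
    (hg : ContDiffOn ℝ ∞ (g ∘ ofComplex) upperHalfPlaneSet) :
    lapOp 2 (g ∣[(2 : ℤ)] γ) = lapOp 2 g ∣[(2 : ℤ)] γ := by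
  have h := xiOp_slash 0 γ (contDiffOn_xiOp 2 hg)
  ext τ
  have h' := congrFun h τ
  rw [ModularForm.SL_slash_apply] at h' ⊢
  simp only [lapOp, sub_self, xiOp_two_slash γ hg, h', sub_zero, neg_mul]

lemma slash_zero_apply (φ : ℍ → ℂ) (γ : SL(2, ℤ)) (τ : ℍ) : (φ ∣[(0 : ℤ)] γ) τ = φ (γ • τ) := by
  simp [ModularForm.SL_slash_apply]

lemma norm_slash_mul (k : ℤ) (f : ℍ → ℂ) (γ : SL(2, ℤ)) (τ : ℍ) :
    τ.im ^ ((k : ℝ) / 2) * ‖(f ∣[k] γ) τ‖ = (γ • τ).im ^ ((k : ℝ) / 2) * ‖f (γ • τ)‖ := by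
  have hd : 0 < ‖denom γ (τ : ℂ)‖ := norm_pos_iff.mpr (denom_ne γ τ)
  rw [ModularForm.SL_slash_apply, ModularGroup.im_smul_eq_div_normSq, normSq_eq_norm_sq, norm_mul,
    norm_zpow, Real.div_rpow τ.im_pos.le (by positivity), ← Real.rpow_natCast, ← Real.rpow_mul hd.le,
    ← Real.rpow_intCast]
  push_cast
  rw [Real.rpow_neg hd.le, mul_div_cancel₀ _ (two_ne_zero' ℝ)]
  ring

lemma logNorm_slash (k : ℤ) (f : ℍ → ℂ) (γ : SL(2, ℤ)) (τ : ℍ) :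
    logNorm k (f ∣[k] γ) τ = logNorm k f (γ • τ) := by
  rw [logNorm, logNorm, norm_slash_mul]

/-- Differentiating `(cτ + d)^(-k)` adds a term proportional to `k c / (cτ + d)`. The correction `-k
/ (4πv)` absorbs it, because `conj (cτ + d) = cτ + d - 2 i c v`. -/
lemma IsNonzeroMeromorphic.logDerivOp_slash {f : ℍ → ℂ} (hf : IsNonzeroMeromorphic f) (k : ℤ)
    (γ : SL(2, ℤ)) {τ : ℍ} (h : f (γ • τ) ≠ 0) :
    logDerivOp k (f ∣[k] γ) τ = (logDerivOp k f ∣[(2 : ℤ)] γ) τ := by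
  have hd := denom_ne γ τ
  have hf' : HasDerivAt (f ∘ ofComplex) (deriv (f ∘ ofComplex) ((γ • ofComplex (τ : ℂ) : ℍ) : ℂ))
      ((γ • ofComplex (τ : ℂ) : ℍ) : ℂ) := by
    refine (hf.analyticAt (γ • ofComplex (τ : ℂ)).im_pos ?_).differentiableAt.hasDerivAt
    rwa [ofComplex_apply, ofComplex_apply]
  have hcomp := (hf'.comp (τ : ℂ) (hasDerivAt_smul_SL γ τ)).mul
    (hasDerivAt_denom_zpow_SL γ (-k) τ)
  have hder := (hcomp.congr_of_eventuallyEq (slash_comp_ofComplex f k γ τ)).deriv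
  have hconj : conj (denom γ (τ : ℂ)) = denom γ τ - 2 * I * γ 1 0 * τ.im := by
    have h1 : (τ : ℂ) = (τ : ℂ).re + τ.im * I := (Complex.re_add_im _).symm
    rw [ModularGroup.denom_apply, h1]
    simp
    ring
  have hv : (τ.im : ℂ) ≠ 0 := by exact_mod_cast τ.im_ne_zero
  have hπ : (π : ℂ) ≠ 0 := by simp [Real.pi_ne_zero]
  have hinv : (((γ • τ).im : ℂ))⁻¹ = denom γ τ * (denom γ τ - 2 * I * γ 1 0 * τ.im) / τ.im := by
    rw [im_smul_SL, ← hconj]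
    simp only [mul_inv, inv_inv]
    field_simp
  have hinv' : (k : ℂ) / (4 * π * (γ • τ).im) =
      k / (4 * π) * (denom γ τ * (denom γ τ - 2 * I * γ 1 0 * τ.im) / τ.im) := by
    rw [← hinv, ← div_div, div_eq_mul_inv _ ((γ • τ).im : ℂ)]
  rw [ModularForm.SL_slash_apply, logDerivOp, logDerivOp, Derivative.normalizedDerivOfComplex,
    Derivative.normalizedDerivOfComplex, hder, ModularForm.SL_slash_apply, hinv']
  simp only [Function.comp_apply, ofComplex_apply]
  rw [show (-(2 : ℤ)) = -((2 : ℕ) : ℤ) from rfl, zpow_neg _ ((2 : ℕ) : ℤ), zpow_natCast,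
    zpow_sub₀ hd, zpow_one, zpow_neg]
  have hk := zpow_ne_zero k hd
  push_cast
  field_simp
  linear_combination (-4 * τ.im * γ 1 0 * k * denom γ τ * f (γ • τ)) * I_sq

lemma analyticAt_denom_zpow (γ : SL(2, ℤ)) (m : ℤ) (τ : ℍ) :
    AnalyticAt ℂ (fun z : ℂ ↦ denom γ z ^ m) τ := by
  refine AnalyticAt.zpow ?_ (denom_ne γ τ)
  unfold denom
  fun_prop

/-- Möbius maps are locally biholomorphic and the automorphy factor has neither zeros nor poles on
`ℍ`. -/
lemma meromorphicOrderAt_slash {f : ℍ → ℂ} (hf : IsNonzeroMeromorphic f) (k : ℤ) (γ : SL(2, ℤ))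
    (τ : ℍ) : meromorphicOrderAt ((f ∣[k] γ) ∘ ofComplex) τ =
      meromorphicOrderAt (f ∘ ofComplex) ((γ • τ : ℍ) : ℂ) := by
  have hγ : 0 < (γ : GL (Fin 2) ℝ).val.det := det_SL_pos γ
  have h1 := analyticAt_denom_zpow γ (-k) τ
  have h0 : meromorphicOrderAt (fun z : ℂ ↦ denom γ z ^ (-k)) τ = 0 :=
    h1.meromorphicNFAt.meromorphicOrderAt_eq_zero_iff.mpr (zpow_ne_zero _ (denom_ne γ τ))
  have hm : MeromorphicAt (fun z : ℂ ↦ (f ∘ ofComplex) ((γ • ofComplex z : ℍ) : ℂ)) τ := by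
    refine MeromorphicAt.comp_analyticAt (f := f ∘ ofComplex)
      (g := fun z : ℂ ↦ ((γ • ofComplex z : ℍ) : ℂ)) ?_
      (analyticAt_smul hγ τ)
    exact (hf.meromorphicNFOn (γ • ofComplex (τ : ℂ)).im_pos).meromorphicAt
  have h2 := meromorphicOrderAt_comp_smul (f := f) (τ := τ) hγ
  rw [meromorphicOrderAt_congr ((slash_comp_ofComplex f k γ τ).filter_mono nhdsWithin_le_nhds)]
  change meromorphicOrderAt ((fun z : ℂ ↦ (f ∘ ofComplex) ((γ • ofComplex z : ℍ) : ℂ)) *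
    fun z : ℂ ↦ denom γ z ^ (-k)) _ = _
  rw [meromorphicOrderAt_mul hm h1.meromorphicAt, h0, add_zero]
  simp only [Function.comp_def, ofComplex_apply]
  exact h2

lemma IsNonzeroMeromorphic.slash {f : ℍ → ℂ} (hf : IsNonzeroMeromorphic f) (k : ℤ)
    (γ : SL(2, ℤ)) : IsNonzeroMeromorphic (f ∣[k] γ) where
  meromorphicNFOn w hw := by
    lift w to ℍ using hw
    rw [meromorphicNFAt_congr (slash_comp_ofComplex f k γ w)]
    have h3 : MeromorphicNFAt (fun z : ℂ ↦ (f ∘ ofComplex) ((γ • ofComplex z : ℍ) : ℂ)) w :=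
      MeromorphicNFAt.comp_analyticAt (g := fun z : ℂ ↦ ((γ • ofComplex z : ℍ) : ℂ))
        (hf.meromorphicNFOn (γ • ofComplex (w : ℂ)).im_pos)
        (analyticAt_smul (g := (γ : GL (Fin 2) ℝ)) (det_SL_pos γ) w)
    exact (meromorphicNFAt_mul_iff_left (analyticAt_denom_zpow γ (-k) w)
      (zpow_ne_zero _ (denom_ne γ w))).mpr h3
  order_ne_top w hw := by
    lift w to ℍ using hw
    rw [meromorphicOrderAt_slash hf]
    exact hf.order_ne_top _ (γ • w).im_pos

lemma IsNonzeroMeromorphic.ordAt_slash {f : ℍ → ℂ} (hf : IsNonzeroMeromorphic f) (k : ℤ)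
    (γ : SL(2, ℤ)) (τ : ℍ) : ordAt (f ∣[k] γ) τ = ordAt f (γ • τ) := by
  rw [ordAt, meromorphicOrderAt_slash hf, ordAt]

lemma IsNonzeroMeromorphic.pairing₁_slash {f g : ℍ → ℂ} (hf : IsNonzeroMeromorphic f) (k : ℤ)
    (hg : ContDiffOn ℝ ∞ (g ∘ ofComplex) upperHalfPlaneSet) (γ : SL(2, ℤ)) {τ : ℍ}
    (h : f (γ • τ) ≠ 0) :
    pairing₁ k (f ∣[k] γ) (g ∣[(2 : ℤ)] γ) τ = (pairing₁ k f g ∣[(2 : ℤ)] γ) τ := by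
  rw [pairing₁, hf.logDerivOp_slash k γ h, xiOp_two_slash γ hg, slash_zero_apply,
    ModularForm.SL_slash_apply, ModularForm.SL_slash_apply, pairing₁]
  ring

lemma pairing₂_slash {f g : ℍ → ℂ} (k : ℤ)
    (hg : ContDiffOn ℝ ∞ (g ∘ ofComplex) upperHalfPlaneSet) (γ : SL(2, ℤ)) (τ : ℍ) :
    pairing₂ k (f ∣[k] γ) (g ∣[(2 : ℤ)] γ) τ = (pairing₂ k f g ∣[(2 : ℤ)] γ) τ := by
  rw [pairing₂, logNorm_slash, lapOp_two_slash γ hg,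
    ModularForm.SL_slash_apply, ModularForm.SL_slash_apply, ModularForm.SL_slash_apply, pairing₂]
  ring

lemma xiOp_lapOp_slash {g : ℍ → ℂ} (hg : ContDiffOn ℝ ∞ (g ∘ ofComplex) upperHalfPlaneSet)
    (γ : SL(2, ℤ)) (τ : ℍ) :
    xiOp 2 (lapOp 2 (g ∣[(2 : ℤ)] γ)) τ = xiOp 2 (lapOp 2 g) (γ • τ) := by
  rw [lapOp_two_slash γ hg, xiOp_two_slash γ (contDiffOn_lapOp 2 hg), slash_zero_apply]

end RohrlichDivisor

end

noncomputable section

namespace RohrlichDivisor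

/-! ### The action of the modular group -/

lemma continuous_smul_SL (γ : SL(2, ℤ)) : Continuous fun τ : ℍ ↦ γ • τ :=
  continuous_const_smul (γ : GL (Fin 2) ℝ)

lemma measurePreserving_smul_SL (γ : SL(2, ℤ)) :
    MeasurePreserving (fun τ : ℍ ↦ γ • τ) volume volume :=
  measurePreserving_smul (γ : GL (Fin 2) ℝ) volume

lemma measurableEmbedding_smul_SL (γ : SL(2, ℤ)) : MeasurableEmbedding fun τ : ℍ ↦ γ • τ :=
  measurableEmbedding_const_smul (γ : GL (Fin 2) ℝ)

/-- Proper discontinuity of the action; it makes the sums over `SL(2, ℤ)` of compactly supported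
functions locally finite. -/
lemma finite_smul_meets {K L : Set ℍ} (hK : IsCompact K) (hL : IsCompact L) :
    {γ : SL(2, ℤ) | ∃ τ ∈ K, γ • τ ∈ L}.Finite := by
  have h := ProperlyDiscontinuousSMul.finite_disjoint_inter_image
    (Γ := (Matrix.SpecialLinearGroup.mapGL ℝ : SL(2, ℤ) →* GL (Fin 2) ℝ).range) hK hL
  have hinj : Function.Injective (Matrix.SpecialLinearGroup.mapGL ℝ : SL(2, ℤ) →* GL (Fin 2) ℝ) :=
    Matrix.SpecialLinearGroup.mapGL_injective
  refine Set.Finite.of_injOn (f := (Matrix.SpecialLinearGroup.mapGL ℝ :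
    SL(2, ℤ) →* GL (Fin 2) ℝ).rangeRestrict) (t := _) ?_ ?_ h
  · rintro γ ⟨τ, hτ, hγ⟩
    exact ⟨γ • τ, ⟨τ, hτ, rfl⟩, hγ⟩
  · intro a _ b _ hab
    exact hinj (congrArg Subtype.val hab)

lemma im_smul_of_eq_zero {γ : SL(2, ℤ)} (h : γ 1 0 = 0) (τ : ℍ) : (γ • τ).im = τ.im := by
  have hdet := Matrix.det_fin_two γ.1
  rw [γ.2, h, mul_zero, sub_zero] at hdet
  rw [ModularGroup.im_smul_eq_div_normSq, ModularGroup.denom_apply, h]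
  have : (γ 1 1 : ℤ) ^ 2 = 1 := by
    rcases Int.eq_one_or_neg_one_of_mul_eq_one (by rw [mul_comm]; exact hdet.symm) with h1 | h1 <;>
    simp [h1]
  have h2 : ((γ 1 1 : ℤ) : ℝ) * ((γ 1 1 : ℤ) : ℝ) = 1 := by
    rw [← sq]
    exact_mod_cast this
  simp [normSq_apply, h2]

/-- For `c ≠ 0`, `|cτ + d|² ≥ c² v² ≥ v²`. High points are thus sent low by every element not fixing
`i∞`, which separates the cusps. -/
lemma im_smul_le_inv {γ : SL(2, ℤ)} (h : γ 1 0 ≠ 0) (τ : ℍ) : (γ • τ).im ≤ τ.im⁻¹ := by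
  have h1 : (1 : ℝ) ≤ ((γ 1 0 : ℤ) : ℝ) ^ 2 := by
    have : 1 ≤ (γ 1 0 : ℤ) ^ 2 := Int.add_one_le_iff.mpr
      (lt_of_le_of_ne (sq_nonneg _) (pow_ne_zero 2 h).symm)
    exact_mod_cast this
  have hv := τ.im_pos
  have h2 : τ.im ^ 2 ≤ normSq (denom γ τ) := by
    rw [ModularGroup.denom_apply, normSq_apply]
    simp only [add_re, mul_re, intCast_re, intCast_im, zero_mul, sub_zero, coe_re, add_im, mul_im,
      coe_im, add_zero]
    nlinarith [mul_self_nonneg (((γ 1 0 : ℤ) : ℝ) * τ.re + ((γ 1 1 : ℤ) : ℝ)),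
      mul_le_mul_of_nonneg_right h1 (sq_nonneg τ.im)]
  rw [ModularGroup.im_smul_eq_div_normSq, div_le_iff₀ (by nlinarith)]
  calc τ.im = τ.im⁻¹ * τ.im ^ 2 := by field_simp
    _ ≤ _ := by gcongr

/-- The complement of the horoballs of height `y` at all points of `ℚ ∪ {i∞}`. -/
def truncatedPlane (y : ℝ) : Set ℍ := {τ | ∀ γ : SL(2, ℤ), (γ • τ).im ≤ y}

lemma isClosed_truncatedPlane (y : ℝ) : IsClosed (truncatedPlane y) := by
  rw [truncatedPlane, Set.ofPred_forall]
  exact isClosed_iInter fun γ ↦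
    isClosed_le (UpperHalfPlane.continuous_im.comp (continuous_smul_SL γ)) continuous_const

lemma smul_mem_truncatedPlane (γ : SL(2, ℤ)) (y : ℝ) (τ : ℍ) :
    γ • τ ∈ truncatedPlane y ↔ τ ∈ truncatedPlane y := by
  refine ⟨fun h δ ↦ ?_, fun h δ ↦ ?_⟩
  · simpa [mul_smul] using h (δ * γ⁻¹)
  · simpa [mul_smul] using h (δ * γ)

lemma im_le_of_mem_truncatedPlane {y : ℝ} {τ : ℍ} (h : τ ∈ truncatedPlane y) : τ.im ≤ y := by
  simpa using h 1

lemma mem_truncatedPlane_of_im {y : ℝ} {τ : ℍ} (h1 : τ.im ≤ y) (h2 : τ.im⁻¹ ≤ y) :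
    τ ∈ truncatedPlane y := fun γ ↦ by
  by_cases h : γ 1 0 = 0
  · rwa [im_smul_of_eq_zero h]
  · exact (im_smul_le_inv h τ).trans h2

/-! ### A smooth partition of unity -/

/-- A version of `1 / s` that is smooth on all of `ℝ`, for normalizing sums that may vanish. The
factor `Real.smoothTransition (4 * s - 1)` is `0` for `s ≤ 1/4` and `1` for `s ≥ 1/2`. -/
lemma exists_smooth_cutoff_div : ∃ ρ : ℝ → ℝ, ContDiff ℝ ∞ ρ ∧ ∀ s, 1 / 2 ≤ s → s * ρ s = 1 := by
  have hs : ContDiff ℝ ∞ fun s : ℝ ↦ Real.smoothTransition (4 * s - 1) :=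
    Real.smoothTransition.contDiff.comp (by fun_prop)
  refine ⟨fun s ↦ Real.smoothTransition (4 * s - 1) * s⁻¹, ?_, fun s hs ↦ ?_⟩
  · rw [contDiff_iff_contDiffAt]
    intro s
    rcases lt_or_ge s (1 / 4) with h | h
    · refine (contDiffAt_const (c := (0 : ℝ))).congr_of_eventuallyEq ?_
      filter_upwards [Iio_mem_nhds h] with t ht
      rw [Real.smoothTransition.zero_of_nonpos, zero_mul]
      rw [Set.mem_Iio] at ht
      linarith
    · exact hs.contDiffAt.mul (contDiffAt_inv ℝ (by linarith))
  · simp only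
    rw [Real.smoothTransition.one_of_one_le (by linarith), one_mul, mul_inv_cancel₀ (by linarith)]

lemma isCompact_preimage_coe {K : Set ℂ} (hK : IsCompact K) (hKV : K ⊆ upperHalfPlaneSet) :
    IsCompact (UpperHalfPlane.coe ⁻¹' K) :=
  isOpenEmbedding_coe.isInducing.isCompact_preimage_iff
    (by rwa [UpperHalfPlane.range_coe]) |>.mpr hK

/-- Sums over the modular group of a compactly supported function are locally finite. -/
lemma exists_finset_support_subset {M : Type*} [Zero M] {x : ℍ → M} {L : Set ℍ}
    (hL : IsCompact L) (hx : ∀ τ, x τ ≠ 0 → τ ∈ L) (τ : ℍ) :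
    ∃ T : Finset SL(2, ℤ), ∀ᶠ τ' in 𝓝 τ, ∀ γ : SL(2, ℤ), x (γ • τ') ≠ 0 → γ ∈ T := by
  obtain ⟨C, hC, hτC⟩ := exists_compact_mem_nhds τ
  refine ⟨(finite_smul_meets hC hL).toFinset, ?_⟩
  filter_upwards [hτC] with τ' hτ' γ hγ
  simpa using ⟨τ', hτ', hx _ hγ⟩

lemma finsum_eq_sum_of_forall {M α : Type*} [AddCommMonoid M] {x : α → M} {T : Finset α}
    (h : ∀ a, x a ≠ 0 → a ∈ T) : ∑ᶠ a, x a = ∑ a ∈ T, x a :=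
  finsum_eq_sum_of_support_subset _ fun a ha ↦ h a ha

/-- Let `χ` be a bump equal to `1` on the standard fundamental domain cut off at height `y`. Its
orbit sum `S` is invariant, smooth, and at least `1` on `truncatedPlane y`; then `X = χ / S`, with
the division smoothed where `S` is small. The support can be kept in `Im τ > 1/2` as the standard
domain has `Im τ ≥ √3 / 2`. The sum is `1` on a whole neighbourhood so that it can be
differentiated. -/
lemma exists_partition (y : ℝ) : ∃ X : ℂ → ℝ, ContDiff ℝ ∞ X ∧ HasCompactSupport X ∧
    tsupport X ⊆ upperHalfPlaneSet ∧ (∀ τ : ℍ, X τ ≠ 0 → 1 / 2 < τ.im) ∧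
    ∀ τ ∈ truncatedPlane y, ∀ᶠ τ' in 𝓝 τ, ∑ᶠ γ : SL(2, ℤ), X ((γ • τ' : ℍ) : ℂ) = 1 := by
  set K : Set ℂ := UpperHalfPlane.coe '' ModularGroup.truncatedFundamentalDomain y
  have hK : IsCompact K :=
    (ModularGroup.isCompact_truncatedFundamentalDomain y).image UpperHalfPlane.continuous_coe
  have hO : IsOpen {w : ℂ | 1 / 2 < w.im} := isOpen_lt continuous_const Complex.continuous_im
  have hOV : {w : ℂ | 1 / 2 < w.im} ⊆ upperHalfPlaneSet := fun w hw ↦ by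
    have hw : 1 / 2 < w.im := hw
    exact lt_trans (by norm_num) hw
  have hKO : K ⊆ {w : ℂ | 1 / 2 < w.im} := by
    rintro _ ⟨τ, hτ, rfl⟩
    have h := ModularGroup.three_le_four_mul_im_sq_of_mem_fd hτ.1
    have h' := τ.im_pos
    change 1 / 2 < τ.im
    nlinarith
  obtain ⟨χ, hχ, hχc, hχO, hχ1, hχI⟩ := exists_bump hK hO hKO
  obtain ⟨ρ, hρ, hρ1⟩ := exists_smooth_cutoff_div
  set L : Set ℍ := UpperHalfPlane.coe ⁻¹' (tsupport χ)
  have hL : IsCompact L := isCompact_preimage_coe hχc (hχO.trans hOV)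
  have hχL (τ : ℍ) (h : χ τ ≠ 0) : τ ∈ L := subset_tsupport χ h
  set S : ℍ → ℝ := fun τ ↦ ∑ᶠ γ : SL(2, ℤ), χ ((γ • τ : ℍ) : ℂ) with hS
  have hSsmooth : ∀ τ : ℍ, ContDiffAt ℝ ∞ (fun w ↦ S (ofComplex w)) τ := fun τ ↦ by
    obtain ⟨T, hT⟩ := exists_finset_support_subset (x := fun τ : ℍ ↦ χ τ) hL hχL τ
    have hcont : Tendsto ofComplex (𝓝 (τ : ℂ)) (𝓝 τ) := by
      have := (contMDiffAt_ofComplex (n := 0) τ.im_pos).continuousAt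
      rwa [ContinuousAt, ofComplex_apply] at this
    have h1 : (fun w ↦ S (ofComplex w)) =ᶠ[𝓝 (τ : ℂ)]
        fun w ↦ ∑ γ ∈ T, χ ((γ • ofComplex w : ℍ) : ℂ) := by
      filter_upwards [hcont.eventually hT] with w hw
      exact finsum_eq_sum_of_forall hw
    refine ContDiffAt.congr_of_eventuallyEq (ContDiffAt.sum fun γ _ ↦ ?_) h1
    exact ContDiffAt.comp (τ : ℂ) (g := χ) (f := fun z : ℂ ↦ ((γ • ofComplex z : ℍ) : ℂ))
      hχ.contDiffAt ((analyticAt_smul (g := (γ : GL (Fin 2) ℝ))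
        (det_SL_pos γ) τ).contDiffAt.restrict_scalars ℝ)
  have hScont : Continuous S := continuous_iff_continuousAt.mpr fun τ ↦ by
    have h := ContinuousAt.comp (f := UpperHalfPlane.coe) (x := τ) (hSsmooth τ).continuousAt
      UpperHalfPlane.continuous_coe.continuousAt
    simpa only [Function.comp_def, ofComplex_apply] using h
  have hSinv (δ : SL(2, ℤ)) (τ : ℍ) : S (δ • τ) = S τ := by
    simp only [hS, ← mul_smul]
    exact finsum_comp_equiv (Equiv.mulRight δ) (f := fun γ : SL(2, ℤ) ↦ χ ((γ • τ : ℍ) : ℂ))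
  have hfin (τ : ℍ) : (Function.support fun γ : SL(2, ℤ) ↦ χ ((γ • τ : ℍ) : ℂ)).Finite := by
    obtain ⟨T, hT⟩ := exists_finset_support_subset (x := fun τ : ℍ ↦ χ τ) hL hχL τ
    exact T.finite_toSet.subset hT.self_of_nhds
  have hS1 : ∀ τ ∈ truncatedPlane y, 1 ≤ S τ := fun τ hτ ↦ by
    obtain ⟨γ, hγ⟩ := ModularGroup.exists_smul_mem_fd τ
    have h1 : χ ((γ • τ : ℍ) : ℂ) = 1 := hχ1 _ ⟨γ • τ, ⟨hγ, hτ γ⟩, rfl⟩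
    rw [← h1]
    exact single_le_finsum γ (hfin τ) fun δ ↦ (hχI _).1
  refine ⟨fun w ↦ χ w * ρ (S (ofComplex w)), ?_, hχc.mul_right, ?_, ?_, ?_⟩
  · rw [contDiff_iff_contDiffAt]
    intro w
    by_cases hw : w ∈ tsupport χ
    · lift w to ℍ using hOV (hχO hw)
      exact hχ.contDiffAt.mul (hρ.contDiffAt.comp _ (hSsmooth w))
    · refine (contDiffAt_const (c := (0 : ℝ))).congr_of_eventuallyEq ?_
      filter_upwards [notMem_tsupport_iff_eventuallyEq.mp hw] with z hz
      simp [hz]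
  · refine (closure_mono fun w hw ↦ ?_).trans (hχO.trans hOV)
    exact left_ne_zero_of_mul hw
  · intro τ hτ
    exact hχO (subset_tsupport χ (left_ne_zero_of_mul hτ))
  · intro τ hτ
    have h2 : ∀ᶠ τ' in 𝓝 τ, 1 / 2 < S τ' :=
      hScont.continuousAt.eventually_const_lt (lt_of_lt_of_le (by norm_num) (hS1 τ hτ))
    filter_upwards [h2] with τ' hlt
    simp only [ofComplex_apply, hSinv]
    rw [← finsum_mul]
    exact hρ1 _ hlt.le

/-! ### Unfolding -/

lemma setIntegral_comp_smul {A : Set ℍ} (hA : ∀ (γ : SL(2, ℤ)) τ, γ • τ ∈ A ↔ τ ∈ A)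
    (γ : SL(2, ℤ)) (B : ℍ → ℂ) : ∫ τ in A, B (γ • τ) = ∫ τ in A, B τ := by
  have h := (measurePreserving_smul_SL γ).setIntegral_preimage_emb
    (measurableEmbedding_smul_SL γ) B A
  have h2 : (fun τ : ℍ ↦ γ • τ) ⁻¹' A = A := by
    ext τ
    exact hA γ τ
  rwa [h2] at h

lemma integrableOn_comp_smul {A : Set ℍ} (hA : ∀ (γ : SL(2, ℤ)) τ, γ • τ ∈ A ↔ τ ∈ A)
    (γ : SL(2, ℤ)) {B : ℍ → ℂ} (hB : IntegrableOn B A) :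
    IntegrableOn (fun τ ↦ B (γ • τ)) A := by
  have h := ((measurePreserving_smul_SL γ).integrableOn_comp_preimage
    (measurableEmbedding_smul_SL γ) (f := B) (s := A)).mpr hB
  have h2 : (fun τ : ℍ ↦ γ • τ) ⁻¹' A = A := by
    ext τ
    exact hA γ τ
  rwa [h2] at h

/-- Insert `1 = ∑ x(γτ)` under the integral of `B` and substitute `τ ↦ γ⁻¹τ` in each summand: the
sum moves from `x` to `B`. Compactness of `K` and `L` leaves finitely many `γ`. -/
lemma setIntegral_unfold {A : Set ℍ} (hAm : MeasurableSet A)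
    (hA : ∀ (γ : SL(2, ℤ)) τ, γ • τ ∈ A ↔ τ ∈ A) {x B C : ℍ → ℂ} (hx : Continuous x)
    {K L : Set ℍ} (hL : IsCompact L) (hxL : ∀ τ, x τ ≠ 0 → τ ∈ L)
    (hsum : ∀ τ ∈ A, ∑ᶠ γ : SL(2, ℤ), x (γ • τ) = 1) (hK : IsCompact K)
    (hB : IntegrableOn B A) (hBK : ∀ τ ∈ A, B τ ≠ 0 → τ ∈ K)
    (hC : ∀ᵐ τ, τ ∈ A → x τ ≠ 0 → ∑ᶠ γ : SL(2, ℤ), B (γ • τ) = C τ) :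
    ∫ τ in A, B τ = ∫ τ in A, x τ * C τ := by
  set T := (finite_smul_meets hK hL).toFinset with hT
  obtain ⟨c, hc⟩ : ∃ c, ∀ τ, ‖x τ‖ ≤ c := by
    refine hx.bounded_above_of_compact_support (HasCompactSupport.of_support_subset_isCompact hL
      fun τ hτ ↦ hxL τ hτ)
  have hi (γ : SL(2, ℤ)) : IntegrableOn (fun τ ↦ x (γ • τ) * B τ) A :=
    hB.bdd_mul (hx.comp (continuous_smul_SL γ)).aestronglyMeasurable
      (Eventually.of_forall fun τ ↦ hc (γ • τ))
  have h1 : ∫ τ in A, B τ = ∑ γ ∈ T, ∫ τ in A, x (γ • τ) * B τ := by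
    rw [← integral_finsetSum _ fun γ _ ↦ hi γ]
    refine setIntegral_congr_fun hAm fun τ hτ ↦ ?_
    rw [← Finset.sum_mul]
    by_cases h0 : B τ = 0
    · simp [h0]
    · rw [← finsum_eq_sum_of_forall, hsum τ hτ, one_mul]
      intro γ hγ
      simpa [hT] using ⟨τ, hBK τ hτ h0, hxL _ hγ⟩
  have h2 (γ : SL(2, ℤ)) : ∫ τ in A, x (γ • τ) * B τ = ∫ τ in A, x τ * B (γ⁻¹ • τ) := by
    rw [← setIntegral_comp_smul hA γ (fun τ ↦ x τ * B (γ⁻¹ • τ))]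
    simp
  have hi' (γ : SL(2, ℤ)) : IntegrableOn (fun τ ↦ x τ * B (γ⁻¹ • τ)) A := by
    have := integrableOn_comp_smul hA γ⁻¹ (hi γ)
    simpa using this
  rw [h1, Finset.sum_congr rfl fun γ _ ↦ h2 γ, ← integral_finsetSum _ fun γ _ ↦ hi' γ]
  refine setIntegral_congr_ae hAm ?_
  filter_upwards [hC] with τ hτ hτA
  by_cases h0 : x τ = 0
  · simp [h0]
  · rw [← Finset.mul_sum, ← hτ hτA h0]
    congr 1
    rw [← finsum_comp_equiv (Equiv.inv SL(2, ℤ))]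
    refine (finsum_eq_sum_of_forall fun γ hγ ↦ ?_).symm
    rw [hT, Set.Finite.mem_toFinset]
    exact ⟨γ⁻¹ • τ, hBK _ ((hA _ _).mpr hτA) hγ, by simpa using hxL _ h0⟩

end RohrlichDivisor

end

noncomputable section

namespace RohrlichDivisor

/-! ### Sums over cosets -/

section Cosets

variable {G M : Type*} [Group G] [AddCommMonoid M] (Γ : Subgroup G)

/-- The quotient `G ⧸ Γ` consists of left cosets, so the inverses of its representatives represent
`Γ \ G`. -/
lemma bijective_mul_out_inv :
    Function.Bijective fun p : (G ⧸ Γ) × Γ ↦ (p.2 : G) * (p.1.out)⁻¹ := by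
  constructor
  · rintro ⟨q, δ⟩ ⟨q', δ'⟩ h
    simp only at h
    have h1 : q.out = q'.out * ((δ'⁻¹ * δ : Γ) : G) := by
      rw [mul_inv_eq_iff_eq_mul] at h
      simp only [Subgroup.coe_mul, Subgroup.coe_inv]
      rw [h]
      group
    have h2 : q = q' := by
      calc q = (q.out : G ⧸ Γ) := (Quotient.out_eq' q).symm
        _ = (q'.out : G ⧸ Γ) := by
          rw [h1]
          exact QuotientGroup.mk_mul_of_mem _ (δ'⁻¹ * δ).2
        _ = q' := Quotient.out_eq' q'
    subst h2
    simpa using h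
  · intro γ
    refine ⟨⟨(γ⁻¹ : G), ⟨γ * ((γ⁻¹ : G) : G ⧸ Γ).out, ?_⟩⟩, by simp⟩
    have h := QuotientGroup.eq.mp (Quotient.out_eq' ((γ⁻¹ : G) : G ⧸ Γ)).symm
    simpa using h

variable {Γ}

lemma finsum_eq_sum_cosets [Fintype (G ⧸ Γ)] {b : G → M} (hb : (Function.support b).Finite) :
    ∑ᶠ γ, b γ = ∑ q : G ⧸ Γ, ∑ᶠ δ : Γ, b (δ * (q.out)⁻¹) := by
  have hbij := bijective_mul_out_inv Γ
  rw [← finsum_comp_equiv (Equiv.ofBijective _ hbij)]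
  simp only [Equiv.ofBijective_apply]
  rw [finsum_curry _ (hb.preimage hbij.1.injOn), finsum_eq_sum_of_fintype]

/-- A left `Γ`-invariant function of `γ` depends only on the class of `γ⁻¹` in `G ⧸ Γ`. -/
lemma apply_eq_apply_out {α : Type*} {c : G → α} (hc : ∀ δ ∈ Γ, ∀ γ, c (δ * γ) = c γ) (γ : G) :
    c γ = c (((γ⁻¹ : G) : G ⧸ Γ).out)⁻¹ := by
  have h := QuotientGroup.eq.mp (Quotient.out_eq' ((γ⁻¹ : G) : G ⧸ Γ)).symm
  rw [← hc _ h (((γ⁻¹ : G) : G ⧸ Γ).out)⁻¹]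
  simp

/-- Right multiplication by `γ` permutes `Γ \ G`. This upgrades invariance under `Γ` to invariance
under all of `G`. -/
lemma sum_cosets_mul [Fintype (G ⧸ Γ)] {c : G → M} (hc : ∀ δ ∈ Γ, ∀ γ, c (δ * γ) = c γ) (γ : G) :
    ∑ q : G ⧸ Γ, c ((q.out)⁻¹ * γ) = ∑ q : G ⧸ Γ, c (q.out)⁻¹ := by
  refine Fintype.sum_equiv (MulAction.toPerm γ⁻¹) _ _ fun q ↦ ?_
  rw [apply_eq_apply_out hc]
  congr 3
  rw [MulAction.toPerm_apply, mul_inv_rev, inv_inv]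
  conv_rhs => rw [← Quotient.out_eq' q]
  rfl

end Cosets

/-! ### Unfolding over the cosets of `Γ₀(N)` -/

lemma neg_one_mem_Gamma0 (N : ℕ) : (-1 : SL(2, ℤ)) ∈ Gamma0 N := by
  simp [Gamma0_mem]

/-- Almost every orbit of `Γ₀(N)` meets a fundamental domain in the images of two elements. -/
lemma IsClosedFundamentalDomain.finsum_indicator {N : ℕ} {F : Set ℍ}
    (hF : IsClosedFundamentalDomain N F) {τ : ℍ}
    (hτ : ∀ γ : SL(2, ℤ), γ • τ ∉ frontier F) (c : ℂ) :
    ∑ᶠ δ : Gamma0 N, F.indicator (fun _ ↦ c) ((δ : SL(2, ℤ)) • τ) = 2 * c := by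
  classical
  obtain ⟨δ, hδ, hδF⟩ := hF.covers τ
  have hint (γ : SL(2, ℤ)) (h : γ • τ ∈ F) : γ • τ ∈ interior F := by
    by_contra h'
    exact hτ γ ⟨subset_closure h, h'⟩
  set d : Gamma0 N := ⟨δ, hδ⟩
  set d' : Gamma0 N := ⟨-1, neg_one_mem_Gamma0 N⟩ * d
  have hne : d ≠ d' := fun h ↦ by
    have h1 := congrArg (fun e : Gamma0 N ↦ (e : SL(2, ℤ)) * δ⁻¹) h
    simp only [d', d, Subgroup.coe_mul, mul_inv_cancel, mul_inv_cancel_right] at h1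
    exact absurd (congrArg (fun e : SL(2, ℤ) ↦ e 0 0) h1) (by norm_num)
  have hneg : ((d' : SL(2, ℤ))) • τ = δ • τ := by
    simp [d', d]
  have hmem (e : Gamma0 N) (he : (e : SL(2, ℤ)) • τ ∈ F) : e = d ∨ e = d' := by
    by_contra! hcon
    have hdis := hF.disjoint_interior (e * δ⁻¹) (mul_mem e.2 (inv_mem hδ)) ?_ ?_
    · refine Set.disjoint_left.mp hdis (hint _ he) ?_
      refine ⟨δ • τ, hint _ hδF, ?_⟩
      simp [mul_smul]
    · intro h1
      exact hcon.1 (Subtype.ext (mul_inv_eq_one.mp h1))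
    · intro h1
      refine hcon.2 (Subtype.ext ?_)
      rw [mul_inv_eq_iff_eq_mul] at h1
      exact h1
  rw [finsum_eq_sum_of_forall (T := {d, d'}), Finset.sum_pair hne, hneg,
    Set.indicator_of_mem hδF]
  · ring
  · intro e he
    simpa using hmem e (Set.mem_of_indicator_ne_zero he)

instance : Countable SL(2, ℤ) :=
  have : Countable (Matrix (Fin 2) (Fin 2) ℤ) := inferInstanceAs (Countable (Fin 2 → Fin 2 → ℤ))
  Subtype.val_injective.countable

lemma ae_smul_notMem {s : Set ℍ} (hs : volume s = 0) :
    ∀ᵐ τ : ℍ, ∀ γ : SL(2, ℤ), γ • τ ∉ s := by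
  rw [ae_all_iff]
  intro γ
  exact (measurePreserving_smul_SL γ).quasiMeasurePreserving.preimage_null hs |> fun h ↦
    measure_eq_zero_iff_ae_notMem.mp h

/-- Unfolding applied to the indicator of `F` times `Φ`. Split into cosets of `Γ₀(N)`, the orbit sum
sees each point of `F` twice, through `δ` and `-δ`, for almost every `τ`. -/
lemma IsClosedFundamentalDomain.setIntegral_inter {N : ℕ} [Fintype (SL(2, ℤ) ⧸ Gamma0 N)]
    {F : Set ℍ} (hF : IsClosedFundamentalDomain N F) {A : Set ℍ} (hAm : MeasurableSet A)
    (hA : ∀ (γ : SL(2, ℤ)) τ, γ • τ ∈ A ↔ τ ∈ A) {x Φ : ℍ → ℂ} (hx : Continuous x)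
    {L : Set ℍ} (hL : IsCompact L) (hxL : ∀ τ, x τ ≠ 0 → τ ∈ L)
    (hsum : ∀ τ ∈ A, ∑ᶠ γ : SL(2, ℤ), x (γ • τ) = 1) (hFA : IsCompact (F ∩ A))
    (hΦ : ∀ γ ∈ Gamma0 N, ∀ τ, Φ (γ • τ) = Φ τ) (hi : IntegrableOn Φ (F ∩ A)) :
    ∫ τ in F ∩ A, Φ τ =
      ∫ τ in A, x τ * ∑ q : SL(2, ℤ) ⧸ Gamma0 N, 2 * Φ ((q.out)⁻¹ • τ) := by
  classical
  have hFm := hF.isClosed.measurableSet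
  have h1 : ∫ τ in F ∩ A, Φ τ = ∫ τ in A, F.indicator Φ τ := by
    rw [setIntegral_indicator hFm, Set.inter_comm]
  rw [h1]
  refine setIntegral_unfold hAm hA hx hL hxL hsum hFA ?_ ?_ ?_
  · rw [integrableOn_indicator_iff hFm]
    exact hi
  · intro τ hτ h
    exact ⟨Set.mem_of_indicator_ne_zero h, hτ⟩
  · filter_upwards [ae_smul_notMem hF.volume_frontier] with τ hτ hτA _
    rw [finsum_eq_sum_cosets (Γ := Gamma0 N)]
    · refine Finset.sum_congr rfl fun q _ ↦ ?_
      rw [← hF.finsum_indicator (τ := (q.out)⁻¹ • τ) (fun γ ↦ by rw [← mul_smul]; exact hτ _)]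
      refine finsum_congr fun δ ↦ ?_
      rw [mul_smul, Set.indicator_apply, Set.indicator_apply, hΦ _ δ.2]
    · refine (finite_smul_meets (isCompact_singleton (x := τ)) hFA).subset fun γ hγ ↦ ?_
      exact ⟨τ, rfl, Set.mem_of_indicator_ne_zero hγ, (hA γ τ).mpr hτA⟩

/-- As `P` has weight `2`, unfolding with `X` itself as the partition gives `v² P` times the
`τ̄`-derivative of `∑ X(γτ)`, which is locally constant on `A`. -/
lemma setIntegral_dbar_eq_zero {A : Set ℍ} (hAm : MeasurableSet A)
    (hA : ∀ (γ : SL(2, ℤ)) τ, γ • τ ∈ A ↔ τ ∈ A) {X : ℂ → ℝ} (hX : ContDiff ℝ ∞ X)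
    (hc : HasCompactSupport X) (hXV : tsupport X ⊆ upperHalfPlaneSet)
    (hsum : ∀ τ ∈ A, ∀ᶠ τ' in 𝓝 τ, ∑ᶠ γ : SL(2, ℤ), X ((γ • τ' : ℍ) : ℂ) = 1) {P : ℍ → ℂ}
    (hP : ∀ᵐ τ : ℍ, ∀ γ : SL(2, ℤ), P (γ • τ) = denom γ τ ^ 2 * P τ)
    (hi : IntegrableOn (fun τ ↦ (τ.im : ℂ) ^ 2 * dbar (fun τ ↦ (X τ : ℂ)) τ * P τ) A) :
    ∫ τ in A, (τ.im : ℂ) ^ 2 * dbar (fun τ ↦ (X τ : ℂ)) τ * P τ = 0 := by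
  set x : ℍ → ℂ := fun τ ↦ (X τ : ℂ) with hxdef
  set L : Set ℍ := UpperHalfPlane.coe ⁻¹' (tsupport X)
  have hL : IsCompact L := isCompact_preimage_coe hc hXV
  have hXc : ContDiff ℝ ∞ (fun w ↦ (X w : ℂ)) := ofRealCLM.contDiff.comp hX
  have hx : Continuous x := hXc.continuous.comp UpperHalfPlane.continuous_coe
  have hxL (τ : ℍ) (h : x τ ≠ 0) : τ ∈ L :=
    subset_tsupport X (by simpa [hxdef] using h)
  have hdL (τ : ℍ) (h : dbar x τ ≠ 0) : τ ∈ L := by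
    rw [hxdef, dbar_coe (fun w ↦ (X w : ℂ))] at h
    exact tsupport_comp_subset (g := ofReal) ofReal_zero X
      (tsupport_dbarC_subset _ (subset_tsupport _ h))
  have hsumc {τ : ℍ} (h : ∑ᶠ γ : SL(2, ℤ), X ((γ • τ : ℍ) : ℂ) = 1) :
      ∑ᶠ γ : SL(2, ℤ), x (γ • τ) = 1 := by
    obtain ⟨T, hT⟩ := exists_finset_support_subset hL hxL τ
    have hT := hT.self_of_nhds
    rw [finsum_eq_sum_of_forall hT]
    rw [finsum_eq_sum_of_forall (T := T) fun γ hγ ↦ hT γ (by simpa [hxdef] using hγ)] at h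
    simp only [hxdef, ← ofReal_sum, h, ofReal_one]
  have hdiff (τ : ℍ) : DifferentiableAt ℝ (x ∘ ofComplex) (τ : ℂ) := by
    refine (hXc.differentiable (by simp) (τ : ℂ)).congr_of_eventuallyEq ?_
    filter_upwards [isOpen_upperHalfPlaneSet.mem_nhds τ.im_pos] with w hw
    simp only [hxdef, Function.comp_apply, coe_ofComplex hw]
  have h0 := setIntegral_unfold (C := fun _ ↦ 0) hAm hA hx hL hxL
    (fun τ hτ ↦ hsumc (hsum τ hτ).self_of_nhds) hL hi (fun τ _ h ↦ hdL τ fun h0 ↦ h (by simp [h0]))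
    ?_
  · rw [h0]
    simp
  · filter_upwards [hP] with τ hτ hτA _
    obtain ⟨T, hT⟩ := exists_finset_support_subset hL hxL τ
    -- The factors of `cτ + d` and its conjugate from `v²`, the derivative and `P` cancel, so the
    -- dependence on `γ` is confined to `x ∣ γ`.
    have hB (γ : SL(2, ℤ)) : ((γ • τ).im : ℂ) ^ 2 * dbar x (γ • τ) * P (γ • τ) =
        (τ.im : ℂ) ^ 2 * P τ * dbar (x ∣[(0 : ℤ)] γ) τ := by
      have hd := denom_ne γ τ
      have hd' : conj (denom γ (τ : ℂ)) ≠ 0 := (map_ne_zero _).mpr hd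
      rw [dbar_slash 0 γ τ (hdiff _), hτ γ, im_smul_SL]
      simp only [map_inv₀, map_pow, neg_zero, zpow_zero]
      field_simp
    have hcont : Tendsto ofComplex (𝓝 (τ : ℂ)) (𝓝 τ) := by
      have := (contMDiffAt_ofComplex (n := 0) τ.im_pos).continuousAt
      rwa [ContinuousAt, ofComplex_apply] at this
    have hzero (γ : SL(2, ℤ)) (hγ : γ ∉ T) : dbar (x ∣[(0 : ℤ)] γ) τ = 0 := by
      rw [dbar_eq_dbarC, dbarC_congr (ψ := fun _ ↦ 0), dbarC_const]
      filter_upwards [hcont.eventually hT] with w hw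
      rw [Function.comp_apply, slash_zero_apply]
      by_contra h
      exact hγ (hw γ h)
    simp_rw [hB]
    rw [finsum_eq_sum_of_forall (T := T), ← Finset.mul_sum]
    · have hs : ∑ γ ∈ T, dbar (x ∣[(0 : ℤ)] γ) τ =
          dbarC (fun w ↦ ∑ γ ∈ T, ((x ∣[(0 : ℤ)] γ) ∘ ofComplex) w) τ := by
        rw [dbarC_sum]
        · rfl
        · intro γ _
          have h2 := contDiffOn_slash (φ := x) 0 γ ?_
          · exact (h2.contDiffAt (isOpen_upperHalfPlaneSet.mem_nhds
              τ.im_pos)).differentiableAt (by simp)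
          · refine hXc.contDiffOn.congr fun w hw ↦ ?_
            simp only [hxdef, Function.comp_apply, coe_ofComplex hw]
      rw [hs, dbarC_congr (ψ := fun _ ↦ 1), dbarC_const, mul_zero]
      filter_upwards [hcont.eventually hT, hcont.eventually (hsum τ hτA)] with w hw hw1
      rw [← hsumc hw1, finsum_eq_sum_of_forall hw]
      simp only [Function.comp_apply, slash_zero_apply]
    · intro γ hγ
      by_contra h
      exact hγ (by rw [hzero γ h, mul_zero])

end RohrlichDivisor

end

noncomputable section

namespace RohrlichDivisor

/-! ### The sum over the divisor -/

lemma mem_center_SL {A : SL(2, ℤ)} : A ∈ Subgroup.center SL(2, ℤ) ↔ A = 1 ∨ A = -1 := by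
  constructor
  · intro hA
    obtain ⟨r, hr, hrA⟩ := Matrix.SpecialLinearGroup.mem_center_iff.mp hA
    rw [Fintype.card_fin] at hr
    rcases eq_or_eq_neg_of_sq_eq_sq r 1 (by simpa using hr) with rfl | rfl
    · left
      ext i j
      rw [← hrA]
      simp
    · right
      ext i j
      rw [← hrA]
      simp [Matrix.one_apply]
  · rintro (rfl | rfl)
    · exact one_mem _
    · rw [Subgroup.mem_center_iff]
      intro g
      simp

lemma neg_one_ne_one_SL : (1 : SL(2, ℤ)) ≠ -1 := fun h ↦
  absurd (congrArg (fun e : SL(2, ℤ) ↦ e 0 0) h) (by norm_num)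

lemma card_center_SL : Nat.card (Subgroup.center SL(2, ℤ)) = 2 := by
  have h : (Subgroup.center SL(2, ℤ) : Set SL(2, ℤ)) = {1, -1} := by
    ext A
    exact mem_center_SL
  have h2 : Nat.card (Subgroup.center SL(2, ℤ)) =
      ((Subgroup.center SL(2, ℤ) : Set SL(2, ℤ))).ncard := rfl
  rw [h2, h, Set.ncard_pair neg_one_ne_one_SL]

lemma center_le_stabilizer_inf (N : ℕ) (z : ℍ) :
    Subgroup.center SL(2, ℤ) ≤ MulAction.stabilizer SL(2, ℤ) z ⊓ Gamma0 N := by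
  intro A hA
  rcases mem_center_SL.mp hA with rfl | rfl
  · exact one_mem _
  · have h : (-1 : SL(2, ℤ)) ∈ MulAction.stabilizer SL(2, ℤ) z := by
      rw [MulAction.mem_stabilizer_iff]
      simp
    exact ⟨h, neg_one_mem_Gamma0 N⟩

/-- The centre `{1, -1}` lies in the stabilizer and is the kernel of the projection that defines
`stabOrder`. -/
lemma card_stabilizer (N : ℕ) (z : ℍ) :
    Nat.card (MulAction.stabilizer (Gamma0 N) z) = 2 * stabOrder N z := by
  set H := MulAction.stabilizer SL(2, ℤ) z ⊓ Gamma0 N with hH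
  have h1 : Nat.card (MulAction.stabilizer (Gamma0 N) z) = Nat.card H := by
    refine Nat.card_congr
      { toFun := fun δ ↦ ⟨δ.1, δ.2, δ.1.2⟩
        invFun := fun δ ↦ ⟨⟨δ.1, δ.2.2⟩, δ.2.1⟩
        left_inv := fun _ ↦ rfl
        right_inv := fun _ ↦ rfl }
  have h2 := Subgroup.relIndex_mul_relIndex ⊥ (Subgroup.center SL(2, ℤ)) H bot_le
    (center_le_stabilizer_inf N z)
  rw [Subgroup.relIndex_bot_left, Subgroup.relIndex_bot_left, card_center_SL] at h2
  rw [h1, stabOrder, ← hH, ← Subgroup.relIndex_ker, QuotientGroup.ker_mk', h2]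

/-- Stabilizers are finite by proper discontinuity; for an infinite one `Nat.card` would be `0`. -/
lemma stabOrder_ne_zero (N : ℕ) (z : ℍ) : stabOrder N z ≠ 0 := by
  have hfin : (MulAction.stabilizer SL(2, ℤ) z : Set SL(2, ℤ)).Finite := by
    refine (finite_smul_meets (isCompact_singleton (x := z))
      (isCompact_singleton (x := z))).subset fun γ hγ ↦ ⟨z, rfl, hγ⟩
  have : Finite (MulAction.stabilizer (Gamma0 N) z) := by
    have := hfin.to_subtype
    refine Finite.of_injective (β := (MulAction.stabilizer SL(2, ℤ) z : Set SL(2, ℤ)))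
      (fun δ ↦ ⟨δ.1, δ.2⟩) fun a b h ↦ ?_
    exact Subtype.ext (Subtype.ext (Subtype.mk.inj h))
  have h := card_stabilizer N z
  have h2 : Nat.card (MulAction.stabilizer (Gamma0 N) z) ≠ 0 := Nat.card_ne_zero.mpr
    ⟨⟨1⟩, this⟩
  intro h0
  rw [h0, mul_zero] at h
  exact h2 h

/-- A sum over an orbit, counted with multiplicity, through the orbit map. -/
lemma sum_orbit_fiberwise {G α : Type*} [Group G] [MulAction G α] [DecidableEq α]
    {x : α → ℂ} (a : α) {T : Finset α} {S : Finset G} (hT : ∀ z ∈ T, ∃ δ : G, δ • a = z)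
    (hTx : ∀ δ : G, x (δ • a) ≠ 0 → δ • a ∈ T) (hS : ∀ δ : G, x (δ • a) ≠ 0 ↔ δ ∈ S) :
    ∑ δ ∈ S, x (δ • a) = Nat.card (MulAction.stabilizer G a) * ∑ z ∈ T, x z := by
  rw [← Finset.sum_fiberwise_of_maps_to (g := fun δ ↦ δ • a) (t := T)
    fun δ hδ ↦ hTx δ ((hS δ).mpr hδ), Finset.mul_sum]
  refine Finset.sum_congr rfl fun z hz ↦ ?_
  rw [Finset.sum_congr rfl (g := fun _ ↦ x z)
    fun δ hδ ↦ by rw [(Finset.mem_filter.mp hδ).2], Finset.sum_const, nsmul_eq_mul]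
  by_cases h0 : x z = 0
  · simp [h0]
  congr 2
  obtain ⟨δ₀, rfl⟩ := hT z hz
  rw [← Nat.card_eq_finsetCard]
  refine Nat.card_congr
    { toFun := fun δ ↦ ⟨δ₀⁻¹ * δ.1, ?_⟩
      invFun := fun δ ↦ ⟨δ₀ * δ.1, ?_⟩
      left_inv := fun δ ↦ by simp
      right_inv := fun δ ↦ by simp }
  · rw [MulAction.mem_stabilizer_iff, mul_smul, (Finset.mem_filter.mp δ.2).2, inv_smul_smul]
  · have h1 : (δ₀ * δ.1) • a = δ₀ • a := by
      rw [mul_smul, MulAction.mem_stabilizer_iff.mp δ.2]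
    exact Finset.mem_filter.mpr ⟨(hS _).mp (by rwa [h1]), h1⟩

/-- Summing the translates of `x` over coset representatives gives a weight `x'` whose sum over
`Γ₀(N)` is `1` at the relevant points. Counted by group elements, each point of an orbit occurs `2
ω_z` times, so `x'` sums to `1 / (2 ω_z)` over that orbit. -/
lemma divisorSum_unfold {N : ℕ} [Fintype (SL(2, ℤ) ⧸ Gamma0 N)] {x φ : ℍ → ℂ} {L : Set ℍ}
    (hL : IsCompact L) (hxL : ∀ τ, x τ ≠ 0 → τ ∈ L)
    (hsum : ∀ z, φ z ≠ 0 → ∑ᶠ γ : SL(2, ℤ), x (γ • z) = 1)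
    (hφ : ∀ γ ∈ Gamma0 N, ∀ τ, φ (γ • τ) = φ τ)
    (hfin : ∀ K : Set ℍ, IsCompact K → {z ∈ K | φ z ≠ 0}.Finite) :
    ∑ᶠ o : MulAction.orbitRel.Quotient (Gamma0 N) ℍ, φ o.out / stabOrder N o.out =
      2 * ∑ q : SL(2, ℤ) ⧸ Gamma0 N, ∑ᶠ z : ℍ, x z * φ ((q.out)⁻¹ • z) := by
  classical
  set x' : ℍ → ℂ := fun z ↦ ∑ q : SL(2, ℤ) ⧸ Gamma0 N, x (q.out • z) with hx'
  set L' : Set ℍ := ⋃ q : SL(2, ℤ) ⧸ Gamma0 N, (fun τ : ℍ ↦ (q.out)⁻¹ • τ) '' L with hL'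
  have hL'c : IsCompact L' :=
    isCompact_iUnion fun q ↦ hL.image (continuous_smul_SL _)
  have hxL' (q : SL(2, ℤ) ⧸ Gamma0 N) (z : ℍ) (h : x (q.out • z) ≠ 0) : z ∈ L' :=
    Set.mem_iUnion.mpr ⟨q, q.out • z, hxL _ h, by simp⟩
  have hxsupp (z : ℍ) (h : x' z ≠ 0) : z ∈ L' := by
    obtain ⟨q, -, hq⟩ := Finset.exists_ne_zero_of_sum_ne_zero h
    exact hxL' q z hq
  set T := (hfin L' hL'c).toFinset with hT
  have hTmem (z : ℍ) : z ∈ T ↔ z ∈ L' ∧ φ z ≠ 0 := by simp [hT]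
  have hR : ∑ q : SL(2, ℤ) ⧸ Gamma0 N, ∑ᶠ z : ℍ, x z * φ ((q.out)⁻¹ • z) =
      ∑ z ∈ T, x' z * φ z := by
    have h1 (q : SL(2, ℤ) ⧸ Gamma0 N) : ∑ᶠ z : ℍ, x z * φ ((q.out)⁻¹ • z) =
        ∑ z ∈ T, x (q.out • z) * φ z := by
      rw [← finsum_comp_equiv (MulAction.toPerm q.out)]
      simp only [MulAction.toPerm_apply, inv_smul_smul]
      refine finsum_eq_sum_of_forall fun z hz ↦ ?_
      exact (hTmem z).mpr ⟨hxL' q z (left_ne_zero_of_mul hz), right_ne_zero_of_mul hz⟩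
    simp_rw [h1, hx', Finset.sum_mul]
    rw [Finset.sum_comm]
  have hone (z : ℍ) (hz : φ z ≠ 0) : ∑ᶠ δ : Gamma0 N, x' (δ • z) = 1 := by
    obtain ⟨T', hT'⟩ := exists_finset_support_subset hL hxL z
    have hT' := hT'.self_of_nhds
    have hinj : Function.Injective fun γ : SL(2, ℤ) ↦ γ⁻¹ := inv_injective
    have hfin' : (Function.support fun γ : SL(2, ℤ) ↦ x (γ⁻¹ • z)).Finite :=
      (T'.finite_toSet.preimage hinj.injOn).subset fun γ hγ ↦ hT' _ hγ
    have hfin2 (q : SL(2, ℤ) ⧸ Gamma0 N) :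
        (Function.support fun δ : Gamma0 N ↦ x (q.out • δ • z)).Finite := by
      have hinj2 : Function.Injective fun δ : Gamma0 N ↦ q.out * (δ : SL(2, ℤ)) :=
        (mul_right_injective _).comp Subtype.val_injective
      refine (T'.finite_toSet.preimage hinj2.injOn).subset fun δ hδ ↦ hT' _ ?_
      rw [mul_smul]
      exact hδ
    rw [← hsum z hz, ← finsum_comp_equiv (Equiv.inv SL(2, ℤ))]
    simp only [Equiv.inv_apply]
    rw [finsum_eq_sum_cosets (Γ := Gamma0 N) hfin']
    simp only [hx']
    rw [finsum_sum_comm _ _ fun q _ ↦ hfin2 q]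
    refine Finset.sum_congr rfl fun q _ ↦ ?_
    rw [← finsum_comp_equiv (Equiv.inv (Gamma0 N))]
    refine finsum_congr fun δ ↦ ?_
    rw [mul_inv_rev, inv_inv, mul_smul]
    rfl
  set m : ℍ → MulAction.orbitRel.Quotient (Gamma0 N) ℍ := Quotient.mk'' with hm
  have hmout (o) : m (Quotient.out o) = o := Quotient.out_eq' o
  have horb {z w : ℍ} (h : m z = m w) : ∃ δ : Gamma0 N, δ • w = z :=
    MulAction.orbitRel_apply.mp (Quotient.eq''.mp h)
  have hmsmul (δ : Gamma0 N) (z : ℍ) : m (δ • z) = m z :=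
    Quotient.eq''.mpr (MulAction.orbitRel_apply.mpr ⟨δ, rfl⟩)
  have hφm (z : ℍ) : φ z = φ (m z).out := by
    obtain ⟨δ, hδ⟩ := horb (hmout (m z))
    rw [← hδ]
    exact (hφ δ δ.2 z).symm
  have hfiber (o : MulAction.orbitRel.Quotient (Gamma0 N) ℍ) (ho : φ o.out ≠ 0) :
      2 * ∑ z ∈ T with m z = o, x' z = 1 / stabOrder N o.out := by
    -- A `finsum` with infinite support is `0` by default, which contradicts the value `1`.
    have hTS : (Function.support fun δ : Gamma0 N ↦ x' (δ • o.out)).Finite := by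
      by_contra h
      have := hone o.out ho
      rw [finsum_of_infinite_support h] at this
      exact zero_ne_one this
    have h1 := sum_orbit_fiberwise (G := Gamma0 N) (x := x') o.out
      (T := {z ∈ T | m z = o}) (S := hTS.toFinset) ?_ ?_ ?_
    · have h2 := hone o.out ho
      rw [finsum_eq_sum_of_forall (T := hTS.toFinset) (fun δ hδ ↦ by simpa using hδ), h1,
        card_stabilizer] at h2
      have h3 : (stabOrder N o.out : ℂ) ≠ 0 := by exact_mod_cast stabOrder_ne_zero N _
      rw [eq_div_iff h3, ← h2]
      push_cast
      ring
    · intro z hz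
      refine horb ?_
      rw [hmout, (Finset.mem_filter.mp hz).2]
    · intro δ hδ
      refine Finset.mem_filter.mpr ⟨(hTmem _).mpr ⟨hxsupp _ hδ, ?_⟩, by rw [hmsmul, hmout]⟩
      have := hφ δ δ.2 o.out
      rw [← this] at ho
      exact ho
    · intro δ
      simp
  rw [hR, finsum_eq_sum_of_forall (T := T.image m), Finset.mul_sum,
    ← Finset.sum_fiberwise_of_maps_to (g := m) (t := T.image m)
      fun z hz ↦ Finset.mem_image_of_mem m hz]
  · refine Finset.sum_congr rfl fun o ho ↦ ?_
    obtain ⟨z, hz, rfl⟩ := Finset.mem_image.mp ho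
    have hz0 : φ (m z).out ≠ 0 := by
      rw [← hφm]
      exact ((hTmem z).mp hz).2
    rw [Finset.sum_congr rfl (g := fun w ↦ 2 * x' w * φ (m z).out) fun w hw ↦ by
      rw [hφm w, (Finset.mem_filter.mp hw).2, mul_assoc], ← Finset.sum_mul, ← Finset.mul_sum,
      hfiber _ hz0]
    ring
  · intro o ho
    have ho : φ o.out ≠ 0 := fun h ↦ ho (by simp [h])
    have h1 := hfiber o ho
    have h2 : ∑ z ∈ T with m z = o, x' z ≠ 0 := by
      intro h
      rw [h, mul_zero, eq_comm, one_div, inv_eq_zero] at h1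
      exact stabOrder_ne_zero N _ (by exact_mod_cast h1)
    obtain ⟨z, hz, -⟩ := Finset.exists_ne_zero_of_sum_ne_zero h2
    exact Finset.mem_image.mpr ⟨z, (Finset.mem_filter.mp hz).1, (Finset.mem_filter.mp hz).2⟩

end RohrlichDivisor

end

noncomputable section

namespace RohrlichDivisor

/-! ### Cusps and cosets -/

lemma eq_T_zpow_or_neg {γ : SL(2, ℤ)} (h : γ 1 0 = 0) :
    ∃ n : ℤ, γ = ModularGroup.T ^ n ∨ γ = -ModularGroup.T ^ n := by
  have hdet := Matrix.det_fin_two γ.1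
  rw [γ.2, h, mul_zero, sub_zero] at hdet
  rcases Int.eq_one_or_neg_one_of_mul_eq_one' hdet.symm with ⟨h1, h2⟩ | ⟨h1, h2⟩
  · refine ⟨γ 0 1, Or.inl ?_⟩
    ext i j
    rw [ModularGroup.coe_T_zpow]
    fin_cases i <;> fin_cases j <;> simp [h, h1, h2]
  · refine ⟨-γ 0 1, Or.inr ?_⟩
    ext i j
    rw [Matrix.SpecialLinearGroup.coe_neg, ModularGroup.coe_T_zpow]
    fin_cases i <;> fin_cases j <;> simp [h, h1, h2]

lemma T_zpow_apply_one_zero (n : ℤ) : (ModularGroup.T ^ n) 1 0 = 0 := by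
  rw [ModularGroup.coe_T_zpow]
  simp

lemma cuspOf_mul (δ σ : SL(2, ℤ)) :
    cuspOf (δ * σ) = Matrix.SpecialLinearGroup.mapGL ℚ δ • cuspOf σ := by
  rw [cuspOf, cuspOf, map_mul, mul_smul]

lemma cuspOf_eq_infty_iff {γ : SL(2, ℤ)} : cuspOf γ = OnePoint.infty ↔ γ 1 0 = 0 := by
  rw [cuspOf, OnePoint.smul_infty_eq_self_iff]
  simp

lemma cuspOf_eq_iff {σ σ' : SL(2, ℤ)} : cuspOf σ = cuspOf σ' ↔ (σ⁻¹ * σ') 1 0 = 0 := by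
  rw [← cuspOf_eq_infty_iff, cuspOf_mul, map_inv, inv_smul_eq_iff, eq_comm]
  rfl

lemma cuspOf_mul_T_zpow (σ : SL(2, ℤ)) (n : ℤ) :
    cuspOf (σ * ModularGroup.T ^ n) = cuspOf σ := by
  rw [eq_comm, cuspOf_eq_iff]
  simp only [inv_mul_cancel_left]
  exact T_zpow_apply_one_zero n

lemma cuspClassOf_eq_iff {N : ℕ} {σ σ' : SL(2, ℤ)} :
    cuspClassOf N σ = cuspClassOf N σ' ↔ ∃ δ ∈ Gamma0 N, cuspOf (δ * σ') = cuspOf σ := by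
  rw [cuspClassOf, cuspClassOf, Quotient.eq, MulAction.orbitRel_apply]
  constructor
  · rintro ⟨⟨_, δ, hδ, rfl⟩, h⟩
    exact ⟨δ, hδ, (cuspOf_mul δ σ').trans h⟩
  · rintro ⟨δ, hδ, h⟩
    exact ⟨⟨_, δ, hδ, rfl⟩, (cuspOf_mul δ σ').symm.trans h⟩

section Width

variable {N : ℕ} [NeZero N] (σ : SL(2, ℤ))

/-- Finite index puts some positive power of `σ T σ⁻¹` into `Γ₀(N)`, so the infimum is over a
nonempty set and is attained. -/
lemma cuspWidth_spec : 0 < cuspWidth N σ ∧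
    σ * ModularGroup.T ^ cuspWidth N σ * σ⁻¹ ∈ Gamma0 N := by
  have h : {n : ℕ | 0 < n ∧ σ * ModularGroup.T ^ n * σ⁻¹ ∈ Gamma0 N}.Nonempty := by
    obtain ⟨n, hn, -, hmem⟩ := Subgroup.exists_pow_mem_of_index_ne_zero
      (Subgroup.FiniteIndex.index_ne_zero (H := Gamma0 N)) (σ * ModularGroup.T * σ⁻¹)
    exact ⟨n, hn, by rwa [conj_pow] at hmem⟩
  exact Nat.sInf_mem h

/-- Division with remainder: a nonzero remainder would contradict the minimality of the width. -/
lemma conj_T_zpow_mem_iff (n : ℤ) :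
    σ * ModularGroup.T ^ n * σ⁻¹ ∈ Gamma0 N ↔ (cuspWidth N σ : ℤ) ∣ n := by
  obtain ⟨h0, h1⟩ := cuspWidth_spec (N := N) σ
  have hmul (m : ℤ) : σ * ModularGroup.T ^ ((cuspWidth N σ : ℤ) * m) * σ⁻¹ ∈ Gamma0 N := by
    rw [zpow_mul, ← conj_zpow, zpow_natCast]
    exact zpow_mem h1 m
  constructor
  · intro h
    by_contra hd
    have h2 : σ * ModularGroup.T ^ (n % (cuspWidth N σ : ℤ)) * σ⁻¹ ∈ Gamma0 N := by
      have h3 := mul_mem h (inv_mem (hmul (n / (cuspWidth N σ : ℤ))))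
      have h4 : n % (cuspWidth N σ : ℤ) = n + -((cuspWidth N σ : ℤ) * (n / (cuspWidth N σ : ℤ))) := by
        have := Int.emod_add_mul_ediv n (cuspWidth N σ : ℤ)
        linarith
      rw [h4, zpow_add, zpow_neg]
      simpa [mul_assoc] using h3
    have hpos : 0 < n % (cuspWidth N σ : ℤ) :=
      lt_of_le_of_ne (Int.emod_nonneg _ (by omega)) fun h ↦ hd (Int.dvd_of_emod_eq_zero h.symm)
    have hlt : n % (cuspWidth N σ : ℤ) < cuspWidth N σ := Int.emod_lt_of_pos _ (by omega)
    obtain ⟨m, hm⟩ := Int.eq_ofNat_of_zero_le hpos.le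
    rw [hm] at h2 hpos hlt
    have h5 : cuspWidth N σ ≤ m :=
      Nat.sInf_le ⟨by exact_mod_cast hpos, by simpa only [zpow_natCast] using h2⟩
    have : (m : ℤ) < cuspWidth N σ := hlt
    omega
  · rintro ⟨m, rfl⟩
    exact hmul m

end Width

/-- The decomposition of `SL(2, ℤ)` into the cosets `Γ₀(N) σ_ρ T^n` with `0 ≤ n < ℓ_ρ`. The
stabilizer of `i∞` consists of the `± T^n`; the sign is absorbed by `-1 ∈ Γ₀(N)`, and `n` matters
modulo the width only. -/
lemma bijective_cusps {N : ℕ} [NeZero N] {σ : CuspClass N → SL(2, ℤ)}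
    (hσ : ∀ ρ, cuspClassOf N (σ ρ) = ρ) :
    Function.Bijective fun p : (Σ ρ : CuspClass N, Fin (cuspWidth N (σ ρ))) ↦
      (((σ p.1 * ModularGroup.T ^ (p.2 : ℕ))⁻¹ : SL(2, ℤ)) : SL(2, ℤ) ⧸ Gamma0 N) := by
  constructor
  · rintro ⟨ρ, n⟩ ⟨ρ', n'⟩ h
    have h1 : σ ρ * ModularGroup.T ^ (n : ℕ) * (σ ρ' * ModularGroup.T ^ (n' : ℕ))⁻¹ ∈ Gamma0 N := by
      simpa using QuotientGroup.eq.mp h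
    have h2 : ρ = ρ' := by
      rw [← hσ ρ, ← hσ ρ', cuspClassOf_eq_iff]
      refine ⟨_, h1, ?_⟩
      rw [← cuspOf_mul_T_zpow (σ ρ) n, ← cuspOf_mul_T_zpow _ (n' : ℤ)]
      simp [mul_assoc]
    subst h2
    have h3 : σ ρ * ModularGroup.T ^ ((n : ℤ) - (n' : ℤ)) * (σ ρ)⁻¹ ∈ Gamma0 N := by
      rw [zpow_sub]
      simpa [mul_assoc] using h1
    rw [conj_T_zpow_mem_iff] at h3
    have h4 : (n : ℤ) = n' := by
      obtain ⟨c, hc⟩ := h3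
      have ha := n.2
      have hb := n'.2
      by_contra hne
      have hc0 : c ≠ 0 := by
        rintro rfl
        omega
      have : (cuspWidth N (σ ρ) : ℤ) ≤ |(n : ℤ) - n'| := by
        rw [hc, abs_mul]
        have := Int.one_le_abs hc0
        nlinarith [abs_of_nonneg (Int.natCast_nonneg (cuspWidth N (σ ρ)))]
      rw [le_abs] at this
      omega
    congr
    exact Fin.ext (by exact_mod_cast h4)
  · intro q
    obtain ⟨γ, rfl⟩ := QuotientGroup.mk_surjective q
    obtain ⟨γ, rfl⟩ : ∃ γ', γ = γ'⁻¹ := ⟨γ⁻¹, by simp⟩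
    obtain ⟨δ, hδ, h⟩ := cuspClassOf_eq_iff.mp (hσ (cuspClassOf N γ)).symm
    set s := σ (cuspClassOf N γ) with hs
    obtain ⟨m, hm⟩ := eq_T_zpow_or_neg (cuspOf_eq_iff.mp h)
    have hw := (cuspWidth_spec (N := N) s).1
    have hm' : ∃ δ' ∈ Gamma0 N, γ = δ' * s * ModularGroup.T ^ m := by
      rcases hm with hm | hm
      · exact ⟨δ, hδ, by rw [← hm]; group⟩
      · refine ⟨-1 * δ, mul_mem (neg_one_mem_Gamma0 N) hδ, ?_⟩
        rw [inv_mul_eq_iff_eq_mul] at hm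
        rw [hm]
        simp [mul_assoc]
    obtain ⟨δ', hδ', hγ⟩ := hm'
    obtain ⟨r, hr⟩ := Int.eq_ofNat_of_zero_le (Int.emod_nonneg m (b := cuspWidth N s) (by omega))
    have hr' : r < cuspWidth N s := by
      have := Int.emod_lt_of_pos m (b := cuspWidth N s) (by omega)
      rw [hr] at this
      exact_mod_cast this
    refine ⟨⟨cuspClassOf N γ, ⟨r, hr'⟩⟩, ?_⟩
    rw [QuotientGroup.eq]
    have h5 : s * ModularGroup.T ^ ((r : ℤ) - m) * s⁻¹ ∈ Gamma0 N := by
      rw [conj_T_zpow_mem_iff, ← dvd_neg, neg_sub]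
      have : (r : ℤ) = m % (cuspWidth N s : ℤ) := hr.symm
      rw [this]
      exact Int.dvd_self_sub_emod
    have h6 := mul_mem h5 (inv_mem hδ')
    have h7 : γ⁻¹ = ModularGroup.T ^ (-m) * s⁻¹ * δ'⁻¹ := by
      have := congrArg (fun e : SL(2, ℤ) ↦ e⁻¹) hγ
      simpa [mul_assoc] using this
    have h8 : s * ModularGroup.T ^ (r : ℕ) * γ⁻¹ =
        s * ModularGroup.T ^ ((r : ℤ) - m) * s⁻¹ * δ'⁻¹ := by
      rw [h7, zpow_sub, zpow_neg, zpow_natCast]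
      simp only [mul_assoc]
    rw [inv_inv]
    exact h8 ▸ h6

lemma finite_cuspClass {N : ℕ} [NeZero N] {σ : CuspClass N → SL(2, ℤ)}
    (hσ : ∀ ρ, cuspClassOf N (σ ρ) = ρ) : Finite (CuspClass N) := by
  refine Finite.of_injective (β := SL(2, ℤ) ⧸ Gamma0 N)
    (fun ρ ↦ (((σ ρ * ModularGroup.T ^ 0)⁻¹ : SL(2, ℤ)) : SL(2, ℤ) ⧸ Gamma0 N)) fun ρ ρ' h ↦ ?_
  have := (bijective_cusps hσ).1 (a₁ := ⟨ρ, ⟨0, (cuspWidth_spec _).1⟩⟩)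
    (a₂ := ⟨ρ', ⟨0, (cuspWidth_spec _).1⟩⟩) h
  exact congrArg Sigma.fst this

lemma sum_cosets_eq_sum_cusps {N : ℕ} [NeZero N] [Fintype (SL(2, ℤ) ⧸ Gamma0 N)]
    [Fintype (CuspClass N)] {σ : CuspClass N → SL(2, ℤ)}
    (hσ : ∀ ρ, cuspClassOf N (σ ρ) = ρ) {M : Type*} [AddCommMonoid M] {c : SL(2, ℤ) → M}
    (hc : ∀ δ ∈ Gamma0 N, ∀ γ, c (δ * γ) = c γ) :
    ∑ q : SL(2, ℤ) ⧸ Gamma0 N, c (q.out)⁻¹ =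
      ∑ ρ, ∑ n ∈ Finset.range (cuspWidth N (σ ρ)), c (σ ρ * ModularGroup.T ^ n) := by
  simp_rw [Finset.sum_range]
  rw [← Fintype.sum_sigma']
  refine (Fintype.sum_bijective _ (bijective_cusps hσ) _ _ fun p ↦ ?_).symm
  rw [apply_eq_apply_out hc]

end RohrlichDivisor

end

noncomputable section

namespace RohrlichDivisor

/-! ### Integrals along horizontal lines -/

/-- At height at least `2` an element with `c ≠ 0` lands at height at most `1/2`, outside the
support of `X`. Only `± T^n` remain, and the two signs act alike; hence `1/2`. -/
lemma finsum_translates {X : ℂ → ℝ} (hX : ∀ τ : ℍ, X τ ≠ 0 → 1 / 2 < τ.im) {τ : ℍ}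
    (hτ : 2 ≤ τ.im) (hsum : ∑ᶠ γ : SL(2, ℤ), X ((γ • τ : ℍ) : ℂ) = 1) :
    ∑ᶠ n : ℤ, X ((τ : ℂ) + n) = 1 / 2 := by
  set h : Bool × ℤ → SL(2, ℤ) := fun p ↦ bif p.1 then ModularGroup.T ^ p.2
    else -ModularGroup.T ^ p.2 with hh
  have hsmul (p : Bool × ℤ) : (((h p) • τ : ℍ) : ℂ) = (τ : ℂ) + p.2 := by
    rcases p with ⟨b, n⟩
    have hT := ModularGroup.coe_T_zpow_smul_eq τ (n := n)
    rcases b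
    · simp only [hh, cond_false]
      rw [ModularGroup.SL_neg_smul, hT]
    · simpa only [hh, cond_true] using hT
  have hinj : Function.Injective h := by
    rintro ⟨b, n⟩ ⟨b', n'⟩ hp
    have hn : n = n' := by
      have h1 := hsmul (b, n)
      rw [hp, hsmul (b', n')] at h1
      have h2 := add_left_cancel h1
      exact_mod_cast h2.symm
    subst hn
    have hb : ∀ m : ℤ, ModularGroup.T ^ m ≠ -ModularGroup.T ^ m := fun m hm ↦ by
      have := congrArg (fun e : SL(2, ℤ) ↦ e 0 0) hm
      simp only [Matrix.SpecialLinearGroup.coe_neg, ModularGroup.coe_T_zpow] at this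
      norm_num at this
    rcases b <;> rcases b' <;> simp only [hh, cond_true, cond_false] at hp ⊢
    · exact absurd hp.symm (hb n)
    · exact absurd hp (hb n)
  have hrange : Function.support (fun γ : SL(2, ℤ) ↦ X ((γ • τ : ℍ) : ℂ)) ⊆ Set.range h := by
    intro γ hγ
    have h1 := hX _ hγ
    have h2 : γ 1 0 = 0 := by
      by_contra h0
      have h3 := im_smul_le_inv h0 τ
      have h4 : τ.im⁻¹ ≤ 2⁻¹ := by gcongr
      linarith
    obtain ⟨n, hn | hn⟩ := eq_T_zpow_or_neg h2
    · exact ⟨(true, n), hn.symm⟩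
    · exact ⟨(false, n), hn.symm⟩
  have h1 : ∑ᶠ p : Bool × ℤ, X ((τ : ℂ) + p.2) = 1 := by
    have h2 : ∑ᶠ γ ∈ Set.range h, X ((γ • τ : ℍ) : ℂ) = 1 := by
      rw [← finsum_mem_inter_support, Set.inter_eq_self_of_subset_right hrange, ← hsum,
        finsum_mem_support]
    rw [finsum_mem_range hinj] at h2
    rw [← h2]
    exact finsum_congr fun p ↦ by rw [hsmul]
  have hfin : (Function.support fun p : Bool × ℤ ↦ X ((τ : ℂ) + p.2)).Finite := by
    by_contra hinf
    rw [finsum_of_infinite_support hinf] at h1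
    exact zero_ne_one h1
  rw [finsum_curry _ hfin, finsum_eq_sum_of_fintype, Fintype.sum_bool] at h1
  simp only at h1
  linarith

/-- Cut the line into unit intervals and translate them to `[0, 1]`, where the translates of `Z` add
up to `1/2`. -/
lemma integral_mul_periodic {Z : ℝ → ℝ} (hZ : Continuous Z) (hc : HasCompactSupport Z)
    (hsum : ∀ t, ∑ᶠ n : ℤ, Z (t + n) = 1 / 2) {R : ℝ → ℂ} (hR : Continuous R)
    (hper : Function.Periodic R 1) :
    ∫ t, (Z t : ℂ) * R t = 1 / 2 * ∫ t in (0 : ℝ)..1, R t := by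
  obtain ⟨r, hr⟩ := hc.isBounded.subset_closedBall (0 : ℝ)
  -- The margin `1` ensures that for `t ∈ [0, 1]` every `n` with `Z (t + n) ≠ 0` lies in `[-m, m)`,
  -- both endpoints of the unit interval included.
  obtain ⟨m, hm⟩ := exists_nat_ge (r + 1)
  have hsupp (t : ℝ) (ht : Z t ≠ 0) : |t| ≤ m - 1 := by
    have := hr (subset_tsupport Z ht)
    rw [Metric.mem_closedBall, dist_zero_right, Real.norm_eq_abs] at this
    linarith
  have hcont : Continuous fun t ↦ (Z t : ℂ) * R t := by fun_prop
  have h1 : ∫ t, (Z t : ℂ) * R t = ∫ t in (-m : ℝ)..m, (Z t : ℂ) * R t := by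
    rw [intervalIntegral.integral_of_le (by linarith [Nat.cast_nonneg (α := ℝ) m])]
    refine (setIntegral_eq_integral_of_forall_compl_eq_zero fun t ht ↦ ?_).symm
    by_cases h0 : Z t = 0
    · simp [h0]
    · have := abs_le.mp (hsupp t h0)
      exact absurd ⟨by linarith, by linarith⟩ ht
  have h2 := intervalIntegral.sum_integral_adjacent_intervals (μ := volume)
    (f := fun t ↦ (Z t : ℂ) * R t) (a := fun i : ℕ ↦ -(m : ℝ) + i) (n := 2 * m)
    fun i _ ↦ hcont.intervalIntegrable _ _
  have h3 (i : ℕ) : ∫ t in (-(m : ℝ) + i)..(-(m : ℝ) + (i + 1 : ℕ)), (Z t : ℂ) * R t =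
      ∫ t in (0 : ℝ)..1, (Z (t + (-(m : ℝ) + i)) : ℂ) * R t := by
    have h4 := intervalIntegral.integral_comp_add_right (a := 0) (b := 1)
      (fun t ↦ (Z t : ℂ) * R t) (-(m : ℝ) + i)
    rw [zero_add, show (1 : ℝ) + (-(m : ℝ) + i) = -(m : ℝ) + (i + 1 : ℕ) by push_cast; ring] at h4
    rw [← h4]
    refine intervalIntegral.integral_congr fun t _ ↦ ?_
    have h5 : R (t + (-(m : ℝ) + i)) = R t := by
      have := hper.int_mul ((-(m : ℤ)) + i) t
      simpa using this
    simp only [h5]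
  have h6 : ∀ t ∈ Set.Icc (0 : ℝ) 1, ∑ i ∈ Finset.range (2 * m), Z (t + (-(m : ℝ) + i)) = 1 / 2 := by
    intro t ht
    have hinj : Set.InjOn (fun i : ℕ ↦ -(m : ℤ) + (i : ℤ)) (Finset.range (2 * m)) :=
      fun a _ b _ hab ↦ by simpa using hab
    rw [← hsum t, finsum_eq_sum_of_forall (T := (Finset.range (2 * m)).image
      fun i : ℕ ↦ -(m : ℤ) + (i : ℤ)), Finset.sum_image hinj]
    · refine Finset.sum_congr rfl fun i _ ↦ ?_
      push_cast
      rfl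
    · intro n hn
      have h7 := abs_le.mp (hsupp _ hn)
      have h8 : -(m : ℤ) ≤ n := by
        have : (-(m : ℝ)) ≤ n := by linarith [ht.2]
        exact_mod_cast this
      have h9 : n < m := by
        have : (n : ℝ) < m := by linarith [ht.1]
        exact_mod_cast this
      refine Finset.mem_image.mpr ⟨(n + m).toNat, ?_, ?_⟩
      · rw [Finset.mem_range]
        omega
      · omega
  rw [h1]
  simp only [Nat.cast_zero, add_zero] at h2
  rw [show -(m : ℝ) + ((2 * m : ℕ) : ℝ) = m by push_cast; ring] at h2
  rw [← h2, Finset.sum_congr rfl fun i _ ↦ h3 i, ← intervalIntegral.integral_finsetSum,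
    ← intervalIntegral.integral_const_mul]
  · refine intervalIntegral.integral_congr fun t ht ↦ ?_
    rw [Set.uIcc_of_le zero_le_one] at ht
    rw [← Finset.sum_mul]
    congr 1
    have := h6 t ht
    rw [← ofReal_sum, this]
    push_cast
    rfl
  · intro i _
    exact Continuous.intervalIntegrable (by fun_prop) _ _

/-- The sum of `Q(t + n)` over `0 ≤ n < ℓ` has period `1`, since a unit shift permutes the residues
modulo `ℓ`. Its integral over `[0, 1]` is that of `Q` over `[0, ℓ]`. -/
lemma sum_integral_translates {Z : ℝ → ℝ} (hZ : Continuous Z) (hc : HasCompactSupport Z)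
    (hsum : ∀ t, ∑ᶠ n : ℤ, Z (t + n) = 1 / 2) {Q : ℝ → ℂ} (hQ : Continuous Q) {ℓ : ℕ}
    (hper : Function.Periodic Q ℓ) :
    ∑ n ∈ Finset.range ℓ, ∫ t, (Z t : ℂ) * Q (t + n) = 1 / 2 * ∫ t in (0 : ℝ)..ℓ, Q t := by
  have hRper : Function.Periodic (fun t ↦ ∑ n ∈ Finset.range ℓ, Q (t + n)) 1 := fun t ↦ by
    have h1 := Finset.sum_range_succ (fun n : ℕ ↦ Q (t + n)) ℓ
    have h2 := Finset.sum_range_succ' (fun n : ℕ ↦ Q (t + n)) ℓ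
    rw [h1] at h2
    simp only [hper t, Nat.cast_zero, add_zero, add_left_inj] at h2
    simp only
    rw [h2]
    refine Finset.sum_congr rfl fun n _ ↦ ?_
    congr 1
    push_cast
    ring
  have h3 := integral_mul_periodic hZ hc hsum (R := fun t ↦ ∑ n ∈ Finset.range ℓ, Q (t + n))
    (by fun_prop) hRper
  have h4 (n : ℕ) : Integrable fun t ↦ (Z t : ℂ) * Q (t + n) :=
    Continuous.integrable_of_hasCompactSupport (by fun_prop)
      (hc.comp_left (g := ofReal) ofReal_zero).mul_right
  rw [← integral_finsetSum _ fun n _ ↦ h4 n]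
  simp_rw [← Finset.mul_sum]
  rw [h3, intervalIntegral.integral_finsetSum]
  · congr 1
    have h5 := intervalIntegral.sum_integral_adjacent_intervals (μ := volume)
      (f := Q) (a := fun i : ℕ ↦ (i : ℝ)) (n := ℓ) fun i _ ↦ hQ.intervalIntegrable _ _
    rw [Nat.cast_zero] at h5
    rw [← h5]
    refine Finset.sum_congr rfl fun n _ ↦ ?_
    rw [intervalIntegral.integral_comp_add_right, zero_add]
    push_cast
    rw [add_comm]
  · intro n _
    exact Continuous.intervalIntegrable (by fun_prop) _ _

end RohrlichDivisor

end

noncomputable section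

namespace RohrlichDivisor

/-! ### Boundary terms -/

lemma T_zpow_smul_ofComplex {y : ℝ} (hy : 0 < y) (n : ℤ) (t : ℝ) :
    ModularGroup.T ^ n • ofComplex ((t : ℂ) + y * I) =
      ofComplex (((t + n : ℝ) : ℂ) + y * I) := by
  apply UpperHalfPlane.ext
  rw [ModularGroup.coe_T_zpow_smul_eq, coe_ofComplex (horizontal_mem hy _),
    coe_ofComplex (horizontal_mem hy _)]
  push_cast
  ring

lemma horizontal_mem_truncatedPlane {y : ℝ} (hy : 1 ≤ y) (t : ℝ) :
    ofComplex ((t : ℂ) + y * I) ∈ truncatedPlane y := by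
  have h0 : 0 < y := by linarith
  have him : (ofComplex ((t : ℂ) + y * I)).im = y := by
    rw [ofComplex_im (horizontal_mem h0 t)]; simp
  refine mem_truncatedPlane_of_im him.le ?_
  rw [him]
  exact (inv_le_one_of_one_le₀ hy).trans hy

/-- Integrals over a horizontal line, weighted by a partition of unity and summed over cosets,
are integrals over the closed horocycles at the cusps. -/
lemma sum_integral_horizontal {N : ℕ} [NeZero N] [Fintype (SL(2, ℤ) ⧸ Gamma0 N)]
    [Fintype (CuspClass N)] {σ : CuspClass N → SL(2, ℤ)}
    (hσ : ∀ ρ, cuspClassOf N (σ ρ) = ρ) {X : ℂ → ℝ} (hX : Continuous X)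
    (hc : HasCompactSupport X) (hXim : ∀ τ : ℍ, X τ ≠ 0 → 1 / 2 < τ.im) {y : ℝ} (hy : 2 ≤ y)
    (hsum : ∀ τ ∈ truncatedPlane y, ∑ᶠ γ : SL(2, ℤ), X ((γ • τ : ℍ) : ℂ) = 1)
    {c : SL(2, ℤ) → ℍ → ℂ} (hcΓ : ∀ δ ∈ Gamma0 N, ∀ γ, c (δ * γ) = c γ)
    (hcT : ∀ γ (n : ℤ) (t : ℝ), c (γ * ModularGroup.T ^ n) (ofComplex ((t : ℂ) + y * I)) =
      c γ (ModularGroup.T ^ n • ofComplex ((t : ℂ) + y * I)))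
    (hcc : ∀ γ, Continuous fun t : ℝ ↦ c γ (ofComplex ((t : ℂ) + y * I))) :
    ∑ q : SL(2, ℤ) ⧸ Gamma0 N,
        ∫ t : ℝ, (X (t + y * I) : ℂ) * c (q.out)⁻¹ (ofComplex ((t : ℂ) + y * I)) =
      1 / 2 * ∑ ρ, horizontalIntegral (cuspWidth N (σ ρ)) (c (σ ρ)) y := by
  have h0 : 0 < y := by linarith
  have hemb : Topology.IsClosedEmbedding fun t : ℝ ↦ (t : ℂ) + y * I :=
    (Homeomorph.addRight ((y : ℂ) * I)).isClosedEmbedding.comp isometry_ofReal.isClosedEmbedding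
  rw [sum_cosets_eq_sum_cusps hσ
    (c := fun γ ↦ ∫ t : ℝ, (X (t + y * I) : ℂ) * c γ (ofComplex ((t : ℂ) + y * I)))
    (fun δ hδ γ ↦ by simp only [hcΓ δ hδ]), Finset.mul_sum]
  refine Finset.sum_congr rfl fun ρ _ ↦ ?_
  have hsumZ : ∀ t : ℝ, ∑ᶠ n : ℤ, X (((t + n : ℝ) : ℂ) + y * I) = 1 / 2 := fun t ↦ by
    rw [← finsum_translates hXim (τ := ofComplex ((t : ℂ) + y * I)) ?_
      (hsum _ (horizontal_mem_truncatedPlane (by linarith) t)), coe_ofComplex (horizontal_mem h0 t)]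
    · refine finsum_congr fun n ↦ ?_
      congr 1
      push_cast
      ring
    · rw [ofComplex_im (horizontal_mem h0 t)]
      simpa using hy
  rw [horizontalIntegral, ← sum_integral_translates (Z := fun t ↦ X (t + y * I))
    (hX.comp hemb.continuous) (hc.comp_isClosedEmbedding hemb) hsumZ (hcc (σ ρ)) ?_]
  · refine Finset.sum_congr rfl fun n _ ↦ ?_
    congr 1 with t
    have h1 := hcT (σ ρ) n t
    rw [zpow_natCast] at h1
    rw [h1, ← zpow_natCast, T_zpow_smul_ofComplex h0]
    simp
  · intro t
    have h1 := hcT (σ ρ) (cuspWidth N (σ ρ)) t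
    rw [T_zpow_smul_ofComplex h0] at h1
    -- Translation by the width is conjugated by `σ_ρ` into `Γ₀(N)`, under which `c` is left
    -- invariant: the integrand has the width as a period.
    have h2 : σ ρ * ModularGroup.T ^ (cuspWidth N (σ ρ) : ℤ) =
        (σ ρ * ModularGroup.T ^ cuspWidth N (σ ρ) * (σ ρ)⁻¹) * σ ρ := by simp
    rw [h2, hcΓ _ (cuspWidth_spec _).2] at h1
    simpa using h1.symm

lemma slash_T_zpow_apply (φ : ℍ → ℂ) (m n : ℤ) (τ : ℍ) :
    (φ ∣[m] (ModularGroup.T ^ n : SL(2, ℤ))) τ = φ (ModularGroup.T ^ n • τ) := by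
  have hd : denom (ModularGroup.T ^ n : SL(2, ℤ)) (τ : ℂ) = 1 := by
    rw [ModularGroup.denom_apply, ModularGroup.coe_T_zpow]
    simp
  rw [ModularForm.SL_slash_apply]
  erw [hd]
  simp

end RohrlichDivisor

end

noncomputable section

namespace RohrlichDivisor

/-! ### Zeros and poles -/

lemma slash_apply_ne_zero_iff (k : ℤ) (f : ℍ → ℂ) (γ : SL(2, ℤ)) (τ : ℍ) :
    (f ∣[k] γ) τ ≠ 0 ↔ f (γ • τ) ≠ 0 := by
  rw [ModularForm.SL_slash_apply]
  exact mul_ne_zero_iff_right (zpow_ne_zero _ (denom_ne γ τ))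

lemma IsNonzeroMeromorphic.finite_zeros {f : ℍ → ℂ} (hf : IsNonzeroMeromorphic f) {K : Set ℍ}
    (hK : IsCompact K) : {τ ∈ K | f τ = 0}.Finite := by
  obtain ⟨W, s, g, hKW, -, -, -, -, hW⟩ := hf.exists_isFactoredOn
    (hK.image UpperHalfPlane.continuous_coe) (by rintro _ ⟨τ, -, rfl⟩; exact τ.im_pos)
  refine (s.finite_toSet.preimage (fun _ _ _ _ h ↦ UpperHalfPlane.ext h)).subset fun τ hτ ↦ ?_
  by_contra h
  refine hW.apply_ne_zero (hKW ⟨τ, hτ.1, rfl⟩) h ?_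
  simpa using hτ.2

instance : NullSingletonClass (volume : Measure ℍ) where
  measure_singleton z := by
    rw [UpperHalfPlane.volume_def]
    refine withDensity_absolutelyContinuous _ _ ?_
    rw [measurableEmbedding_coe.comap_apply, Set.image_singleton]
    exact measure_singleton _

/-- The zeros and poles are finite in number on each set of a compact exhaustion, hence countable,
and the group is countable too. -/
lemma IsNonzeroMeromorphic.ae_ne_zero {f : ℍ → ℂ} (hf : IsNonzeroMeromorphic f) :
    ∀ᵐ τ : ℍ, ∀ γ : SL(2, ℤ), f (γ • τ) ≠ 0 := by
  refine ae_smul_notMem (s := {τ | f τ = 0}) ?_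
  have h : {τ | f τ = 0} ⊆ ⋃ n, {τ ∈ compactCovering ℍ n | f τ = 0} := fun τ hτ ↦ by
    obtain ⟨n, hn⟩ := exists_mem_compactCovering τ
    exact Set.mem_iUnion.2 ⟨n, hn, hτ⟩
  exact (((Set.countable_iUnion fun n ↦
    (hf.finite_zeros (isCompact_compactCovering ℍ n)).countable).mono h)).measure_zero _

lemma IsNonzeroMeromorphic.ordAt_eq_zero {f : ℍ → ℂ} (hf : IsNonzeroMeromorphic f) {τ : ℍ}
    (h : f τ ≠ 0) : ordAt f τ = 0 := by
  have ha := hf.analyticAt τ.im_pos (by simpa using h)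
  have h0 : analyticOrderAt (f ∘ ofComplex) (τ : ℂ) = 0 := by
    rw [ha.analyticOrderAt_eq_zero]; simpa using h
  rw [ordAt, ha.meromorphicOrderAt_eq, h0]
  rfl

/-- If `γ` moved `z` above height `y`, then `f ∣ γ⁻¹` would vanish at `γz`. Through the convention
at poles this confines both the zeros and the poles of `f`. -/
lemma mem_truncatedPlane_of_eq_zero {k : ℤ} {f : ℍ → ℂ} {y : ℝ}
    (hfy : ∀ (γ : SL(2, ℤ)) (τ : ℍ), y ≤ τ.im → (f ∣[k] γ) τ ≠ 0) {z : ℍ} (hz : f z = 0) :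
    z ∈ truncatedPlane y := fun γ ↦ by
  by_contra! h
  refine (slash_apply_ne_zero_iff k f γ⁻¹ (γ • z)).mp (hfy _ _ h.le) ?_
  rwa [inv_smul_smul]

/-! ### Integrability of the terms in Green's formula -/

lemma coe_preimage_tsupport {X : ℂ → ℝ} (hc : HasCompactSupport X)
    (hXV : tsupport X ⊆ upperHalfPlaneSet) : IsCompact (UpperHalfPlane.coe ⁻¹' tsupport X) :=
  isCompact_preimage_coe hc hXV

lemma continuous_dbar_coe {X : ℂ → ℝ} (hX : ContDiff ℝ ∞ X) :
    Continuous fun τ : ℍ ↦ dbar (fun τ ↦ (X τ : ℂ)) τ := by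
  have h1 : ContDiff ℝ ∞ (fun w ↦ (X w : ℂ)) := ofRealCLM.contDiff.comp hX
  have h2 := (contDiffOn_dbarC isOpen_univ h1.contDiffOn).continuousOn
  rw [continuousOn_univ] at h2
  simp only [dbar_coe (fun w ↦ (X w : ℂ))]
  exact h2.comp UpperHalfPlane.continuous_coe

lemma continuous_im_sq_mul_dbar {X : ℂ → ℝ} (hX : ContDiff ℝ ∞ X) :
    Continuous fun τ : ℍ ↦ (τ.im : ℂ) ^ 2 * dbar (fun τ ↦ (X τ : ℂ)) τ :=
  ((continuous_ofReal.comp UpperHalfPlane.continuous_im).pow 2).mul (continuous_dbar_coe hX)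

lemma dbar_coe_eq_zero {X : ℂ → ℝ} {τ : ℍ} (h : ∀ᶠ w in 𝓝 (τ : ℂ), X w = 0) :
    dbar (fun τ ↦ (X τ : ℂ)) τ = 0 := by
  have h1 : (fun τ : ℍ ↦ (X τ : ℂ)) ∘ ofComplex =ᶠ[𝓝 (τ : ℂ)] fun _ ↦ 0 := by
    filter_upwards [h, isOpen_upperHalfPlaneSet.mem_nhds τ.im_pos] with w hw hwV
    simp [coe_ofComplex hwV, hw]
  rw [dbar, h1.fderiv_eq]
  simp

lemma dbar_coe_eq_zero_of_im_lt {X : ℂ → ℝ} (hXim : ∀ τ : ℍ, X τ ≠ 0 → 1 / 2 < τ.im) {τ : ℍ}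
    (h : τ.im < 1 / 2) : dbar (fun τ ↦ (X τ : ℂ)) τ = 0 := by
  refine dbar_coe_eq_zero ?_
  filter_upwards [isOpen_upperHalfPlaneSet.mem_nhds τ.im_pos,
    (isOpen_lt Complex.continuous_im continuous_const).mem_nhds
      (show (τ : ℂ).im < 1 / 2 from h)] with w hw hw2
  lift w to ℍ using hw
  by_contra h'
  exact (hXim w h').not_gt hw2

lemma integrable_of_integrableOn_tsupport {X : ℂ → ℝ} {h : ℍ → ℂ}
    (hi : IntegrableOn h (UpperHalfPlane.coe ⁻¹' tsupport X))
    (h0 : ∀ τ : ℍ, (τ : ℂ) ∉ tsupport X → h τ = 0) : Integrable h :=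
  (integrableOn_iff_integrable_of_support_subset fun τ hτ ↦ by
    by_contra h'; exact hτ (h0 τ h')).mp hi

section Integrable

variable {f g : ℍ → ℂ} (hf : IsNonzeroMeromorphic f) (k : ℤ)
  (hg : ContDiffOn ℝ ∞ (g ∘ ofComplex) upperHalfPlaneSet) {X : ℂ → ℝ} (hX : ContDiff ℝ ∞ X)
  (hc : HasCompactSupport X) (hXV : tsupport X ⊆ upperHalfPlaneSet)

lemma eventually_eq_zero_of_notMem_tsupport {X : ℂ → ℝ} {w : ℂ} (h : w ∉ tsupport X) :
    ∀ᶠ w in 𝓝 w, X w = 0 :=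
  notMem_tsupport_iff_eventuallyEq.mp h

include hf hg hX hc hXV

lemma IsNonzeroMeromorphic.integrable_coe_mul :
    Integrable fun τ : ℍ ↦ (X τ : ℂ) * (xiOp 2 (lapOp 2 g) τ * logNorm k f τ) := by
  refine integrable_of_integrableOn_tsupport (X := X) ?_ fun τ h ↦ by
    simp [image_eq_zero_of_notMem_tsupport h]
  simp_rw [← mul_assoc]
  refine hf.integrableOn_mul_logNorm k (Continuous.mul ?_ ?_) (coe_preimage_tsupport hc hXV)
  · exact continuous_ofReal.comp (hX.continuous.comp UpperHalfPlane.continuous_coe)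
  · exact continuous_of_contDiffOn (contDiffOn_xiOp 2 (contDiffOn_lapOp 2 hg))

lemma IsNonzeroMeromorphic.integrable_dbar_mul_pairing₁ :
    Integrable fun τ : ℍ ↦ (τ.im : ℂ) ^ 2 * dbar (fun τ ↦ (X τ : ℂ)) τ * pairing₁ k f g τ := by
  refine integrable_of_integrableOn_tsupport (X := X) ?_ fun τ h ↦ by
    simp [dbar_coe_eq_zero (eventually_eq_zero_of_notMem_tsupport h)]
  have := hf.integrableOn_mul_logDerivOp k ((continuous_im_sq_mul_dbar hX).mul
    (continuous_of_contDiffOn (contDiffOn_xiOp 2 hg))) (coe_preimage_tsupport hc hXV)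
  refine this.congr (ae_of_all _ fun τ ↦ ?_)
  simp only [pairing₁, Pi.mul_apply]
  ring

lemma IsNonzeroMeromorphic.integrable_dbar_mul_pairing₂ :
    Integrable fun τ : ℍ ↦ (τ.im : ℂ) ^ 2 * dbar (fun τ ↦ (X τ : ℂ)) τ * pairing₂ k f g τ := by
  refine integrable_of_integrableOn_tsupport (X := X) ?_ fun τ h ↦ by
    simp [dbar_coe_eq_zero (eventually_eq_zero_of_notMem_tsupport h)]
  have hcont := continuous_im_sq_mul_dbar hX
  have h1 := hf.integrableOn_mul_logNorm k (hcont.mul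
    (continuous_of_contDiffOn (contDiffOn_lapOp 2 hg))) (coe_preimage_tsupport hc hXV)
  have h2 : IntegrableOn (fun τ : ℍ ↦ (τ.im : ℂ) ^ 2 * dbar (fun τ ↦ (X τ : ℂ)) τ *
      ((k : ℂ) / 2 * g τ)) (UpperHalfPlane.coe ⁻¹' tsupport X) :=
    (hcont.mul (continuous_const.mul (continuous_of_contDiffOn hg))).continuousOn.integrableOn_compact
      (coe_preimage_tsupport hc hXV)
  refine (h1.add h2).congr (ae_of_all _ fun τ ↦ ?_)
  simp only [pairing₂, Pi.add_apply, Pi.mul_apply]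
  ring

end Integrable

/-- Points with `1/2 ≤ Im τ ≤ y` lie in `truncatedPlane y` because `1 / Im τ ≤ 2 ≤ y`. This
exchanges the half plane of Green's formula for the invariant domain needed for unfolding. -/
lemma setIntegral_truncatedPlane {y : ℝ} (hy : 2 ≤ y) {h : ℍ → ℂ}
    (h0 : ∀ τ : ℍ, τ.im < 1 / 2 → h τ = 0) :
    ∫ τ in {τ : ℍ | τ.im ≤ y}, h τ = ∫ τ in truncatedPlane y, h τ := by
  refine setIntegral_eq_of_subset_of_forall_sdiff_eq_zero
    (measurableSet_le UpperHalfPlane.continuous_im.measurable measurable_const)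
    (fun τ hτ ↦ im_le_of_mem_truncatedPlane hτ) fun τ hτ ↦ ?_
  refine h0 τ ?_
  by_contra! h
  refine hτ.2 (mem_truncatedPlane_of_im hτ.1 (le_trans ?_ hy))
  have := inv_anti₀ (by norm_num) h
  simpa using this

end RohrlichDivisor

end

noncomputable section

namespace RohrlichDivisor

/-! ### The formula at a finite height -/

section Identity

variable {N : ℕ} {k : ℤ} {f g : ℍ → ℂ}

lemma slash_mul_eq {m : ℤ} {φ : ℍ → ℂ} (h : ∀ γ ∈ Gamma0 N, φ ∣[m] γ = φ) {δ : SL(2, ℤ)}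
    (hδ : δ ∈ Gamma0 N) (γ : SL(2, ℤ)) : φ ∣[m] (δ * γ) = φ ∣[m] γ := by
  rw [SlashAction.slash_mul, h δ hδ]

lemma IsNonzeroMeromorphic.pairing₁_slash_mul (hf : IsNonzeroMeromorphic f)
    (hg : ContDiffOn ℝ ∞ (g ∘ ofComplex) upperHalfPlaneSet) (γ δ : SL(2, ℤ)) {τ : ℍ}
    (h : (f ∣[k] γ) (δ • τ) ≠ 0) :
    pairing₁ k (f ∣[k] (γ * δ)) (g ∣[(2 : ℤ)] (γ * δ)) τ =
      (pairing₁ k (f ∣[k] γ) (g ∣[(2 : ℤ)] γ) ∣[(2 : ℤ)] δ) τ := by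
  rw [SlashAction.slash_mul, SlashAction.slash_mul,
    (hf.slash k γ).pairing₁_slash k (contDiffOn_slash 2 γ hg) δ h]

lemma pairing₂_slash_mul (hg : ContDiffOn ℝ ∞ (g ∘ ofComplex) upperHalfPlaneSet)
    (γ δ : SL(2, ℤ)) (τ : ℍ) :
    pairing₂ k (f ∣[k] (γ * δ)) (g ∣[(2 : ℤ)] (γ * δ)) τ =
      (pairing₂ k (f ∣[k] γ) (g ∣[(2 : ℤ)] γ) ∣[(2 : ℤ)] δ) τ := by
  rw [SlashAction.slash_mul, SlashAction.slash_mul,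
    pairing₂_slash k (contDiffOn_slash 2 γ hg) δ]

lemma continuous_horizontal {φ : ℍ → ℂ} {y : ℝ}
    (h : ∀ t : ℝ, ContinuousAt (φ ∘ ofComplex) ((t : ℂ) + y * I)) :
    Continuous fun t : ℝ ↦ φ (ofComplex ((t : ℂ) + y * I)) :=
  continuous_iff_continuousAt.2 fun t ↦ ContinuousAt.comp (f := fun t : ℝ ↦ (t : ℂ) + y * I)
    (g := φ ∘ ofComplex) (h t) (by fun_prop)

lemma IsNonzeroMeromorphic.continuousAt_logDerivOp (hf : IsNonzeroMeromorphic f) {w : ℂ}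
    (hw : w ∈ upperHalfPlaneSet) (h : f (ofComplex w) ≠ 0) :
    ContinuousAt (logDerivOp k f ∘ ofComplex) w := by
  have ha := hf.analyticAt hw h
  have h1 : ContinuousAt (fun w : ℂ ↦ (2 * π * I)⁻¹ * logDeriv (f ∘ ofComplex) w -
      k / (4 * π) * (w.im : ℂ)⁻¹) w := by
    have h2 : ContinuousAt (logDeriv (f ∘ ofComplex)) w :=
      ha.deriv.continuousAt.div ha.continuousAt h
    have h3 : ContinuousAt (fun w : ℂ ↦ (w.im : ℂ)⁻¹) w :=
      (continuous_ofReal.comp Complex.continuous_im).continuousAt.inv₀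
        (ofReal_ne_zero.2 (ne_of_gt hw))
    exact (continuousAt_const.mul h2).sub (continuousAt_const.mul h3)
  refine h1.congr ?_
  filter_upwards [isOpen_upperHalfPlaneSet.mem_nhds hw] with z hz
  exact (logDerivOp_comp_ofComplex k f hz).symm

lemma continuousAt_of_contDiffOn {φ : ℍ → ℂ}
    (hφ : ContDiffOn ℝ ∞ (φ ∘ ofComplex) upperHalfPlaneSet) {w : ℂ}
    (hw : w ∈ upperHalfPlaneSet) : ContinuousAt (φ ∘ ofComplex) w :=
  hφ.continuousOn.continuousAt (isOpen_upperHalfPlaneSet.mem_nhds hw)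

lemma IsNonzeroMeromorphic.continuous_horizontal_pairing₁ (hf : IsNonzeroMeromorphic f)
    (hg : ContDiffOn ℝ ∞ (g ∘ ofComplex) upperHalfPlaneSet) {y : ℝ} (hy : 0 < y)
    (hfy : ∀ τ : ℍ, y ≤ τ.im → f τ ≠ 0) :
    Continuous fun t : ℝ ↦ pairing₁ k f g (ofComplex ((t : ℂ) + y * I)) :=
  continuous_horizontal fun t ↦
    (hf.continuousAt_logDerivOp (horizontal_mem hy t) (hf.horizontal_ne_zero hy hfy t)).mul
      (continuousAt_of_contDiffOn (contDiffOn_xiOp 2 hg) (horizontal_mem hy t))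

lemma IsNonzeroMeromorphic.continuous_horizontal_pairing₂ (hf : IsNonzeroMeromorphic f)
    (hg : ContDiffOn ℝ ∞ (g ∘ ofComplex) upperHalfPlaneSet) {y : ℝ} (hy : 0 < y)
    (hfy : ∀ τ : ℍ, y ≤ τ.im → f τ ≠ 0) :
    Continuous fun t : ℝ ↦ pairing₂ k f g (ofComplex ((t : ℂ) + y * I)) :=
  continuous_horizontal fun t ↦
    ((hf.continuousAt_logNorm k (horizontal_mem hy t) (hf.horizontal_ne_zero hy hfy t)).mul
      (continuousAt_of_contDiffOn (contDiffOn_lapOp 2 hg) (horizontal_mem hy t))).add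
      (continuousAt_const.mul (continuousAt_of_contDiffOn hg (horizontal_mem hy t)))

variable [Fintype (SL(2, ℤ) ⧸ Gamma0 N)]
  (hf : IsNonzeroMeromorphic f) (hfΓ : ∀ γ ∈ Gamma0 N, f ∣[k] γ = f)
  (hg : ContDiffOn ℝ ∞ (g ∘ ofComplex) upperHalfPlaneSet)
  (hgΓ : ∀ γ ∈ Gamma0 N, g ∣[(2 : ℤ)] γ = g) {y : ℝ} (hy : 2 ≤ y)
  (hfy : ∀ (γ : SL(2, ℤ)) (τ : ℍ), y ≤ τ.im → (f ∣[k] γ) τ ≠ 0)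
  {X : ℂ → ℝ} (hX : ContDiff ℝ ∞ X) (hc : HasCompactSupport X)
  (hXV : tsupport X ⊆ upperHalfPlaneSet) (hXim : ∀ τ : ℍ, X τ ≠ 0 → 1 / 2 < τ.im)
  (hsum : ∀ τ ∈ truncatedPlane y, ∀ᶠ τ' in 𝓝 τ, ∑ᶠ γ : SL(2, ℤ), X ((γ • τ' : ℍ) : ℂ) = 1)

include hf hfΓ hg hgΓ hy hfy hX hc hXim hsum in
-- At height `y` and above no `f ∣ γ` vanishes, so the equivariance of `𝒟_k f` is available at every
-- point of the line.
lemma sum_boundary₁ [NeZero N] [Fintype (CuspClass N)] {σ : CuspClass N → SL(2, ℤ)}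
    (hσ : ∀ ρ, cuspClassOf N (σ ρ) = ρ) :
    -2 * π * ∑ q : SL(2, ℤ) ⧸ Gamma0 N, ∫ t : ℝ, (X (t + y * I) : ℂ) *
        pairing₁ k (f ∣[k] (q.out)⁻¹) (g ∣[(2 : ℤ)] (q.out)⁻¹) (ofComplex ((t : ℂ) + y * I)) =
      1 / 2 * ∑ ρ, cuspTerm₁ N k f g (σ ρ) y := by
  have h0 : 0 < y := by linarith
  rw [sum_integral_horizontal hσ hX.continuous hc hXim hy (fun τ hτ ↦ (hsum τ hτ).self_of_nhds)
    (c := fun γ ↦ pairing₁ k (f ∣[k] γ) (g ∣[(2 : ℤ)] γ))]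
  · simp only [cuspTerm₁, ← Finset.mul_sum]
    rw [mul_left_comm]
    congr 3 with ρ
    unfold horizontalIntegral
    congr 1 with t
    have hne := (hf.slash k (σ ρ)).horizontal_ne_zero h0 (hfy (σ ρ)) t
    rw [pairing₁, hf.logDerivOp_slash k (σ ρ) ((slash_apply_ne_zero_iff k f _ _).mp hne),
      xiOp_two_slash (σ ρ) hg]
  · intro δ hδ γ
    simp only [slash_mul_eq hfΓ hδ, slash_mul_eq hgΓ hδ]
  · intro γ n t
    rw [hf.pairing₁_slash_mul hg, slash_T_zpow_apply]
    rw [T_zpow_smul_ofComplex h0]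
    exact (hf.slash k γ).horizontal_ne_zero h0 (hfy γ) _
  · exact fun γ ↦ (hf.slash k γ).continuous_horizontal_pairing₁ (contDiffOn_slash 2 γ hg) h0 (hfy γ)

include hf hfΓ hg hgΓ hy hfy hX hc hXim hsum in
lemma sum_boundary₂ [NeZero N] [Fintype (CuspClass N)] {σ : CuspClass N → SL(2, ℤ)}
    (hσ : ∀ ρ, cuspClassOf N (σ ρ) = ρ) :
    ∑ q : SL(2, ℤ) ⧸ Gamma0 N, ∫ t : ℝ, (X (t + y * I) : ℂ) *
        pairing₂ k (f ∣[k] (q.out)⁻¹) (g ∣[(2 : ℤ)] (q.out)⁻¹) (ofComplex ((t : ℂ) + y * I)) =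
      1 / 2 * ∑ ρ, cuspTerm₂ N k f g (σ ρ) y := by
  have h0 : 0 < y := by linarith
  rw [sum_integral_horizontal hσ hX.continuous hc hXim hy (fun τ hτ ↦ (hsum τ hτ).self_of_nhds)
    (c := fun γ ↦ pairing₂ k (f ∣[k] γ) (g ∣[(2 : ℤ)] γ))]
  · simp only [cuspTerm₂]
    congr 2 with ρ
    unfold horizontalIntegral
    congr 1 with t
    rw [pairing₂, lapOp_two_slash (σ ρ) hg]
  · intro δ hδ γ
    simp only [slash_mul_eq hfΓ hδ, slash_mul_eq hgΓ hδ]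
  · intro γ n t
    rw [pairing₂_slash_mul hg, slash_T_zpow_apply]
  · exact fun γ ↦ (hf.slash k γ).continuous_horizontal_pairing₂ (contDiffOn_slash 2 γ hg) h0 (hfy γ)

include hy hX hc hXV hXim hsum in
-- A single coset does not give zero; the sum over all cosets does, because it has weight `2` under
-- the full modular group.
lemma sum_setIntegral_dbar_eq_zero {c : SL(2, ℤ) → ℍ → ℂ}
    (hcΓ : ∀ δ ∈ Gamma0 N, ∀ γ, c (δ * γ) = c γ)
    (hcm : ∀ᵐ τ : ℍ, ∀ γ δ : SL(2, ℤ), c (γ * δ) τ = (c γ ∣[(2 : ℤ)] δ) τ)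
    (hi : ∀ γ, Integrable fun τ : ℍ ↦ (τ.im : ℂ) ^ 2 * dbar (fun τ ↦ (X τ : ℂ)) τ * c γ τ) :
    ∑ q : SL(2, ℤ) ⧸ Gamma0 N, ∫ τ in {τ : ℍ | τ.im ≤ y},
      2 * I * ((τ.im : ℂ) ^ 2 * dbar (fun τ ↦ (X τ : ℂ)) τ * c (q.out)⁻¹ τ) = 0 := by
  have h1 : ∀ q : SL(2, ℤ) ⧸ Gamma0 N, ∫ τ in {τ : ℍ | τ.im ≤ y},
      2 * I * ((τ.im : ℂ) ^ 2 * dbar (fun τ ↦ (X τ : ℂ)) τ * c (q.out)⁻¹ τ) =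
      2 * I * ∫ τ in truncatedPlane y,
        (τ.im : ℂ) ^ 2 * dbar (fun τ ↦ (X τ : ℂ)) τ * c (q.out)⁻¹ τ := fun q ↦ by
    rw [integral_const_mul, setIntegral_truncatedPlane hy]
    intro τ hτ
    simp [dbar_coe_eq_zero_of_im_lt hXim hτ]
  simp only [h1]
  rw [← Finset.mul_sum, ← integral_finsetSum _ fun q _ ↦ (hi _).integrableOn]
  simp only [← Finset.mul_sum]
  rw [setIntegral_dbar_eq_zero (isClosed_truncatedPlane y).measurableSet
    (fun γ τ ↦ smul_mem_truncatedPlane γ y τ) hX hc hXV hsum, mul_zero]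
  · filter_upwards [hcm] with τ hτ γ
    have h2 : ∀ q : SL(2, ℤ) ⧸ Gamma0 N,
        c (q.out)⁻¹ (γ • τ) = denom γ τ ^ 2 * c ((q.out)⁻¹ * γ) τ := fun q ↦ by
      rw [hτ, ModularForm.SL_slash_apply, mul_left_comm, ← zpow_natCast, ← zpow_add₀ (denom_ne γ τ)]
      simp
    simp only [h2, ← Finset.mul_sum]
    rw [sum_cosets_mul (c := fun γ ↦ c γ τ) fun δ hδ γ ↦ by rw [hcΓ δ hδ]]
  · simp only [Finset.mul_sum]
    exact integrable_finsetSum _ fun q _ ↦ (hi _).integrableOn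

end Identity

end RohrlichDivisor

end

noncomputable section

namespace RohrlichDivisor

/-! ### Assembling the truncated formula from the sums over cosets -/

lemma finsum_ofReal {α : Type*} (x : α → ℝ) : ∑ᶠ a, (x a : ℂ) = ((∑ᶠ a, x a : ℝ) : ℂ) :=
  (AddMonoidHom.map_finsum_of_injective ofRealHom.toAddMonoidHom ofReal_injective x).symm

/-- The formula over a fundamental domain truncated at height `y`. -/
theorem IsClosedFundamentalDomain.setIntegral_eq {N : ℕ} [NeZero N]
    [Fintype (CuspClass N)] {F : Set ℍ} (hF : IsClosedFundamentalDomain N F) {k : ℤ} {f g : ℍ → ℂ}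
    (hf : IsNonzeroMeromorphic f) (hfΓ : ∀ γ ∈ Gamma0 N, f ∣[k] γ = f)
    (hg : ContDiffOn ℝ ∞ (g ∘ ofComplex) upperHalfPlaneSet)
    (hgΓ : ∀ γ ∈ Gamma0 N, g ∣[(2 : ℤ)] γ = g) {y : ℝ} (hy : 2 ≤ y)
    (hfy : ∀ (γ : SL(2, ℤ)) (τ : ℍ), y ≤ τ.im → (f ∣[k] γ) τ ≠ 0)
    (hFy : IsCompact (F ∩ truncatedPlane y)) {σ : CuspClass N → SL(2, ℤ)}
    (hσ : ∀ ρ, cuspClassOf N (σ ρ) = ρ) :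
    ∫ τ in F ∩ truncatedPlane y, xiOp 2 (lapOp 2 g) τ * logNorm k f τ =
      -2 * π * divisorSum N f (xiOp 2 g) +
        ∑ ρ, (cuspTerm₁ N k f g (σ ρ) y + conj (cuspTerm₂ N k f g (σ ρ) y)) := by
  have h0 : 0 < y := by linarith
  let _ : Fintype (SL(2, ℤ) ⧸ Gamma0 N) := Fintype.ofFinite _
  obtain ⟨X, hX, hc, hXV, hXim, hsum⟩ := exists_partition y
  have hL := coe_preimage_tsupport hc hXV
  have hxL : ∀ τ : ℍ, (X τ : ℂ) ≠ 0 → τ ∈ UpperHalfPlane.coe ⁻¹' tsupport X := fun τ hτ ↦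
    subset_tsupport X (ofReal_ne_zero.1 hτ)
  have hsum' : ∀ τ ∈ truncatedPlane y, ∑ᶠ γ : SL(2, ℤ), (X ((γ • τ : ℍ) : ℂ) : ℂ) = 1 :=
    fun τ hτ ↦ by
      rw [finsum_ofReal, (hsum τ hτ).self_of_nhds, ofReal_one]
  have hΦ : ∀ γ τ, xiOp 2 (lapOp 2 g) (γ • τ) * logNorm k f (γ • τ) =
      xiOp 2 (lapOp 2 (g ∣[(2 : ℤ)] γ)) τ * logNorm k (f ∣[k] γ) τ := fun γ τ ↦ by
    rw [xiOp_lapOp_slash hg, logNorm_slash]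
  have hord : ∀ γ τ, (ordAt f (γ • τ) : ℂ) * xiOp 2 g (γ • τ) =
      ordAt (f ∣[k] γ) τ * xiOp 2 (g ∣[(2 : ℤ)] γ) τ := fun γ τ ↦ by
    rw [hf.ordAt_slash, xiOp_two_slash γ hg, slash_zero_apply]
  have hord0 : ∀ z, (ordAt f z : ℂ) * xiOp 2 g z ≠ 0 → f z = 0 := fun z hz ↦ by
    by_contra h
    exact hz (by simp [hf.ordAt_eq_zero h])
  have hcont : Continuous (xiOp 2 (lapOp 2 g)) :=
    continuous_of_contDiffOn (contDiffOn_xiOp 2 (contDiffOn_lapOp 2 hg))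
  have hD : divisorSum N f (xiOp 2 g) = 2 * ∑ q : SL(2, ℤ) ⧸ Gamma0 N, ∑ᶠ z : ℍ,
      (X z : ℂ) * (ordAt (f ∣[k] (q.out)⁻¹) z * xiOp 2 (g ∣[(2 : ℤ)] (q.out)⁻¹) z) := by
    have := divisorSum_unfold (N := N) (x := fun τ ↦ (X τ : ℂ))
      (φ := fun z ↦ (ordAt f z : ℂ) * xiOp 2 g z) hL hxL
      (fun z hz ↦ hsum' z (mem_truncatedPlane_of_eq_zero hfy (hord0 z hz)))
      (fun γ hγ τ ↦ by simp only [hord, hfΓ γ hγ, hgΓ γ hγ])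
      (fun K hK ↦ (hf.finite_zeros hK).subset fun z hz ↦ ⟨hz.1, hord0 z hz.2⟩)
    simp only [hord] at this
    rw [← this, divisorSum]
    exact finsum_congr fun o ↦ by ring
  rw [hF.setIntegral_inter (isClosed_truncatedPlane y).measurableSet
    (fun γ τ ↦ smul_mem_truncatedPlane γ y τ) (x := fun τ ↦ (X τ : ℂ))
    (continuous_ofReal.comp (hX.continuous.comp UpperHalfPlane.continuous_coe)) hL hxL hsum' hFy
    (fun γ hγ τ ↦ by rw [hΦ, hfΓ γ hγ, hgΓ γ hγ]) (hf.integrableOn_mul_logNorm k hcont hFy)]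
  simp only [hΦ, ← Finset.mul_sum, mul_left_comm _ (2 : ℂ)]
  rw [integral_const_mul]
  simp only [Finset.mul_sum]
  rw [integral_finsetSum _ fun q _ ↦ ((hf.slash k _).integrable_coe_mul k
    (contDiffOn_slash 2 _ hg) hX hc hXV).integrableOn]
  have hgreen : ∀ q : SL(2, ℤ) ⧸ Gamma0 N, _ := fun q ↦
    (setIntegral_truncatedPlane (h := fun τ ↦ (X τ : ℂ) *
      (xiOp 2 (lapOp 2 (g ∣[(2 : ℤ)] (q.out)⁻¹)) τ * logNorm k (f ∣[k] (q.out)⁻¹) τ)) hy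
      fun τ hτ ↦ by
        have : X τ = 0 := by
          by_contra h
          exact (hXim τ h).not_gt hτ
        simp [this]).symm.trans
    ((hf.slash k (q.out)⁻¹).green k (contDiffOn_slash 2 (q.out)⁻¹ hg) hX hc hXV h0 (hfy (q.out)⁻¹))
  simp only [hgreen]
  have hB₁ := sum_boundary₁ hf hfΓ hg hgΓ hy hfy hX hc hXim hsum hσ
  have hB₂ := sum_boundary₂ hf hfΓ hg hgΓ hy hfy hX hc hXim hsum hσ
  have hE₁ := sum_setIntegral_dbar_eq_zero (N := N) hy hX hc hXV hXim hsum
    (c := fun γ ↦ pairing₁ k (f ∣[k] γ) (g ∣[(2 : ℤ)] γ))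
    (fun δ hδ γ ↦ by simp only [slash_mul_eq hfΓ hδ, slash_mul_eq hgΓ hδ])
    (by
      filter_upwards [hf.ae_ne_zero] with τ hτ γ δ
      refine hf.pairing₁_slash_mul hg γ δ ((slash_apply_ne_zero_iff k f γ _).mpr ?_)
      rw [← mul_smul]
      exact hτ _)
    fun γ ↦ (hf.slash k γ).integrable_dbar_mul_pairing₁ k (contDiffOn_slash 2 γ hg) hX hc hXV
  have hE₂ := sum_setIntegral_dbar_eq_zero (N := N) hy hX hc hXV hXim hsum
    (c := fun γ ↦ pairing₂ k (f ∣[k] γ) (g ∣[(2 : ℤ)] γ))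
    (fun δ hδ γ ↦ by simp only [slash_mul_eq hfΓ hδ, slash_mul_eq hgΓ hδ])
    (ae_of_all _ fun τ γ δ ↦ pairing₂_slash_mul hg γ δ τ)
    fun γ ↦ (hf.slash k γ).integrable_dbar_mul_pairing₂ k (contDiffOn_slash 2 γ hg) hX hc hXV
  simp only [Finset.sum_add_distrib, Finset.sum_sub_distrib, ← Finset.mul_sum, ← map_sum]
  -- The factor `2` from unfolding cancels the `1/2` of the horocycle sums and is contained in the
  -- divisor sum.
  rw [hE₁, hE₂, hB₁, hB₂, hD]
  simp only [map_mul, map_div₀, map_one, map_ofNat, map_zero]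
  ring

end RohrlichDivisor

end

noncomputable section

namespace RohrlichDivisor

/-! ### Behaviour at the cusps -/

/-- On the connected half plane the order is infinite everywhere or nowhere, and it is `0` where `f`
has a nonzero value. -/
lemma IsMeromorphicModularForm.isNonzeroMeromorphic {N : ℕ} {k : ℤ} {f : ℍ → ℂ}
    (hf : IsMeromorphicModularForm N k f) (hf0 : f ≠ 0) : IsNonzeroMeromorphic f := by
  refine ⟨hf.meromorphic, fun z hz ↦ ?_⟩
  obtain ⟨τ, hτ⟩ := Function.ne_iff.1 hf0
  have hconn : IsConnected upperHalfPlaneSet :=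
    (convex_halfSpace_im_gt 0).isConnected ⟨I, by simp⟩
  have h := (hf.meromorphic.meromorphicOn.exists_meromorphicOrderAt_ne_top_iff_forall hconn).1
    ⟨⟨τ, τ.im_pos⟩, by
      rw [((hf.meromorphic τ.im_pos).meromorphicOrderAt_eq_zero_iff).2 (by simpa using hτ)]
      exact WithTop.zero_ne_top⟩
  exact h ⟨z, hz⟩

lemma periodic_slash_comp_ofComplex {N : ℕ} [NeZero N] {m : ℤ} {φ : ℍ → ℂ}
    (hφ : ∀ γ ∈ Gamma0 N, φ ∣[m] γ = φ) (σ : SL(2, ℤ)) :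
    Function.Periodic ((φ ∣[m] σ) ∘ ofComplex) ((cuspWidth N σ : ℝ) : ℂ) := fun w ↦ by
  rcases le_or_gt w.im 0 with hw | hw
  -- Outside the half plane `ofComplex` takes a constant default value, so periodicity is automatic
  -- there.
  · simp only [Function.comp_apply]
    rw [ofComplex_apply_of_im_nonpos hw, ofComplex_apply_of_im_nonpos (by simpa using hw)]
  · have h1 : ofComplex (w + ((cuspWidth N σ : ℝ) : ℂ)) =
        ModularGroup.T ^ (cuspWidth N σ : ℤ) • ofComplex w := by
      apply UpperHalfPlane.ext
      rw [ModularGroup.coe_T_zpow_smul_eq, coe_ofComplex hw, coe_ofComplex]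
      · simp
      · simpa [upperHalfPlaneSet] using hw
    simp only [Function.comp_apply]
    rw [h1, ← slash_T_zpow_apply (φ ∣[m] σ) m, ← SlashAction.slash_mul,
      show σ * ModularGroup.T ^ (cuspWidth N σ : ℤ) =
        (σ * ModularGroup.T ^ cuspWidth N σ * σ⁻¹) * σ by simp,
      slash_mul_eq hφ (cuspWidth_spec σ).2]

/-- In the local parameter at the cusp a meromorphic function either vanishes near `0` or has no
zeros in a punctured neighbourhood. The first case would make `f ∣ σ` vanish on an open set. -/
lemma IsMeromorphicModularForm.exists_slash_ne_zero {N : ℕ} [NeZero N] {k : ℤ} {f : ℍ → ℂ}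
    (hf : IsMeromorphicModularForm N k f) (hf0 : f ≠ 0) (σ : SL(2, ℤ)) :
    ∃ y₀ : ℝ, ∀ τ : ℍ, y₀ ≤ τ.im → (f ∣[k] σ) τ ≠ 0 := by
  have hℓ : (0 : ℝ) < cuspWidth N σ := Nat.cast_pos.2 (cuspWidth_spec σ).1
  have hper := periodic_slash_comp_ofComplex hf.slash_eq σ
  have hq := Function.Periodic.qParam_tendsto hℓ
  have hcomap : ∀ p : ℂ → Prop, (∀ᶠ w in comap Complex.im atTop, p w) →
      ∃ y₀ : ℝ, ∀ w : ℂ, y₀ ≤ w.im → p w := fun p hp ↦ by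
    obtain ⟨s, hs, hsp⟩ := mem_comap.1 hp
    obtain ⟨y₀, h⟩ := mem_atTop_sets.1 hs
    exact ⟨y₀, fun w hw ↦ hsp (h _ hw)⟩
  rcases (hf.meromorphic_at_cusps σ).eventually_eq_zero_or_eventually_ne_zero with h | h
  · exfalso
    obtain ⟨y₀, h1⟩ := hcomap _ (hq.eventually h)
    simp only [Function.Periodic.eq_cuspFunction hℓ.ne' hper] at h1
    set w : ℂ := ((max y₀ 0 + 1 : ℝ) : ℂ) * I with hw
    have him : w.im = max y₀ 0 + 1 := by simp [hw]
    have hwV : w ∈ upperHalfPlaneSet := by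
      change 0 < w.im
      rw [him]
      positivity
    refine ((hf.isNonzeroMeromorphic hf0).slash k σ).order_ne_top w hwV
      (meromorphicOrderAt_eq_top_iff.2 (Filter.Eventually.filter_mono nhdsWithin_le_nhds ?_))
    filter_upwards [(isOpen_lt continuous_const Complex.continuous_im).mem_nhds
      (show y₀ < w.im by rw [him]; linarith [le_max_left y₀ 0])] with z hz
    exact h1 z (le_of_lt hz)
  · obtain ⟨y₀, h1⟩ := hcomap _ (hq.eventually h)
    simp only [Function.Periodic.eq_cuspFunction hℓ.ne' hper] at h1
    exact ⟨y₀, fun τ hτ ↦ by simpa using h1 τ hτ⟩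

lemma IsMeromorphicModularForm.exists_forall_slash_ne_zero {N : ℕ} [NeZero N] {k : ℤ} {f : ℍ → ℂ}
    (hf : IsMeromorphicModularForm N k f) (hf0 : f ≠ 0) :
    ∃ y₀ : ℝ, ∀ (γ : SL(2, ℤ)) (τ : ℍ), y₀ ≤ τ.im → (f ∣[k] γ) τ ≠ 0 := by
  choose y₀ h using fun q : SL(2, ℤ) ⧸ Gamma0 N ↦ hf.exists_slash_ne_zero hf0 (q.out)⁻¹
  obtain ⟨M, hM⟩ := (Set.finite_range y₀).bddAbove
  refine ⟨M, fun γ τ hτ ↦ ?_⟩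
  rw [apply_eq_apply_out (c := fun γ ↦ f ∣[k] γ)
    (fun δ hδ γ ↦ slash_mul_eq hf.slash_eq hδ γ) γ]
  exact h _ τ ((hM ⟨_, rfl⟩).trans hτ)

/-! ### Truncated fundamental domains -/

lemma truncatedPlane_mono {y y' : ℝ} (h : y ≤ y') : truncatedPlane y ⊆ truncatedPlane y' :=
  fun _ hτ γ ↦ (hτ γ).trans h

lemma exists_subset_truncatedPlane {K : Set ℍ} (hK : IsCompact K) :
    ∃ y : ℝ, K ⊆ truncatedPlane y := by
  obtain ⟨a, ha⟩ := (hK.image UpperHalfPlane.continuous_im).bddAbove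
  obtain ⟨b, hb⟩ := (hK.image (UpperHalfPlane.continuous_im.inv₀ fun τ ↦ τ.im_ne_zero)).bddAbove
  exact ⟨max a b, fun τ hτ ↦ mem_truncatedPlane_of_im
    ((ha ⟨τ, hτ, rfl⟩).trans (le_max_left _ _)) ((hb ⟨τ, hτ, rfl⟩).trans (le_max_right _ _))⟩

/-- A point of `F` lies either in the compact truncation at height `1`, which avoids all
sufficiently small horoballs, or in a horoball of height `1` at a cusp of `F`. The latter is
disjoint from the horoballs of height `y ≥ 1` at every other cusp, so only those at the cusps of `F`
matter. -/
lemma IsClosedFundamentalDomain.exists_sdiff_horoball_eq {N : ℕ} {F : Set ℍ}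
    (hF : IsClosedFundamentalDomain N F) : ∃ y₀ : ℝ, ∀ y, y₀ ≤ y →
      F \ ⋃ ρ ∈ cuspsOf F, horoball ρ y = F ∩ truncatedPlane y := by
  obtain ⟨y₁, hy₁⟩ := exists_subset_truncatedPlane (hF.isCompact_truncation 1 one_pos)
  refine ⟨max y₁ 1, fun y hy ↦ Set.Subset.antisymm ?_ ?_⟩
  · rintro τ ⟨hτF, hτ⟩
    refine ⟨hτF, ?_⟩
    simp only [Set.mem_iUnion, not_exists] at hτ
    by_cases hK : τ ∈ F \ ⋃ ρ ∈ cuspsOf F, horoball ρ 1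
    · exact truncatedPlane_mono ((le_max_left _ _).trans hy) (hy₁ hK)
    · have h1 : τ ∈ ⋃ ρ ∈ cuspsOf F, horoball ρ 1 := by
        by_contra h
        exact hK ⟨hτF, h⟩
      simp only [Set.mem_iUnion] at h1
      obtain ⟨ρ, hρ, σ, hσ, τ', hτ', rfl⟩ := h1
      intro γ
      by_contra! h
      rw [← mul_smul] at h
      by_cases h0 : (γ * σ) 1 0 = 0
      · rw [im_smul_of_eq_zero h0] at h
        exact hτ ρ hρ ⟨σ, hσ, τ', h, rfl⟩
      · have h2 := h.trans_le (im_smul_le_inv h0 τ')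
        have h3 := inv_lt_one_of_one_lt₀ hτ'
        linarith [le_max_right y₁ 1]
  · rintro τ ⟨hτF, hτ⟩
    refine ⟨hτF, fun h ↦ ?_⟩
    simp only [Set.mem_iUnion] at h
    obtain ⟨ρ, -, σ, -, τ', hlt, rfl⟩ := h
    have := hτ σ⁻¹
    rw [inv_smul_smul] at this
    exact this.not_gt hlt

/-! ### Shrinking discs -/

/-- The union of the Euclidean `ε`-discs around the points of `Z`. -/
def discs (Z : Set ℍ) (ε : ℝ) : Set ℍ := ⋃ z ∈ Z, {τ : ℍ | ‖(τ : ℂ) - (z : ℂ)‖ < ε}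

lemma isOpen_discs (Z : Set ℍ) (ε : ℝ) : IsOpen (discs Z ε) :=
  isOpen_biUnion fun _ _ ↦ isOpen_lt
    ((UpperHalfPlane.continuous_coe.sub continuous_const).norm) continuous_const

/-- Discs of radius below `Im z / 2` lie in a compact subset of `ℍ`, so a single height works for
all small `ε`. -/
lemma exists_discs_subset_truncatedPlane {Z : Set ℍ} (hZ : Z.Finite) :
    ∃ y : ℝ, ∀ᶠ ε in 𝓝[>] (0 : ℝ), discs Z ε ⊆ truncatedPlane y := by
  have hK : IsCompact (⋃ z ∈ Z, UpperHalfPlane.coe ⁻¹' Metric.closedBall (z : ℂ) (z.im / 2)) :=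
    hZ.isCompact_biUnion fun z _ ↦ isCompact_preimage_coe (isCompact_closedBall _ _) fun w hw ↦ by
      have h1 : |w.im - z.im| ≤ z.im / 2 := by
        have := (Complex.abs_im_le_norm (w - z)).trans (mem_closedBall_iff_norm.1 hw)
        simpa using this
      change 0 < w.im
      linarith [(abs_le.1 h1).1, z.im_pos]
  obtain ⟨y, hy⟩ := exists_subset_truncatedPlane hK
  refine ⟨y, ?_⟩
  have : ∀ᶠ ε in 𝓝[>] (0 : ℝ), ∀ z ∈ Z, ε < z.im / 2 :=
    (eventually_all_finite hZ).2 fun z _ ↦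
      nhdsWithin_le_nhds (eventually_lt_nhds (half_pos z.im_pos))
  filter_upwards [this] with ε hε τ hτ
  simp only [discs, Set.mem_iUnion] at hτ
  obtain ⟨z, hz, h⟩ := hτ
  refine hy (Set.mem_biUnion hz ?_)
  exact mem_closedBall_iff_norm.2 (le_of_lt (lt_trans h (hε z hz)))

lemma tendsto_setIntegral_discs {Z S : Set ℍ} (hZ : Z.Finite) {Φ : ℍ → ℂ}
    (hΦ : IntegrableOn Φ S) :
    Tendsto (fun ε ↦ ∫ τ in S ∩ discs Z ε, Φ τ) (𝓝[>] (0 : ℝ)) (𝓝 0) := by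
  have h1 : ∀ ε, ∫ τ in S ∩ discs Z ε, Φ τ =
      ∫ τ in S, (discs Z ε).indicator Φ τ := fun ε ↦
    (setIntegral_indicator (isOpen_discs Z ε).measurableSet).symm
  simp only [h1]
  rw [← integral_zero ℍ ℂ (μ := volume.restrict S)]
  refine tendsto_integral_filter_of_dominated_convergence (fun τ ↦ ‖Φ τ‖)
    (Eventually.of_forall fun ε ↦
      hΦ.aestronglyMeasurable.indicator (isOpen_discs Z ε).measurableSet)
    (Eventually.of_forall fun ε ↦ ae_of_all _ fun τ ↦ norm_indicator_le_norm_self _ _) hΦ.norm ?_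
  have hZ0 : ∀ᵐ τ : ℍ, τ ∉ Z := measure_eq_zero_iff_ae_notMem.1 (hZ.measure_zero volume)
  filter_upwards [ae_restrict_of_ae hZ0] with τ hτ
  refine tendsto_const_nhds.congr' ?_
  have : ∀ᶠ ε in 𝓝[>] (0 : ℝ), ∀ z ∈ Z, ε < ‖(τ : ℂ) - z‖ :=
    (eventually_all_finite hZ).2 fun z hz ↦ nhdsWithin_le_nhds (eventually_lt_nhds
      (norm_pos_iff.2 (sub_ne_zero.2 fun h ↦ hτ (UpperHalfPlane.ext h ▸ hz))))
  filter_upwards [this] with ε hε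
  rw [Set.indicator_of_notMem]
  simp only [discs, Set.mem_iUnion, not_exists]
  exact fun z hz h ↦ lt_asymm h (hε z hz)

/-- The integrand is integrable over each truncation, and small discs lie below a fixed height. The
integral over the discs is therefore independent of large `y` and tends to `0` with `ε`. -/
lemma hasRegInner_of_tendsto {F : Set ℍ} {φ ψ : ℍ → ℂ} {c : ℂ} {y₀ : ℝ}
    (hfin : ((singularSet φ ∪ singularSet ψ) ∩ F).Finite)
    (hF : ∀ y, y₀ ≤ y → F \ ⋃ ρ ∈ cuspsOf F, horoball ρ y = F ∩ truncatedPlane y)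
    (hi : ∀ y, y₀ ≤ y → IntegrableOn (fun τ ↦ φ τ * conj (ψ τ)) (F ∩ truncatedPlane y))
    (hlim : Tendsto (fun y ↦ ∫ τ in F ∩ truncatedPlane y, φ τ * conj (ψ τ)) atTop (𝓝 c)) :
    HasRegInner F φ ψ c := by
  set Z := (singularSet φ ∪ singularSet ψ) ∩ F with hZ
  have hdom : ∀ ε y, y₀ ≤ y → puncturedDomain F Z ε y =
      (F ∩ truncatedPlane y) \ discs Z ε := fun ε y hy ↦ by
    rw [← hF y hy, puncturedDomain, Set.union_comm, ← Set.sdiff_sdiff]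
    rfl
  obtain ⟨y₁, hy₁⟩ := exists_discs_subset_truncatedPlane hfin
  set y₂ := max y₀ y₁
  refine ⟨hfin, Eventually.of_forall fun ε ↦ ?_,
    fun ε ↦ c - ∫ τ in F ∩ truncatedPlane y₂ ∩ discs Z ε, φ τ * conj (ψ τ), ?_, ?_⟩
  · filter_upwards [eventually_ge_atTop y₀] with y hy
    rw [hdom ε y hy]
    exact (hi y hy).mono_set Set.sdiff_subset
  · filter_upwards [hy₁] with ε hε
    refine (hlim.sub_const _).congr' ?_
    filter_upwards [eventually_ge_atTop y₂] with y hy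
    have hy0 : y₀ ≤ y := (le_max_left _ _).trans hy
    have hinter : F ∩ truncatedPlane y₂ ∩ discs Z ε = F ∩ truncatedPlane y ∩ discs Z ε := by
      ext τ
      constructor
      · exact fun h ↦ ⟨⟨h.1.1, truncatedPlane_mono hy h.1.2⟩, h.2⟩
      · exact fun h ↦ ⟨⟨h.1.1, truncatedPlane_mono (le_max_right _ _) (hε h.2)⟩, h.2⟩
    rw [hdom ε y hy0, hinter,
      ← integral_inter_add_sdiff (isOpen_discs Z ε).measurableSet (hi y hy0), add_sub_cancel_left]
  · simpa using (tendsto_setIntegral_discs hfin (hi y₂ (le_max_left _ _))).const_sub c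

end RohrlichDivisor

end

/-! ### The limit `y → ∞` -/

theorem theorem1p1 (N : ℕ) (hN : 1 ≤ N) (k : ℤ) (f g : ℍ → ℂ)
    (hf : IsMeromorphicModularForm N k f) (hf0 : f ≠ 0)
    (hg : IsSmoothModularForm N 2 g)
    (F : Set ℍ) (hF : IsClosedFundamentalDomain N F)
    (σ : CuspClass N → SL(2, ℤ)) (hσ : ∀ ρ, cuspClassOf N (σ ρ) = ρ)
    (C₁ C₂ : CuspClass N → ℂ)
    (hC₁ : ∀ ρ, Tendsto (cuspTerm₁ N k f g (σ ρ)) atTop (𝓝 (C₁ ρ)))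
    (hC₂ : ∀ ρ, Tendsto (cuspTerm₂ N k f g (σ ρ)) atTop (𝓝 (C₂ ρ))) :
    HasRegInner F (xiOp 2 (lapOp 2 g)) (logNorm k f)
      (-2 * π * divisorSum N f (xiOp 2 g) + ∑ᶠ ρ : CuspClass N, (C₁ ρ + conj (C₂ ρ))) := by
  have : NeZero N := ⟨by omega⟩
  have : Finite (CuspClass N) := finite_cuspClass hσ
  let _ : Fintype (CuspClass N) := Fintype.ofFinite _
  have hn := hf.isNonzeroMeromorphic hf0
  obtain ⟨a, ha⟩ := hf.exists_forall_slash_ne_zero hf0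
  obtain ⟨b, hb⟩ := hF.exists_sdiff_horoball_eq
  -- From height `2` on the partition of unity reduces to translations, from `a` on no `f ∣ γ` has
  -- zeros or poles, and from `b` on the truncation of `F` is `F ∩ truncatedPlane y`.
  set y₀ := max 2 (max a b)
  have h2 : 2 ≤ y₀ := le_max_left _ _
  have ha' : a ≤ y₀ := (le_max_left _ _).trans (le_max_right _ _)
  have hb' : b ≤ y₀ := (le_max_right _ _).trans (le_max_right _ _)
  have hcompact : ∀ y, y₀ ≤ y → IsCompact (F ∩ truncatedPlane y) := fun y hy ↦ by
    rw [← hb y (hb'.trans hy)]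
    exact hF.isCompact_truncation y (by linarith)
  have hξ := contDiffOn_xiOp 2 (contDiffOn_lapOp 2 hg.smooth)
  refine hasRegInner_of_tendsto (y₀ := y₀) ?_ (fun y hy ↦ hb y (hb'.trans hy)) (fun y hy ↦ ?_) ?_
  -- As `ξ_2 Δ_2 g` is smooth, singularities occur only at zeros and poles of `f`, and those in `F`
  -- lie in a compact truncation.
  · refine (hn.finite_zeros (hcompact y₀ le_rfl)).subset fun z hz ↦ ?_
    have h0 : f z = 0 := by
      by_contra h
      refine hz.1.elim (fun h' ↦ h' ?_) fun h' ↦ h' ?_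
      · exact hξ.contDiffAt (isOpen_upperHalfPlaneSet.mem_nhds z.im_pos)
      · exact hn.contDiffAt_logNorm k z.im_pos (by simpa using h)
    exact ⟨⟨hz.2, mem_truncatedPlane_of_eq_zero (fun γ τ hτ ↦ ha γ τ (ha'.trans hτ)) h0⟩, h0⟩
  · simp only [conj_logNorm]
    exact hn.integrableOn_mul_logNorm k (continuous_of_contDiffOn hξ) (hcompact y hy)
  · simp only [conj_logNorm, finsum_eq_sum_of_fintype]
    refine Tendsto.congr' ?_ (tendsto_const_nhds.add (tendsto_finsetSum _ fun ρ _ ↦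
      (hC₁ ρ).add ((continuous_conj.tendsto _).comp (hC₂ ρ))))
    filter_upwards [eventually_ge_atTop y₀] with y hy
    exact (hF.setIntegral_eq hn hf.slash_eq hg.smooth hg.slash_eq (h2.trans hy)
      (fun γ τ hτ ↦ ha γ τ (ha'.trans (hy.trans hτ))) (hcompact y hy) hσ).symm
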